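/- A \emph{polyhedron} is a connected union of finitely many closed tetrahedra in $\mathbb{R}^3$ whose boundary is a 2-manifold. Its \emph{faces} are the maximal planar regions of its boundary with connected non-empty relative interior, i.e. the closures of the connected components of the relative interiors of the intersections of the boundary with planes. A polyhedron is \emph{orthogonal} if each face is orthogonal to a coordinate axis. A \emph{2-reflex orthostack} is an orthogonal polyhedron that has no vertical (parallel to the $z$ axis) reflex edges, i.e. no vertical edges with internal dihedral angle greater than $180^\circ$, and whose non-empty horizontal cross sections are all simply connected. A set $S$ \emph{guards} a polyhedron $\mathcal P$ if the set of all points $y$ for which there is an $x\in S$ such that the segment $xy$ contains no point of the exterior of $\mathcal P$ is all of $\mathcal P$ (boundary included). A \emph{closed face guard} is a face taken together with its relative boundary. \textbf{Theorem.} Every 2-reflex orthostack has finitely many faces, and if it has $f$ faces, then there are $\lfloor (f+1)/7\rfloor$ of its faces, none of which is the topmost horizontal face, whose union (as closed faces) guards the orthostack. -/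

import Mathlib

namespace FaceGuards

/-- Euclidean 3-space; the coordinates are `0`, `1` (horizontal) and `2` (vertical, pointing up). -/
abbrev E3 : Type := EuclideanSpace ℝ (Fin 3)

/-- The solid `P` is bounded by a (two-sided, hence orientable) 2-manifold: near each boundary
point, some local homeomorphism of space flattens the boundary to the plane `z = 0` and `P` to the
half-space `z ≤ 0`. For finite unions of tetrahedra this is the same as saying that the boundary,
as a topological space, is a 2-manifold: near a boundary point `P` is a cone over a polygonal region
of a small sphere, the boundary is a 2-manifold there exactly when that region is bounded by a
single closed polygonal curve, and such a region can be carried to a hemisphere. -/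
def HasManifoldBoundary (P : Set E3) : Prop :=
  ∀ x ∈ frontier P, ∃ e : OpenPartialHomeomorph E3 E3,
    x ∈ e.source ∧ ∀ y ∈ e.source, (y ∈ P ↔ (e y) 2 ≤ 0)

/-- A polyhedron: a connected union of finitely many (nondegenerate, closed) tetrahedra whose
boundary is a 2-manifold. -/
structure IsPolyhedron (P : Set E3) : Prop where
  connected : IsConnected P
  union_tetrahedra : ∃ T : Set (Affine.Simplex ℝ E3 3), T.Finite ∧
    P = ⋃ s ∈ T, convexHull ℝ (Set.range s.points)
  manifold : HasManifoldBoundary P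

/-- The plane with normal vector `n` and equation `⟨n, y⟩ = c`. -/
def plane (n : E3) (c : ℝ) : Set E3 := {y | inner ℝ n y = c}

/-- The interior, relative to the plane `⟨n, y⟩ = c`, of the part of the boundary of `P` that lies
in this plane. -/
def flatPart (P : Set E3) (n : E3) (c : ℝ) : Set E3 :=
  {y | y ∈ plane n c ∧ ∃ ε > 0, plane n c ∩ Metric.ball y ε ⊆ frontier P}

/-- The (closed) faces of `P`: the maximal plane regions in its boundary with connected nonempty
relative interior, that is, the closures of the connected components of the flat parts. -/
def faces (P : Set E3) : Set (Set E3) :=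
  {F | ∃ (n : E3) (c : ℝ), n ≠ 0 ∧ ∃ y ∈ flatPart P n c,
    F = closure (connectedComponentIn (flatPart P n c) y)}

/-- An orthogonal polyhedron: each face is orthogonal to a coordinate axis. -/
structure IsOrthogonalPolyhedron (P : Set E3) : Prop extends IsPolyhedron P where
  orthogonal : ∀ F ∈ faces P, ∃ (i : Fin 3) (c : ℝ), ∀ x ∈ F, x i = c

/-- `x` is a relative interior point of a reflex edge of `P` with direction `d`: near `x`, the solid
`P` is a wedge whose edge has direction `d` and whose internal dihedral angle lies strictly between
180 and 360 degrees, that is, the union of two half-spaces with nonparallel bounding planes through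
that edge. -/
def IsReflexEdgePoint (P : Set E3) (d x : E3) : Prop :=
  ∃ n₁ n₂ : E3, LinearIndependent ℝ ![n₁, n₂] ∧ inner ℝ n₁ d = 0 ∧ inner ℝ n₂ d = 0 ∧
    ∃ ε > 0, ∀ y ∈ Metric.ball x ε,
      (y ∈ P ↔ inner ℝ n₁ (y - x) ≤ 0 ∨ inner ℝ n₂ (y - x) ≤ 0)

/-- The upward vertical unit vector. -/
noncomputable def up : E3 := EuclideanSpace.single 2 1

/-- The horizontal cross section of `P` at height `z`. -/
def crossSection (P : Set E3) (z : ℝ) : Set E3 := {x | x ∈ P ∧ x 2 = z}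

/-- A 2-reflex orthostack: an orthogonal polyhedron without vertical reflex edges, all of whose
(nonempty) horizontal cross sections are simply connected. -/
structure IsTwoReflexOrthostack (P : Set E3) : Prop extends IsOrthogonalPolyhedron P where
  twoReflex : ∀ x, ¬ IsReflexEdgePoint P up x
  orthostack : ∀ z, (crossSection P z).Nonempty → SimplyConnectedSpace (crossSection P z)

/-- The visible region of a set `S` of points: all points `y` such that for some `x ∈ S` no point of
the segment `xy` lies in the exterior of `P`. -/
def visibleRegion (P S : Set E3) : Set E3 :=
  {y | ∃ x ∈ S, ∀ p ∈ segment ℝ x y, p ∉ interior Pᶜ}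

/-- `S` guards `P`: its visible region is the entire polyhedron, boundary included. -/
def Guards (P S : Set E3) : Prop := visibleRegion P S = P

/-- `F` is a topmost horizontal face of `P`: all its points have the maximal height in `P`. -/
def IsTopmostFace (P F : Set E3) : Prop :=
  F ∈ faces P ∧ ∀ x ∈ F, ∀ y ∈ P, y 2 ≤ x 2

end FaceGuards

/-!
An orthostack without vertical reflex edges is a stack of boxes, and the theorem is a count of how
many faces each change of box must create, weighed against how many boxes one face can see.

**The solid is a stack of bricks.** The boundary of a finite union of tetrahedra lies in finitely
many planes, and near a suitable point of any relatively open piece of it the boundary fills one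
such plane. That piece belongs to a face, so the plane is orthogonal to an axis. Hence the whole
boundary lies in finitely many axis-orthogonal planes and the solid is a union of closed cells of a
grid (`IsOrthogonalPolyhedron.exists_gridSolid`). Between the horizontal grid planes, the solid is a
union of quadrants around each vertical grid line. Three filled quadrants form a reflex edge, and
exactly two opposite ones contradict the manifold condition, since small neighbourhoods of a
boundary point meet the interior in a connected set (`HasManifoldBoundary.exists_isPreconnected`).
So opposite quadrants come together with the other two (`quadrant_subset`), and a connected section
between grid heights is a rectangle: a maximal grid rectangle in it cannot be adjacent to further
cells (`GridSolid.section_eq`). Choosing a grid with the fewest horizontal planes, consecutive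
rectangles differ, and they overlap because the section at an interface is connected and the
boundary is a manifold (`IsTwoReflexOrthostack.exists_stack`).

**Counting faces.** At the interface of two bricks each of the four sides moves in, moves out, or
stays. Every side that moves starts a new wall face, and the protruding parts of either rectangle
form horizontal faces, the number of which depends only on the four signs (`newFaces`). Together
with the bottom, the top and the lowest four walls, there are at least `6 + ∑ newFaces` faces
(`Stack.le_card_faces`), so it is enough to use at most `1 + ⌊(∑ newFaces) / 7⌋` guards.

**Guarding.** A face that meets a closed brick sees all of it. A horizontal face at an interface
meets both bricks there, which is enough if that interface and the next one add seven faces. If two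
consecutive interfaces add at most six, a check of the sign patterns
(`signs_of_newFaces_le_six`) shows that a wall of the middle brick meets both of its neighbours, or
that the middle brick has a floor from which the upper brick is visible through the middle one. If
three consecutive interfaces add two faces each, each moves one side only, and a wall on a fourth
side runs along all four bricks. Thus one face always guards a run of bricks that reaches the top or
accounts for seven added faces (`Stack.exists_face_run`), and the greedy choice of runs needs few
enough faces (`Stack.exists_guards_from`). None of them is the topmost face, and since the topmost
face is unique (`Stack.topmostFace_unique`), there are enough other faces to enlarge the set to the
exact cardinality.
-/

namespace FaceGuards

open Set Filter Topology

/-! ### The four horizontal directions -/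

/-- The unit normals of the four sides of a rectangle, in cyclic order: east, north, west, south.
The side opposite to `d` is `d + 2`. -/
noncomputable def sideNormal (d : Fin 4) : E3 :=
  ![EuclideanSpace.single 0 1, EuclideanSpace.single 1 1,
    -EuclideanSpace.single 0 1, -EuclideanSpace.single 1 1] d

/-- The coordinate of `x` in the direction of the normal of side `d`: one of `±x 0`, `±x 1`. -/
noncomputable def reach (d : Fin 4) (x : E3) : ℝ := inner ℝ (sideNormal d) x

@[simp] lemma reach_zero (x : E3) : reach 0 x = x 0 := by
  simp [reach, sideNormal, EuclideanSpace.inner_single_left]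

@[simp] lemma reach_one (x : E3) : reach 1 x = x 1 := by
  simp [reach, sideNormal, EuclideanSpace.inner_single_left]

@[simp] lemma reach_two (x : E3) : reach 2 x = -x 0 := by
  simp [reach, sideNormal, EuclideanSpace.inner_single_left]

@[simp] lemma reach_three (x : E3) : reach 3 x = -x 1 := by
  simp [reach, sideNormal, EuclideanSpace.inner_single_left]

lemma reach_add_two (d : Fin 4) (x : E3) : reach (d + 2) x = -reach d x := by
  fin_cases d
  · exact (reach_two x).trans (by simp)
  · exact (reach_three x).trans (by simp)
  · exact (reach_zero x).trans (by simp)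
  · exact (reach_one x).trans (by simp)

lemma reach_add_three (d : Fin 4) (x : E3) : reach (d + 3) x = -reach (d + 1) x := by
  rw [← reach_add_two, add_assoc]; rfl

lemma reach_add (d : Fin 4) (x y : E3) : reach d (x + y) = reach d x + reach d y :=
  inner_add_right _ _ _

lemma reach_sub (d : Fin 4) (x y : E3) : reach d (x - y) = reach d x - reach d y :=
  inner_sub_right _ _ _

lemma reach_smul (d : Fin 4) (t : ℝ) (x : E3) : reach d (t • x) = t * reach d x :=
  real_inner_smul_right _ _ _

@[fun_prop] lemma continuous_reach (d : Fin 4) : Continuous (reach d) := by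
  unfold reach; fun_prop

@[fun_prop] lemma continuous_coord (i : Fin 3) : Continuous (fun x : E3 => x i) := by
  fun_prop

@[simp] lemma reach_up (d : Fin 4) : reach d up = 0 := by
  fin_cases d
  · exact (reach_zero _).trans (by simp [up])
  · exact (reach_one _).trans (by simp [up])
  · exact (reach_two _).trans (by simp [up])
  · exact (reach_three _).trans (by simp [up])

@[simp] lemma up_two : up 2 = 1 := by simp [up]

@[simp] lemma sideNormal_two (d : Fin 4) : sideNormal d 2 = 0 := by
  fin_cases d <;> simp [sideNormal]

lemma reach_sideNormal (d : Fin 4) : reach d (sideNormal d) = 1 := by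
  fin_cases d
  · exact (reach_zero _).trans (by simp [sideNormal])
  · exact (reach_one _).trans (by simp [sideNormal])
  · exact (reach_two _).trans (by simp [sideNormal])
  · exact (reach_three _).trans (by simp [sideNormal])

lemma reach_succ_sideNormal (d : Fin 4) : reach (d + 1) (sideNormal d) = 0 := by
  fin_cases d
  · exact (reach_one _).trans (by simp [sideNormal])
  · exact (reach_two _).trans (by simp [sideNormal])
  · exact (reach_three _).trans (by simp [sideNormal])
  · exact (reach_zero _).trans (by simp [sideNormal])

lemma reach_sideNormal_succ (d : Fin 4) : reach d (sideNormal (d + 1)) = 0 := by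
  rw [reach, real_inner_comm]; exact reach_succ_sideNormal d

lemma sideNormal_ne_zero (d : Fin 4) : sideNormal d ≠ 0 := fun h => by
  have := reach_sideNormal d
  rw [h] at this
  simp [reach] at this

/-- The four sides listed from `d` on; this reduces statements about all sides to the frame of
`d`. -/
lemma forall_side (d : Fin 4) {p : Fin 4 → Prop} :
    (∀ d', p d') ↔ p d ∧ p (d + 1) ∧ p (d + 2) ∧ p (d + 3) := by
  constructor
  · exact fun h => ⟨h _, h _, h _, h _⟩
  · rintro ⟨h0, h1, h2, h3⟩ d'
    have : d' = d ∨ d' = d + 1 ∨ d' = d + 2 ∨ d' = d + 3 := by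
      revert d'; clear h0 h1 h2 h3; revert d; decide
    rcases this with rfl | rfl | rfl | rfl <;> assumption

/-- The point with coordinates `s`, `t` in the directions `d`, `d + 1` and height `h`. -/
noncomputable def pt (d : Fin 4) (s t h : ℝ) : E3 :=
  s • sideNormal d + t • sideNormal (d + 1) + h • up

section pt
variable (d : Fin 4) (s t h : ℝ)

@[simp] lemma reach_pt : reach d (pt d s t h) = s := by
  simp [pt, reach_add, reach_smul, reach_sideNormal, reach_sideNormal_succ]

@[simp] lemma reach_succ_pt : reach (d + 1) (pt d s t h) = t := by
  simp [pt, reach_add, reach_smul, reach_sideNormal, reach_succ_sideNormal]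

@[simp] lemma reach_add_two_pt : reach (d + 2) (pt d s t h) = -s := by
  rw [reach_add_two, reach_pt]

@[simp] lemma reach_add_three_pt : reach (d + 3) (pt d s t h) = -t := by
  rw [reach_add_three, reach_succ_pt]

@[simp] lemma pt_two : pt d s t h 2 = h := by
  simp [pt]

end pt

lemma ext_reach (d : Fin 4) {x y : E3} (h0 : reach d x = reach d y)
    (h1 : reach (d + 1) x = reach (d + 1) y) (h2 : x 2 = y 2) : x = y := by
  have key : x 0 = y 0 ∧ x 1 = y 1 := by
    fin_cases d
    · exact ⟨by simpa using h0, by simpa using h1⟩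
    · have h1' : reach 2 x = reach 2 y := h1
      exact ⟨by simpa using h1', by simpa using h0⟩
    · have h1' : reach 3 x = reach 3 y := h1
      exact ⟨by simpa using h0, by simpa using h1'⟩
    · have h1' : reach 0 x = reach 0 y := h1
      exact ⟨by simpa using h1', by simpa using h0⟩
  ext i
  fin_cases i
  · exact key.1
  · exact key.2
  · exact h2

lemma pt_reach (d : Fin 4) (x : E3) : pt d (reach d x) (reach (d + 1) x) (x 2) = x :=
  ext_reach d (by simp) (by simp) (by simp)

lemma continuous_pt (d : Fin 4) :
    Continuous (fun q : ℝ × ℝ × ℝ => pt d q.1 q.2.1 q.2.2) := by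
  unfold pt; fun_prop

@[simp] lemma pt_zero_zero (s t h : ℝ) : pt 0 s t h 0 = s := by
  have := reach_pt 0 s t h; simpa only [reach_zero] using this

@[simp] lemma pt_zero_one (s t h : ℝ) : pt 0 s t h 1 = t := by
  have := reach_succ_pt 0 s t h
  have h2 : reach 1 (pt 0 s t h) = t := this
  simpa only [reach_one] using h2

lemma pt_zero_coord (p : E3) : pt 0 (p 0) (p 1) (p 2) = p := by
  have := pt_reach 0 p
  rwa [show (0 : Fin 4) + 1 = 1 from rfl, reach_zero, reach_one] at this

/-! ### Finite sets of reals -/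

lemma eventually_gt_notMem (C : Finset ℝ) (x : ℝ) : ∀ᶠ t in 𝓝[>] x, t ∉ C := by
  have h := C.finite_toSet.eventually_cofinite_notMem
  exact (h.filter_mono (nhdsNE_le_cofinite x)).filter_mono (nhdsWithin_mono x fun _ h => ne_of_gt h)

/-- Just above `x` there is an interval free of members of `C`. -/
lemma exists_gap_right (C : Finset ℝ) (x : ℝ) : ∃ δ > 0, ∀ c ∈ C, x < c → x + δ < c := by
  induction C using Finset.induction_on with
  | empty => exact ⟨1, one_pos, by simp⟩
  | insert a C _ ih =>
    obtain ⟨δ, hδ, h⟩ := ih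
    by_cases ha : x < a
    · refine ⟨min δ ((a - x) / 2), lt_min hδ (by linarith), fun c hc hx => ?_⟩
      have h1 := min_le_left δ ((a - x) / 2)
      have h2 := min_le_right δ ((a - x) / 2)
      rcases Finset.mem_insert.1 hc with rfl | hc
      · linarith
      · linarith [h c hc hx]
    · refine ⟨δ, hδ, fun c hc hx => ?_⟩
      rcases Finset.mem_insert.1 hc with rfl | hc
      · exact absurd hx ha
      · exact h c hc hx

/-- A predicate on the reals of an open interval outside a finite set `C` that takes equal values at
any two points between which there is at most one member of `C` is constant. -/
lemma iff_of_iff_of_subsingleton (C : Finset ℝ) {lo hi : ℝ} {p : ℝ → Prop}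
    (h : ∀ y₁ y₂, lo < y₁ → y₁ < y₂ → y₂ < hi → y₁ ∉ C → y₂ ∉ C →
      (∀ c ∈ C, ∀ c' ∈ C, c ∈ Icc y₁ y₂ → c' ∈ Icc y₁ y₂ → c = c') → (p y₁ ↔ p y₂))
    {y₁ y₂ : ℝ} (h₁ : lo < y₁) (h₁₂ : y₁ < y₂) (h₂ : y₂ < hi) (hy₁ : y₁ ∉ C) (hy₂ : y₂ ∉ C) :
    p y₁ ↔ p y₂ := by
  generalize hn : (C.filter fun c => y₁ < c ∧ c < y₂).card = n
  induction n using Nat.strong_induction_on generalizing y₁ with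
  | _ n ih =>
    rcases (C.filter fun c => y₁ < c ∧ c < y₂).eq_empty_or_nonempty with he | hne
    · refine h _ _ h₁ h₁₂ h₂ hy₁ hy₂ fun c hc _ _ hi _ => ?_
      have h1 : y₁ ≠ c := fun e => hy₁ (e ▸ hc)
      have h2 : c ≠ y₂ := fun e => hy₂ (e ▸ hc)
      have : c ∈ C.filter fun c => y₁ < c ∧ c < y₂ :=
        Finset.mem_filter.2 ⟨hc, lt_of_le_of_ne hi.1 h1, lt_of_le_of_ne hi.2 h2⟩
      simp [he] at this
    · set m := (C.filter fun c => y₁ < c ∧ c < y₂).min' hne with hm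
      have hmem := (C.filter fun c => y₁ < c ∧ c < y₂).min'_mem hne
      rw [← hm, Finset.mem_filter] at hmem
      obtain ⟨hmC, hm1, hm2⟩ := hmem
      obtain ⟨δ, hδ, hgap⟩ := exists_gap_right C m
      obtain ⟨y, hy1, hy2⟩ := exists_between (lt_min (lt_add_of_pos_right m hδ) hm2)
      have hy3 := lt_of_lt_of_le hy2 (min_le_left _ _)
      have hy4 := lt_of_lt_of_le hy2 (min_le_right _ _)
      have hyC : y ∉ C := fun hc => by linarith [hgap y hc hy1]
      have hstep : p y₁ ↔ p y := by
        have hu : ∀ c ∈ C, c ∈ Icc y₁ y → c = m := by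
          intro c hc hi
          have h1 : y₁ ≠ c := fun e => hy₁ (e ▸ hc)
          have h2 : m ≤ c := Finset.min'_le _ _ (Finset.mem_filter.2
            ⟨hc, lt_of_le_of_ne hi.1 h1, lt_of_le_of_lt hi.2 hy4⟩)
          by_contra hne'
          have := hgap c hc (lt_of_le_of_ne h2 (Ne.symm hne'))
          linarith [hi.2]
        exact h _ _ h₁ (hm1.trans hy1) (hy4.trans h₂) hy₁ hyC fun c hc c' hc' hi hi' =>
          (hu c hc hi).trans (hu c' hc' hi').symm
      rw [hstep]
      refine ih _ ?_ (h₁.trans (hm1.trans hy1)) hy4 hyC rfl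
      rw [← hn]
      refine Finset.card_lt_card ((Finset.ssubset_iff_of_subset ?_).2 ⟨m, ?_, ?_⟩)
      · intro c hc
        rw [Finset.mem_filter] at hc ⊢
        exact ⟨hc.1, by linarith [hc.2.1], hc.2.2⟩
      · exact Finset.mem_filter.2 ⟨hmC, hm1, hm2⟩
      · intro hc
        rw [Finset.mem_filter] at hc
        linarith [hc.2.1]

/-! ### From tetrahedra to a grid -/

/-- `P` is a closed bounded solid that is a union of closed cells of the grid formed by the planes
`x i = c` with `c ∈ C i`: membership in `P` is constant on each open cell, and every point of `P` is
a limit of points of `P` in open cells. -/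
structure GridSolid (P : Set E3) (C : Fin 3 → Finset ℝ) : Prop where
  closed : IsClosed P
  bounded : Bornology.IsBounded P
  cell : ∀ p q : E3, (∀ i, ∀ c ∈ C i, c ∉ uIcc (p i) (q i)) → p ∈ P → q ∈ P
  dense : P ⊆ closure {p ∈ P | ∀ i, p i ∉ C i}

lemma affineMap_zero_set_eq_plane (f : E3 →ᵃ[ℝ] ℝ) {a b : E3} (hab : f a ≠ f b) :
    ∃ n : E3, ∃ c : ℝ, n ≠ 0 ∧ {x | f x = 0} = plane n c := by
  set L : E3 →L[ℝ] ℝ := f.linear.toContinuousLinearMap with hL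
  have hf : ∀ x, f x = L x + f 0 := fun x => by
    have := f.map_vadd 0 x
    simpa [hL] using this
  refine ⟨(InnerProductSpace.toDual ℝ E3).symm L, -f 0, ?_, ?_⟩
  · intro h
    have h0 : L = 0 := by simpa using h
    exact hab (by rw [hf a, hf b, h0]; simp)
  · ext x
    simp only [plane, mem_ofPred_eq, InnerProductSpace.toDual_symm_apply]
    rw [hf x]
    constructor <;> intro h <;> linarith

/-- A tetrahedron is compact, is the closure of its interior, and has its boundary in finitely many
planes. -/
lemma simplex_regular (s : Affine.Simplex ℝ E3 3) :
    IsCompact (convexHull ℝ (range s.points)) ∧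
    convexHull ℝ (range s.points) ⊆ closure (interior (convexHull ℝ (range s.points))) ∧
    ∃ Q : Finset (E3 × ℝ), (∀ π ∈ Q, π.1 ≠ 0) ∧
      convexHull ℝ (range s.points) \ interior (convexHull ℝ (range s.points)) ⊆
        ⋃ π ∈ Q, plane π.1 π.2 := by
  classical
  have htop : affineSpan ℝ (range s.points) = ⊤ := by
    rw [s.independent.affineSpan_eq_top_iff_card_eq_finrank_add_one]
    simp
  let b : AffineBasis (Fin 4) ℝ E3 := ⟨s.points, s.independent, htop⟩
  have hb : range s.points = range b := rfl
  rw [hb]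
  have hint := b.interior_convexHull
  have hcl := b.convexHull_eq_nonneg_coord
  have hcomp : IsCompact (convexHull ℝ (range b)) := (finite_range b).isCompact_convexHull (𝕜 := ℝ)
  refine ⟨hcomp, ?_, ?_⟩
  · have hne : (interior (convexHull ℝ (range b))).Nonempty := by
      rw [hint]
      refine ⟨Finset.univ.centroid ℝ b, fun i => ?_⟩
      rw [b.coord_apply_centroid (Finset.mem_univ i)]
      simp
    have := Convex.closure_interior_eq_closure_of_nonempty_interior (𝕜 := ℝ)
      (convex_convexHull ℝ (range b)) hne
    rw [this]
    exact subset_closure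
  · have hcoord : ∀ i : Fin 4, ∃ π : E3 × ℝ, π.1 ≠ 0 ∧ {x | b.coord i x = 0} = plane π.1 π.2 := by
      intro i
      have hne : b.coord i (b i) ≠ b.coord i (b (i + 1)) := by
        have h1 : i ≠ i + 1 := by revert i; decide
        rw [b.coord_apply_eq, b.coord_apply_ne h1]
        exact one_ne_zero
      obtain ⟨n, c, h1, h2⟩ := affineMap_zero_set_eq_plane _ hne
      exact ⟨(n, c), h1, h2⟩
    choose π hπ0 hπ using hcoord
    refine ⟨Finset.univ.image π, ?_, ?_⟩
    · intro x hx
      obtain ⟨i, -, rfl⟩ := Finset.mem_image.1 hx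
      exact hπ0 i
    · rintro x ⟨hx1, hx2⟩
      rw [hint, mem_ofPred_eq, not_forall] at hx2
      obtain ⟨i, hi⟩ := hx2
      rw [hcl] at hx1
      have h0 : x ∈ {x | b.coord i x = 0} := le_antisymm (not_lt.1 hi) (hx1 i)
      rw [hπ i] at h0
      simp only [mem_iUnion]
      exact ⟨π i, Finset.mem_image_of_mem _ (Finset.mem_univ i), h0⟩

/-- A polyhedron is compact, is the closure of its interior, and has its boundary in finitely many
planes. -/
lemma IsPolyhedron.regular {P : Set E3} (hP : IsPolyhedron P) :
    IsCompact P ∧ P ⊆ closure (interior P) ∧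
    ∃ Q : Finset (E3 × ℝ), (∀ π ∈ Q, π.1 ≠ 0) ∧ frontier P ⊆ ⋃ π ∈ Q, plane π.1 π.2 := by
  classical
  obtain ⟨T, hT, hPT⟩ := hP.union_tetrahedra
  have hc : IsCompact P := by
    rw [hPT]
    exact hT.isCompact_biUnion fun s _ => (simplex_regular s).1
  refine ⟨hc, ?_, ?_⟩
  · intro x hx
    rw [hPT] at hx
    simp only [mem_iUnion] at hx
    obtain ⟨s, hs, hxs⟩ := hx
    refine closure_mono (interior_mono ?_) ((simplex_regular s).2.1 hxs)
    rw [hPT]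
    exact subset_biUnion_of_mem
      (u := fun s : Affine.Simplex ℝ E3 3 => convexHull ℝ (range s.points)) hs
  · choose Q hQ0 hQ using fun s : Affine.Simplex ℝ E3 3 => (simplex_regular s).2.2
    refine ⟨hT.toFinset.biUnion Q, ?_, ?_⟩
    · intro π hπ
      obtain ⟨s, -, hs⟩ := Finset.mem_biUnion.1 hπ
      exact hQ0 s π hs
    · intro x hx
      rw [hc.isClosed.frontier_eq] at hx
      obtain ⟨hx1, hx2⟩ := hx
      have hx3 := hx1
      rw [hPT] at hx3
      simp only [mem_iUnion] at hx3
      obtain ⟨s, hs, hxs⟩ := hx3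
      have hsub : convexHull ℝ (range s.points) ⊆ P := by
        rw [hPT]
        exact subset_biUnion_of_mem
          (u := fun s : Affine.Simplex ℝ E3 3 => convexHull ℝ (range s.points)) hs
      have := hQ s ⟨hxs, fun h => hx2 (interior_mono hsub h)⟩
      simp only [mem_iUnion] at this ⊢
      obtain ⟨π, hπ, hxπ⟩ := this
      exact ⟨π, Finset.mem_biUnion.2 ⟨s, hT.mem_toFinset.2 hs, hπ⟩, hxπ⟩

lemma isClosed_plane (n : E3) (c : ℝ) : IsClosed (plane n c) :=
  isClosed_eq (by fun_prop) continuous_const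

lemma convex_plane (n : E3) (c : ℝ) : Convex ℝ (plane n c) :=
  convex_hyperplane (f := fun y => inner ℝ n y)
    ⟨inner_add_right n, fun r y => real_inner_smul_right n y r⟩ c

/-- A preconnected set that avoids the boundary of `P` lies inside or outside `P`. -/
lemma subset_of_disjoint_frontier {P K : Set E3} (hK : IsPreconnected K)
    (hd : Disjoint K (frontier P)) (hne : (K ∩ P).Nonempty) : K ⊆ P := by
  have hsub : K ⊆ interior P ∪ (closure P)ᶜ := fun x hx => by
    by_contra h
    rw [mem_union, not_or, mem_compl_iff, not_not] at h
    exact Set.disjoint_left.1 hd hx ⟨h.2, h.1⟩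
  refine (hK.subset_left_of_subset_union isOpen_interior isClosed_closure.isOpen_compl ?_ hsub
    ?_).trans interior_subset
  · exact Set.disjoint_left.2 fun x h1 h2 => h2 (subset_closure (interior_subset h1))
  · obtain ⟨x, hx, hxP⟩ := hne
    exact ⟨x, hx, (hsub hx).resolve_right fun h => h (subset_closure hxP)⟩

/-- A nonempty relatively open piece of a set covered by finitely many planes contains a smaller one
that lies in a single plane. -/
lemma exists_mem_single_plane {A : Set E3} (Q : Finset (E3 × ℝ)) (U : Set E3) (hU : IsOpen U)
    (hne : (U ∩ A).Nonempty) (hsub : U ∩ A ⊆ ⋃ π ∈ Q, plane π.1 π.2) :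
    ∃ π ∈ Q, ∃ V ⊆ U, IsOpen V ∧ (V ∩ A).Nonempty ∧ V ∩ A ⊆ plane π.1 π.2 := by
  classical
  induction Q using Finset.induction_on generalizing U with
  | empty =>
    obtain ⟨x, hx⟩ := hne
    simpa using hsub hx
  | insert a Q _ ih =>
    by_cases h : ((U \ plane a.1 a.2) ∩ A).Nonempty
    · obtain ⟨π, hπ, V, hV, h1, h2, h3⟩ := ih (U \ plane a.1 a.2)
        (hU.sdiff (isClosed_plane _ _)) h (by
          rintro x ⟨⟨hx1, hx2⟩, hx3⟩
          have := hsub ⟨hx1, hx3⟩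
          simp only [Finset.mem_insert, iUnion_iUnion_eq_or_left, mem_union] at this
          exact this.resolve_left hx2)
      exact ⟨π, Finset.mem_insert_of_mem hπ, V, hV.trans sdiff_subset, h1, h2, h3⟩
    · refine ⟨a, Finset.mem_insert_self _ _, U, le_rfl, hU, hne, fun x hx => ?_⟩
      by_contra hxa
      exact h ⟨x, ⟨hx.1, hxa⟩, hx.2⟩

lemma eventually_add_smul_mem {O : Set E3} (hO : IsOpen O) {w : E3} (hw : w ∈ O) (v : E3) :
    ∀ᶠ t in 𝓝[>] (0 : ℝ), w + t • v ∈ O := by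
  have hc : Continuous fun t : ℝ => w + t • v := by fun_prop
  have : ∀ᶠ t in 𝓝 (0 : ℝ), w + t • v ∈ O :=
    hc.continuousAt.eventually_mem (hO.mem_nhds (by simpa using hw))
  exact this.filter_mono nhdsWithin_le_nhds

lemma mem_closure_of_ray {A : Set E3} {w : E3} (v : E3)
    (h : ∀ᶠ t in 𝓝[>] (0 : ℝ), w + t • v ∈ A) : w ∈ closure A := by
  have hc : Continuous fun t : ℝ => w + t • v := by fun_prop
  have ht : Tendsto (fun t : ℝ => w + t • v) (𝓝[>] 0) (𝓝 w) := by
    have := hc.tendsto 0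
    simp only [zero_smul, add_zero] at this
    exact this.mono_left nhdsWithin_le_nhds
  exact mem_closure_of_tendsto ht h

lemma mem_closure_halfSpace {O : Set E3} (hO : IsOpen O) {w n : E3} (hn : n ≠ 0) (hw : w ∈ O) :
    w ∈ closure ({x | inner ℝ n w < inner ℝ n x} ∩ O) := by
  refine mem_closure_of_ray n ?_
  filter_upwards [eventually_add_smul_mem hO hw n, self_mem_nhdsWithin] with t ht ht0
  refine ⟨?_, ht⟩
  have h0 : (0 : ℝ) < t := ht0
  have h1 : 0 < inner ℝ n n := by
    rw [real_inner_self_eq_norm_sq]; positivity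
  simp only [mem_ofPred_eq, inner_add_right, real_inner_smul_right]
  nlinarith

/-- If the boundary of a regular closed set is locally contained in a plane, then locally it is the
whole plane: the set is on exactly one side. -/
lemma plane_inter_ball_subset_frontier {P V : Set E3} (hcl : IsClosed P)
    (hreg : P ⊆ closure (interior P)) (hV : IsOpen V) {y : E3} (hyV : y ∈ V)
    (hyP : y ∈ frontier P) {n : E3} {c : ℝ} (hn : n ≠ 0)
    (hsub : V ∩ frontier P ⊆ plane n c) :
    ∃ ε > 0, plane n c ∩ Metric.ball y ε ⊆ frontier P := by
  obtain ⟨ε, hε, hball⟩ := Metric.isOpen_iff.1 hV y hyV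
  refine ⟨ε, hε, ?_⟩
  have hyc : inner ℝ n y = c := hsub ⟨hyV, hyP⟩
  set B := Metric.ball y ε with hB
  have hBo : IsOpen B := Metric.isOpen_ball
  have hyB : y ∈ B := Metric.mem_ball_self hε
  -- The two open half balls.
  have hup : IsPreconnected ({x : E3 | c < inner ℝ n x} ∩ B) :=
    ((convex_halfSpace_gt ⟨inner_add_right n, fun r x => real_inner_smul_right n x r⟩ c).inter
      (convex_ball y ε)).isPreconnected
  have hdn : IsPreconnected ({x : E3 | inner ℝ n x < c} ∩ B) :=
    ((convex_halfSpace_lt ⟨inner_add_right n, fun r x => real_inner_smul_right n x r⟩ c).inter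
      (convex_ball y ε)).isPreconnected
  have hupd : Disjoint ({x : E3 | c < inner ℝ n x} ∩ B) (frontier P) :=
    Set.disjoint_left.2 fun x hx hxf => (ne_of_gt hx.1) (hsub ⟨hball hx.2, hxf⟩)
  have hdnd : Disjoint ({x : E3 | inner ℝ n x < c} ∩ B) (frontier P) :=
    Set.disjoint_left.2 fun x hx hxf => (ne_of_lt hx.1) (hsub ⟨hball hx.2, hxf⟩)
  have clup : ∀ w ∈ plane n c ∩ B, w ∈ closure ({x : E3 | c < inner ℝ n x} ∩ B) := by
    rintro w ⟨hw, hwB⟩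
    have := mem_closure_halfSpace hBo hn hwB
    rwa [show inner ℝ n w = c from hw] at this
  have cldn : ∀ w ∈ plane n c ∩ B, w ∈ closure ({x : E3 | inner ℝ n x < c} ∩ B) := by
    rintro w ⟨hw, hwB⟩
    have := mem_closure_halfSpace hBo (neg_ne_zero.2 hn) hwB
    simpa only [inner_neg_left, neg_lt_neg_iff, show inner ℝ n w = c from hw] using this
  by_cases h1 : (({x : E3 | c < inner ℝ n x} ∩ B) ∩ P).Nonempty
  · have s1 := subset_of_disjoint_frontier hup hupd h1
    by_cases h2 : (({x : E3 | inner ℝ n x < c} ∩ B) ∩ P).Nonempty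
    · have s2 := subset_of_disjoint_frontier hdn hdnd h2
      exfalso
      have : B ⊆ P := by
        intro x hx
        rcases lt_trichotomy (inner ℝ n x) c with h | h | h
        · exact s2 ⟨h, hx⟩
        · exact closure_minimal s1 hcl (clup x ⟨h, hx⟩)
        · exact s1 ⟨h, hx⟩
      exact hyP.2 (interior_maximal this hBo hyB)
    · intro w hw
      rw [frontier_eq_closure_inter_closure]
      refine ⟨closure_mono s1 (clup w hw), closure_mono ?_ (cldn w hw)⟩
      exact fun x hx hxP => h2 ⟨x, hx, hxP⟩
  · by_cases h2 : (({x : E3 | inner ℝ n x < c} ∩ B) ∩ P).Nonempty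
    · have s2 := subset_of_disjoint_frontier hdn hdnd h2
      intro w hw
      rw [frontier_eq_closure_inter_closure]
      refine ⟨closure_mono s2 (cldn w hw), closure_mono ?_ (clup w hw)⟩
      exact fun x hx hxP => h1 ⟨x, hx, hxP⟩
    · exfalso
      have hyi : y ∈ closure (interior P) := hreg (hcl.frontier_subset hyP)
      obtain ⟨x, hxB, hxi⟩ := mem_closure_iff.1 hyi B hBo hyB
      have hxn : inner ℝ n x = c := by
        rcases lt_trichotomy (inner ℝ n x) c with h | h | h
        · exact absurd ⟨x, ⟨h, hxB⟩, interior_subset hxi⟩ h2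
        · exact h
        · exact absurd ⟨x, ⟨h, hxB⟩, interior_subset hxi⟩ h1
      have := clup x ⟨hxn, hxB⟩
      obtain ⟨x', hx', hx''⟩ := mem_closure_iff.1 this _ isOpen_interior hxi
      exact h1 ⟨x', hx'', interior_subset hx'⟩

/-! ### Flat parts and faces -/

lemma plane_inter_subset_flatPart {P V : Set E3} {n : E3} {c : ℝ} (hV : IsOpen V)
    (h : plane n c ∩ V ⊆ frontier P) : plane n c ∩ V ⊆ flatPart P n c := by
  rintro y ⟨hy, hyV⟩
  obtain ⟨ε, hε, hball⟩ := Metric.isOpen_iff.1 hV y hyV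
  exact ⟨hy, ε, hε, fun w hw => h ⟨hw.1, hball hw.2⟩⟩

lemma flatPart_subset_frontier (P : Set E3) (n : E3) (c : ℝ) : flatPart P n c ⊆ frontier P := by
  rintro y ⟨hy, ε, hε, h⟩
  exact h ⟨hy, Metric.mem_ball_self hε⟩

/-- The face of `P` in the plane `⟨n, x⟩ = c` around the point `y`. -/
def faceAt (P : Set E3) (n : E3) (c : ℝ) (y : E3) : Set E3 :=
  closure (connectedComponentIn (flatPart P n c) y)

lemma faceAt_mem_faces {P : Set E3} {n : E3} {c : ℝ} {y : E3} (hn : n ≠ 0)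
    (hy : y ∈ flatPart P n c) : faceAt P n c y ∈ faces P := ⟨n, c, hn, y, hy, rfl⟩

lemma faceAt_subset {P A : Set E3} {n : E3} {c : ℝ} {y : E3} (hA : IsClosed A)
    (h : connectedComponentIn (flatPart P n c) y ⊆ A) : faceAt P n c y ⊆ A :=
  closure_minimal h hA

lemma faceAt_subset_plane {P : Set E3} {n : E3} {c : ℝ} {y : E3} : faceAt P n c y ⊆ plane n c :=
  faceAt_subset (isClosed_plane n c) fun _ h => (connectedComponentIn_subset _ _ h).1

lemma faceAt_subset_frontier {P : Set E3} {n : E3} {c : ℝ} {y : E3} :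
    faceAt P n c y ⊆ frontier P :=
  faceAt_subset isClosed_frontier fun _ h =>
    flatPart_subset_frontier _ _ _ (connectedComponentIn_subset _ _ h)

/-- Around each of its points, a component of a flat part contains a disk of the plane. -/
lemma exists_ball_subset_component {P : Set E3} {n : E3} {c : ℝ} {y w : E3}
    (hw : w ∈ connectedComponentIn (flatPart P n c) y) :
    ∃ ε > 0, plane n c ∩ Metric.ball w ε ⊆ connectedComponentIn (flatPart P n c) y := by
  obtain ⟨hwp, ε, hε, h⟩ := connectedComponentIn_subset _ _ hw
  refine ⟨ε, hε, ?_⟩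
  rw [connectedComponentIn_eq hw]
  exact (((convex_plane n c).inter (convex_ball w ε)).isPreconnected).subset_connectedComponentIn
    ⟨hwp, Metric.mem_ball_self hε⟩ (plane_inter_subset_flatPart Metric.isOpen_ball h)

/-- Two faces in the same plane that are equal come from the same component. -/
lemma component_eq_of_faceAt_eq {P : Set E3} {n : E3} {c : ℝ} {y y' : E3}
    (hy : y ∈ flatPart P n c)
    (h : faceAt P n c y = faceAt P n c y') :
    connectedComponentIn (flatPart P n c) y = connectedComponentIn (flatPart P n c) y' := by
  have h1 : y ∈ faceAt P n c y' := h ▸ subset_closure (mem_connectedComponentIn hy)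
  obtain ⟨ε, hε, hb⟩ := exists_ball_subset_component (mem_connectedComponentIn hy)
  obtain ⟨w, hw, hw'⟩ := mem_closure_iff.1 h1 _ Metric.isOpen_ball (Metric.mem_ball_self hε)
  have h2 := hb ⟨(connectedComponentIn_subset _ _ hw').1, hw⟩
  rw [connectedComponentIn_eq h2, connectedComponentIn_eq hw']

/-- A plane is contained in another one as soon as a small disk of it is. -/
lemma plane_subset_of_ball {n : E3} {c : ℝ} {y : E3} {ε : ℝ} (hε : 0 < ε) (hy : y ∈ plane n c)
    {i : Fin 3} {a : ℝ} (h : ∀ x ∈ plane n c ∩ Metric.ball y ε, x i = a) :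
    ∀ x ∈ plane n c, x i = a := by
  intro x hx
  have hya := h y ⟨hy, Metric.mem_ball_self hε⟩
  obtain ⟨t, ht, ht0⟩ := ((eventually_add_smul_mem Metric.isOpen_ball
    (Metric.mem_ball_self hε) (x - y)).and self_mem_nhdsWithin).exists
  have ht0 : (0 : ℝ) < t := ht0
  have hx' : inner ℝ n x = c := hx
  have hy' : inner ℝ n y = c := hy
  have := h (y + t • (x - y)) ⟨by
    simp [plane, inner_add_right, real_inner_smul_right, inner_sub_right, hx', hy'], ht⟩
  simp only [PiLp.add_apply, PiLp.smul_apply, PiLp.sub_apply, smul_eq_mul, hya] at this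
  have h3 : t * (x i - a) = 0 := by linarith
  rcases mul_eq_zero.1 h3 with h | h
  · exact absurd h ht0.ne'
  · linarith

/-- Orthogonality of a face passes from the face to the whole plane containing it. -/
lemma IsOrthogonalPolyhedron.plane_subset {P : Set E3} (hP : IsOrthogonalPolyhedron P)
    {n : E3} {c : ℝ} (hn : n ≠ 0) {y : E3} (hy : y ∈ flatPart P n c) :
    ∃ (i : Fin 3) (a : ℝ), ∀ x ∈ plane n c, x i = a := by
  obtain ⟨i, a, h⟩ := hP.orthogonal _ (faceAt_mem_faces hn hy)
  obtain ⟨ε, hε, hb⟩ := exists_ball_subset_component (mem_connectedComponentIn hy)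
  exact ⟨i, a, plane_subset_of_ball hε hy.1 fun x hx => h x (subset_closure (hb hx))⟩

/-- The boundary of an orthogonal polyhedron lies in finitely many axis-orthogonal planes. -/
lemma IsOrthogonalPolyhedron.exists_frontier_subset {P : Set E3} (hP : IsOrthogonalPolyhedron P) :
    ∃ C : Fin 3 → Finset ℝ, ∀ x ∈ frontier P, ∃ i, x i ∈ C i := by
  classical
  obtain ⟨hc, hreg, Q, hQ0, hQ⟩ := hP.toIsPolyhedron.regular
  let good : E3 × ℝ → Prop := fun π => ∃ (i : Fin 3) (a : ℝ), ∀ x ∈ plane π.1 π.2, x i = a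
  let I : E3 × ℝ → Fin 3 × ℝ := fun π => if h : good π then (h.choose, h.choose_spec.choose) else 0
  have hI : ∀ π, good π → ∀ x ∈ plane π.1 π.2, x (I π).1 = (I π).2 := by
    intro π h x hx
    have := h.choose_spec.choose_spec x hx
    simpa only [I, dif_pos h] using this
  let C : Fin 3 → Finset ℝ := fun i => (Q.image fun π => (I π).2)
  refine ⟨C, fun x hx => ?_⟩
  by_contra hno
  push Not at hno
  have hU : IsOpen {y : E3 | ∀ i, y i ∉ C i} := by
    have : {y : E3 | ∀ i, y i ∉ C i} = ⋂ i, (fun y : E3 => y i) ⁻¹' (C i : Set ℝ)ᶜ := by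
      ext; simp
    rw [this]
    exact isOpen_iInter_of_finite fun i =>
      (C i).finite_toSet.isClosed.isOpen_compl.preimage (continuous_coord i)
  obtain ⟨π, hπ, V, hVU, hVo, ⟨y, hyV, hyP⟩, hsub⟩ :=
    exists_mem_single_plane (A := frontier P) Q _ hU ⟨x, hno, hx⟩ fun y hy => hQ hy.2
  obtain ⟨ε, hε, hb⟩ :=
    plane_inter_ball_subset_frontier hc.isClosed hreg hVo hyV hyP (hQ0 π hπ) hsub
  have hyp := hsub ⟨hyV, hyP⟩
  have hgood : good π := hP.plane_subset (hQ0 π hπ) ⟨hyp, ε, hε, hb⟩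
  refine hVU hyV (I π).1 ?_
  rw [hI π hgood y hyp]
  exact Finset.mem_image_of_mem _ hπ

lemma subset_closure_inter_generic {O : Set E3} (hO : IsOpen O) (C : Fin 3 → Finset ℝ) :
    O ⊆ closure (O ∩ {p | ∀ i, p i ∉ C i}) := by
  intro x hx
  refine mem_closure_of_ray (∑ i, EuclideanSpace.single i 1) ?_
  have h1 : ∀ i : Fin 3, ∀ᶠ t in 𝓝[>] (0 : ℝ), x i + t ∉ C i := by
    intro i
    have := eventually_gt_notMem ((C i).image fun c => c - x i) 0
    filter_upwards [this] with t ht htC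
    exact ht (Finset.mem_image.2 ⟨_, htC, by ring⟩)
  filter_upwards [eventually_add_smul_mem hO hx (∑ i, EuclideanSpace.single i 1),
    eventually_all.2 h1] with t ht hti
  refine ⟨ht, fun i => ?_⟩
  have : (x + t • ∑ i : Fin 3, EuclideanSpace.single i (1 : ℝ) : E3) i = x i + t := by
    fin_cases i <;> simp [Fin.sum_univ_three]
  rw [this]
  exact hti i

lemma IsOrthogonalPolyhedron.exists_gridSolid {P : Set E3} (hP : IsOrthogonalPolyhedron P) :
    ∃ C, GridSolid P C := by
  obtain ⟨hc, hreg, -⟩ := hP.toIsPolyhedron.regular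
  obtain ⟨C, hC⟩ := hP.exists_frontier_subset
  refine ⟨C, hc.isClosed, hc.isBounded, ?_, ?_⟩
  · intro p q hpq hp
    refine subset_of_disjoint_frontier (convex_segment p q).isPreconnected ?_
      ⟨p, left_mem_segment ℝ p q, hp⟩ (right_mem_segment ℝ p q)
    refine Set.disjoint_left.2 fun x hx hxf => ?_
    obtain ⟨i, hi⟩ := hC x hxf
    refine hpq i _ hi ?_
    rw [← segment_eq_uIcc]
    obtain ⟨a, b, ha, hb, hab, rfl⟩ := hx
    exact ⟨a, b, ha, hb, hab, by simp⟩
  · refine hreg.trans (closure_minimal ?_ isClosed_closure)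
    exact (subset_closure_inter_generic isOpen_interior C).trans
      (closure_mono fun x hx => ⟨interior_subset hx.1, hx.2⟩)

/-! ### Consequences of the manifold condition -/

/-- In a chart flattening the boundary, the interior of the solid is the open half-space `z < 0`. -/
lemma interior_inter_chart {P : Set E3} (e : OpenPartialHomeomorph E3 E3)
    (he : ∀ y ∈ e.source, (y ∈ P ↔ (e y) 2 ≤ 0)) {B : Set E3} (hBo : IsOpen B)
    (hB : B ⊆ e.target) :
    interior P ∩ (e.source ∩ e ⁻¹' B) = e.symm '' ({q : E3 | q 2 < 0} ∩ B) := by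
  refine Subset.antisymm ?_ ?_
  · rintro y ⟨hyP, hys, hyB⟩
    refine ⟨e y, ⟨?_, hyB⟩, e.left_inv hys⟩
    have hle : (e y) 2 ≤ 0 := (he y hys).1 (interior_subset hyP)
    rcases hle.lt_or_eq with h | h0
    · exact h
    exfalso
    have ht : Tendsto (fun t : ℝ => e.symm (e y + t • up)) (𝓝[>] 0) (𝓝 y) := by
      have h1 : ContinuousAt e.symm (e y + (0 : ℝ) • up) := by
        rw [zero_smul, add_zero]
        exact e.continuousAt_symm (e.map_source hys)
      have h2 : ContinuousAt (fun t : ℝ => e.symm (e y + t • up)) 0 :=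
        ContinuousAt.comp (f := fun t : ℝ => e y + t • up) h1 (by fun_prop)
      have h3 := h2.tendsto
      simp only [zero_smul, add_zero, e.left_inv hys] at h3
      exact h3.mono_left nhdsWithin_le_nhds
    have hev := eventually_add_smul_mem e.open_target (e.map_source hys) up
    obtain ⟨t, ⟨ht1, ht2⟩, ht0⟩ := ((ht.eventually_mem (isOpen_interior.mem_nhds hyP)).and hev).and
      self_mem_nhdsWithin |>.exists
    have ht0 : (0 : ℝ) < t := ht0
    have h4 := (he _ (e.map_target ht2)).1 (interior_subset ht1)
    rw [e.right_inv ht2, PiLp.add_apply, PiLp.smul_apply, up_two, h0, smul_eq_mul] at h4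
    linarith
  · have hopen : IsOpen (e.source ∩ e ⁻¹' ({q : E3 | q 2 < 0} ∩ B)) :=
      e.isOpen_inter_preimage
        ((isOpen_lt (continuous_coord 2) continuous_const).inter hBo)
    have hsub : e.source ∩ e ⁻¹' ({q : E3 | q 2 < 0} ∩ B) ⊆ P :=
      fun y hy => (he y hy.1).2 (le_of_lt hy.2.1)
    rintro y ⟨q, ⟨hq0, hqB⟩, hqy⟩
    have hys : y ∈ e.source := hqy ▸ e.map_target (hB hqB)
    have hey : e y = q := by rw [← hqy]; exact e.right_inv (hB hqB)
    refine ⟨interior_maximal hsub hopen ⟨hys, ?_⟩, hys, ?_⟩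
    · rw [mem_preimage, hey]; exact ⟨hq0, hqB⟩
    · rw [mem_preimage, hey]; exact hqB

/-- Arbitrarily small neighbourhoods of a boundary point meet the interior of the solid in a
connected set. -/
lemma HasManifoldBoundary.exists_isPreconnected {P : Set E3} (hP : HasManifoldBoundary P)
    {x : E3} (hx : x ∈ frontier P) {U : Set E3} (hU : IsOpen U) (hxU : x ∈ U) :
    ∃ V ⊆ U, IsOpen V ∧ x ∈ V ∧ IsPreconnected (interior P ∩ V) := by
  obtain ⟨e, hxe, he⟩ := hP x hx
  have hO : IsOpen (e.target ∩ e.symm ⁻¹' U) := e.symm.isOpen_inter_preimage hU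
  have hex : e x ∈ e.target ∩ e.symm ⁻¹' U :=
    ⟨e.map_source hxe, by rw [mem_preimage, e.left_inv hxe]; exact hxU⟩
  obtain ⟨r, hr, hB⟩ := Metric.isOpen_iff.1 hO _ hex
  have hVo : IsOpen (e.source ∩ e ⁻¹' Metric.ball (e x) r) :=
    e.isOpen_inter_preimage Metric.isOpen_ball
  have hxV : x ∈ e.source ∩ e ⁻¹' Metric.ball (e x) r :=
    mem_inter hxe (mem_preimage.2 (Metric.mem_ball_self hr))
  have hVU : e.source ∩ e ⁻¹' Metric.ball (e x) r ⊆ U := by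
    intro y hy
    have h1 : e.symm (e y) ∈ U := mem_preimage.1 (mem_of_mem_inter_right (hB (mem_preimage.1 hy.2)))
    rwa [e.left_inv hy.1] at h1
  refine ⟨_, hVU, hVo, hxV, ?_⟩
  rw [interior_inter_chart e he Metric.isOpen_ball fun q hq => (hB hq).1]
  refine IsPreconnected.image ?_ _ (e.continuousOn_symm.mono fun q hq => (hB hq.2).1)
  refine Convex.isPreconnected (Convex.inter ?_ (convex_ball _ _))
  exact convex_halfSpace_lt (f := fun q : E3 => q 2) ⟨fun _ _ => rfl, fun _ _ => rfl⟩ 0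

/-- The open quadrant (times a vertical line) at the point `w` between the directions `d` and
`d + 1`. -/
def quadrant (d : Fin 4) (w : E3) : Set E3 :=
  {p | reach d w < reach d p ∧ reach (d + 1) w < reach (d + 1) p}

lemma isOpen_quadrant (d : Fin 4) (w : E3) : IsOpen (quadrant d w) :=
  (isOpen_lt continuous_const (continuous_reach _)).inter
    (isOpen_lt continuous_const (continuous_reach _))

lemma add_one_add_one (d : Fin 4) : d + 1 + 1 = d + 2 := by revert d; decide
lemma add_two_add_one (d : Fin 4) : d + 2 + 1 = d + 3 := by revert d; decide
lemma add_three_add_one (d : Fin 4) : d + 3 + 1 = d := by revert d; decide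
lemma add_two_add_two (d : Fin 4) : d + 2 + 2 = d := by revert d; decide
lemma add_one_add_two (d : Fin 4) : d + 1 + 2 = d + 3 := by revert d; decide
lemma add_three_add_two (d : Fin 4) : d + 3 + 2 = d + 1 := by revert d; decide

lemma mem_quadrant {d : Fin 4} {w p : E3} : p ∈ quadrant d w ↔
    reach d w < reach d p ∧ reach (d + 1) w < reach (d + 1) p := Iff.rfl

lemma mem_quadrant_add_one {d : Fin 4} {w p : E3} : p ∈ quadrant (d + 1) w ↔
    reach d p < reach d w ∧ reach (d + 1) w < reach (d + 1) p := by
  rw [mem_quadrant, add_one_add_one, reach_add_two, reach_add_two, neg_lt_neg_iff, and_comm]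

lemma mem_quadrant_add_two {d : Fin 4} {w p : E3} : p ∈ quadrant (d + 2) w ↔
    reach d p < reach d w ∧ reach (d + 1) p < reach (d + 1) w := by
  rw [mem_quadrant, add_two_add_one, reach_add_two, reach_add_two, reach_add_three, reach_add_three,
    neg_lt_neg_iff, neg_lt_neg_iff]

lemma mem_quadrant_add_three {d : Fin 4} {w p : E3} : p ∈ quadrant (d + 3) w ↔
    reach d w < reach d p ∧ reach (d + 1) p < reach (d + 1) w := by
  rw [mem_quadrant, add_three_add_one, reach_add_three, reach_add_three, neg_lt_neg_iff, and_comm]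

lemma mem_closure_quadrant {d : Fin 4} {w p : E3} {U : Set E3} (hU : IsOpen U) (hp : p ∈ U)
    (h0 : reach d w ≤ reach d p) (h1 : reach (d + 1) w ≤ reach (d + 1) p) :
    p ∈ closure (U ∩ quadrant d w) := by
  refine mem_closure_of_ray (sideNormal d + sideNormal (d + 1)) ?_
  filter_upwards [eventually_add_smul_mem hU hp (sideNormal d + sideNormal (d + 1)),
    self_mem_nhdsWithin] with t ht ht0
  have ht0 : (0 : ℝ) < t := ht0
  refine ⟨ht, ?_, ?_⟩
  · simp only [reach_add, reach_smul, reach_sideNormal, reach_sideNormal_succ]; linarith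
  · simp only [reach_add, reach_smul, reach_sideNormal, reach_succ_sideNormal]; linarith

lemma linearIndependent_sideNormal (d : Fin 4) :
    LinearIndependent ℝ ![sideNormal d, sideNormal (d + 1)] := by
  rw [LinearIndependent.pair_iff]
  intro s t h
  have h0 := congrArg (reach d) h
  have h1 := congrArg (reach (d + 1)) h
  simp only [reach_add, reach_smul, reach_sideNormal, reach_sideNormal_succ,
    reach_succ_sideNormal] at h0 h1
  have hz : ∀ d, reach d 0 = 0 := fun d => inner_zero_right _
  rw [hz] at h0 h1
  constructor <;> linarith

/-- Local convexity of horizontal sections: if two opposite quadrants around a vertical line are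
filled, then so are the other two. Otherwise the line is a reflex edge (three quadrants filled), or
the boundary is not a manifold there (two opposite quadrants filled). -/
lemma quadrant_subset {P : Set E3} (hcl : IsClosed P) (hman : HasManifoldBoundary P)
    (href : ∀ x, ¬ IsReflexEdgePoint P up x) {w : E3} {U : Set E3} (hU : IsOpen U) (hw : w ∈ U)
    (hconst : ∀ d, U ∩ quadrant d w ⊆ P ∨ Disjoint (U ∩ quadrant d w) P) (d : Fin 4)
    (h0 : U ∩ quadrant d w ⊆ P) (h2 : U ∩ quadrant (d + 2) w ⊆ P) :
    U ∩ quadrant (d + 1) w ⊆ P := by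
  refine (hconst (d + 1)).resolve_right fun h1 => ?_
  have hclosed : ∀ d', U ∩ quadrant d' w ⊆ P → ∀ p ∈ U, reach d' w ≤ reach d' p →
      reach (d' + 1) w ≤ reach (d' + 1) p → p ∈ P := fun d' hd p hp ha hb =>
    closure_minimal hd hcl (mem_closure_quadrant hU hp ha hb)
  rcases hconst (d + 3) with h3 | h3
  · refine href w ⟨sideNormal (d + 1), sideNormal (d + 2), ?_, reach_up _, reach_up _, ?_⟩
    · have := linearIndependent_sideNormal (d + 1)
      rwa [add_one_add_one] at this
    obtain ⟨ε, hε, hb⟩ := Metric.isOpen_iff.1 hU w hw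
    refine ⟨ε, hε, fun y hy => ?_⟩
    have hyU := hb hy
    change y ∈ P ↔ reach (d + 1) (y - w) ≤ 0 ∨ reach (d + 2) (y - w) ≤ 0
    rw [reach_sub, reach_sub, reach_add_two, reach_add_two]
    constructor
    · intro hyP
      by_contra hcon
      rw [not_or] at hcon
      refine Set.disjoint_left.1 h1 ⟨hyU, mem_quadrant_add_one.2 ⟨?_, ?_⟩⟩ hyP <;>
        linarith [hcon.1, hcon.2]
    · rintro (h | h)
      · rcases le_total (reach d w) (reach d y) with h' | h'
        · refine hclosed _ h3 y hyU ?_ ?_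
          · rw [reach_add_three, reach_add_three]; linarith
          · rw [add_three_add_one]; exact h'
        · refine hclosed _ h2 y hyU ?_ ?_
          · rw [reach_add_two, reach_add_two]; linarith
          · rw [add_two_add_one, reach_add_three, reach_add_three]; linarith
      · rcases le_total (reach (d + 1) w) (reach (d + 1) y) with h' | h'
        · exact hclosed _ h0 y hyU (by linarith) h'
        · refine hclosed _ h3 y hyU ?_ ?_
          · rw [reach_add_three, reach_add_three]; linarith
          · rw [add_three_add_one]; linarith
  · have hout : ∀ d', Disjoint (U ∩ quadrant d' w) P → ∀ p ∈ U, reach d' w ≤ reach d' p →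
        reach (d' + 1) w ≤ reach (d' + 1) p → p ∉ interior P := by
      intro d' hd p hp ha hb hpi
      obtain ⟨q, hq1, hq2⟩ := mem_closure_iff.1 (mem_closure_quadrant hU hp ha hb) _
        isOpen_interior hpi
      exact Set.disjoint_left.1 hd hq2 (interior_subset hq1)
    have hwf : w ∈ frontier P := by
      rw [hcl.frontier_eq]
      exact ⟨hclosed d h0 w hw le_rfl le_rfl, hout _ h1 w hw le_rfl le_rfl⟩
    obtain ⟨V, hVU, hVo, hwV, hV⟩ := hman.exists_isPreconnected hwf hU hw
    have hmeet : ∀ d', U ∩ quadrant d' w ⊆ P →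
        (interior P ∩ V ∩ quadrant d' w).Nonempty := by
      intro d' hd
      obtain ⟨q, hq1, hq2⟩ := mem_closure_iff.1
        (mem_closure_quadrant (d := d') hU hw le_rfl le_rfl) _ hVo hwV
      exact ⟨q, ⟨interior_maximal hd (hU.inter (isOpen_quadrant _ _)) hq2, hq1⟩, hq2.2⟩
    obtain ⟨q, -, hq1, hq2⟩ := hV _ _ (isOpen_quadrant d w) (isOpen_quadrant (d + 2) w) (by
      rintro p ⟨hpi, hpV⟩
      have ha := hout _ h1 p (hVU hpV)
      have hb := hout _ h3 p (hVU hpV)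
      rw [add_one_add_one, reach_add_two, reach_add_two] at ha
      rw [reach_add_three, reach_add_three, add_three_add_one] at hb
      rw [mem_union, mem_quadrant_add_two, mem_quadrant]
      by_contra hcon
      rcases lt_or_ge (reach d w) (reach d p) with h | h
      · refine hb ?_ h.le hpi
        by_contra h'
        exact hcon (Or.inl ⟨h, by linarith⟩)
      · by_cases h'' : reach (d + 1) w ≤ reach (d + 1) p
        · exact ha h'' (by linarith) hpi
        · rcases h.lt_or_eq with h | h
          · exact hcon (Or.inr ⟨h, by linarith⟩)
          · exact hb (by linarith) h.ge hpi) (hmeet _ h0) (hmeet _ h2)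
    have := (mem_quadrant_add_two.1 hq2).1
    exact absurd hq1.1 (not_lt.2 this.le)

/-! ### Horizontal sections are rectangles -/

lemma exists_near_right (C : Finset ℝ) {x b : ℝ} (h : x < b) :
    ∃ y, x < y ∧ y < b ∧ ∀ c ∈ C, x < c → y < c := by
  obtain ⟨δ, hδ, hC⟩ := exists_gap_right C x
  obtain ⟨y, h1, h2⟩ := exists_between (lt_min h (lt_add_of_pos_right x hδ))
  exact ⟨y, h1, h2.trans_le (min_le_left _ _), fun c hc hx =>
    (h2.trans_le (min_le_right _ _)).trans (hC c hc hx)⟩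

lemma exists_near_left (C : Finset ℝ) {a x : ℝ} (h : a < x) :
    ∃ y, a < y ∧ y < x ∧ ∀ c ∈ C, c < x → c < y := by
  obtain ⟨y, h1, h2, h3⟩ := exists_near_right (C.image fun c => -c) (neg_lt_neg h)
  refine ⟨-y, by linarith, by linarith, fun c hc hx => ?_⟩
  linarith [h3 (-c) (Finset.mem_image_of_mem _ hc) (by linarith)]

lemma Icc_subset_closure_sdiff (C : Finset ℝ) {a b : ℝ} (h : a < b) :
    Icc a b ⊆ closure (Ioo a b \ C) := by
  rw [← closure_Ioo h.ne]
  refine closure_minimal ?_ isClosed_closure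
  exact (Dense.sdiff_finset dense_univ C).open_subset_closure_inter isOpen_Ioo |>.trans
    (closure_mono fun x hx => ⟨hx.1, hx.2.2⟩)

lemma isOpen_forall_notMem_uIcc (C : Finset ℝ) (h : ℝ) :
    IsOpen {t : ℝ | ∀ c ∈ C, c ∉ uIcc t h} := by
  have : {t : ℝ | ∀ c ∈ C, c ∉ uIcc t h} = ⋂ c ∈ C, {t | c ∉ uIcc t h} := by ext; simp
  rw [this]
  refine isOpen_biInter_finset fun c _ => ?_
  have : {t : ℝ | c ∉ uIcc t h} = {t | c < t ∧ c < h} ∪ {t | t < c ∧ h < c} := by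
    ext t
    simp only [mem_ofPred_eq, mem_union, mem_uIcc]
    constructor
    · intro hn
      push Not at hn
      rcases lt_or_ge c t with h1 | h1
      · refine Or.inl ⟨h1, ?_⟩
        by_contra h2
        exact absurd (hn.2 (not_lt.1 h2)) (not_lt.2 h1.le)
      · refine Or.inr ⟨?_, hn.1 h1⟩
        refine lt_of_le_of_ne h1 fun e => ?_
        subst e
        exact lt_irrefl _ (hn.2 (hn.1 h1).le)
    · rintro (⟨h1, h2⟩ | ⟨h1, h2⟩) (⟨h3, h4⟩ | ⟨h3, h4⟩) <;> linarith
  rw [this]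
  refine IsOpen.union ?_ ?_
  · exact (isOpen_lt continuous_const continuous_id).inter isOpen_const
  · exact (isOpen_lt continuous_id continuous_const).inter isOpen_const

/-- The grid values for the coordinate `reach d`. -/
noncomputable def sideGrid (C : Fin 3 → Finset ℝ) (d : Fin 4) : Finset ℝ :=
  ![C 0, C 1, (C 0).image fun c => -c, (C 1).image fun c => -c] d

lemma mem_sideGrid_add_two {C : Fin 3 → Finset ℝ} {d : Fin 4} {c : ℝ} :
    c ∈ sideGrid C (d + 2) ↔ -c ∈ sideGrid C d := by
  have key : ∀ (D : Finset ℝ) (c : ℝ), c ∈ D.image (fun c => -c) ↔ -c ∈ D := fun D c => by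
    rw [Finset.mem_image]
    exact ⟨by rintro ⟨a, ha, rfl⟩; simpa using ha, fun h => ⟨-c, h, by simp⟩⟩
  fin_cases d
  · exact key _ _
  · exact key _ _
  · exact (by simp : c ∈ C 0 ↔ -c ∈ (C 0).image fun c => -c)
  · exact (by simp : c ∈ C 1 ↔ -c ∈ (C 1).image fun c => -c)

lemma neg_mem_uIcc_neg {a b c : ℝ} : -c ∈ uIcc (-a) (-b) ↔ c ∈ uIcc a b := by
  simp only [mem_uIcc, neg_le_neg_iff]
  tauto

section
variable {P : Set E3} {C : Fin 3 → Finset ℝ}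

/-- Constancy on the open cells, in the frame of side `d`. -/
lemma GridSolid.cell_side (hG : GridSolid P C) (d : Fin 4) {p q : E3}
    (h0 : ∀ c ∈ sideGrid C d, c ∉ uIcc (reach d p) (reach d q))
    (h1 : ∀ c ∈ sideGrid C (d + 1), c ∉ uIcc (reach (d + 1) p) (reach (d + 1) q))
    (h2 : ∀ c ∈ C 2, c ∉ uIcc (p 2) (q 2)) (hp : p ∈ P) : q ∈ P := by
  have hneg : ∀ d, (∀ c ∈ sideGrid C d, c ∉ uIcc (reach d p) (reach d q)) →
      ∀ c ∈ sideGrid C (d + 2), c ∉ uIcc (reach (d + 2) p) (reach (d + 2) q) := by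
    intro d h c hc
    rw [reach_add_two, reach_add_two, ← neg_neg c, neg_mem_uIcc_neg]
    exact h _ (mem_sideGrid_add_two.1 hc)
  have hall := (forall_side d
    (p := fun d => ∀ c ∈ sideGrid C d, c ∉ uIcc (reach d p) (reach d q))).2
    ⟨h0, h1, hneg _ h0, by have := hneg _ h1; rwa [add_one_add_two] at this⟩
  refine hG.cell p q (fun i => ?_) hp
  fin_cases i
  · have := hall 0
    simp only [reach_zero] at this
    exact this
  · have := hall 1
    simp only [reach_one] at this
    exact this
  · exact h2

lemma notMem_uIcc_self {c a : ℝ} (h : a ≠ c) : c ∉ uIcc a a := by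
  rw [uIcc_self]; exact fun e => h (mem_singleton_iff.1 e).symm

/-- A point can be moved vertically as long as no horizontal grid plane is met. -/
lemma GridSolid.shift_mem (hG : GridSolid P C) {p : E3} (hp : p ∈ P) {h : ℝ}
    (hh : ∀ c ∈ C 2, c ∉ uIcc (p 2) h) : pt 0 (p 0) (p 1) h ∈ P := by
  rw [← hG.closed.closure_eq, mem_closure_iff]
  intro O hO hpO
  have hφ : Continuous fun q : E3 => pt 0 (q 0) (q 1) h := by unfold pt; fun_prop
  obtain ⟨q, ⟨hq1, hq2⟩, hqP, hqC⟩ := mem_closure_iff.1 (hG.dense hp)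
    ((fun q : E3 => pt 0 (q 0) (q 1) h) ⁻¹' O ∩
      (fun q : E3 => q 2) ⁻¹' {t | ∀ c ∈ C 2, c ∉ uIcc t h})
    ((hO.preimage hφ).inter ((isOpen_forall_notMem_uIcc _ _).preimage (continuous_coord 2)))
    ⟨hpO, hh⟩
  refine ⟨_, hq1, hG.cell q _ (fun i => ?_) hqP⟩
  fin_cases i
  · intro c hc
    simp only [Fin.zero_eta, pt_zero_zero]
    exact notMem_uIcc_self fun e => hqC 0 (e ▸ hc)
  · intro c hc
    simp only [Fin.mk_one, pt_zero_one]
    exact notMem_uIcc_self fun e => hqC 1 (e ▸ hc)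
  · intro c hc
    simp only [Fin.reduceFinMk, pt_two]
    exact hq2 c hc

lemma generic_side {q : E3} (h0 : q 0 ∉ C 0) (h1 : q 1 ∉ C 1) (d : Fin 4) :
    reach d q ∉ sideGrid C d := by
  fin_cases d
  · simpa [sideGrid] using h0
  · simpa [sideGrid] using h1
  · simpa [sideGrid] using h0
  · simpa [sideGrid] using h1

/-- Every point of the solid off the horizontal grid planes is a limit of points of the solid at the
same height that avoid the vertical grid planes. -/
lemma GridSolid.exists_generic (hG : GridSolid P C) {p : E3} (hp : p ∈ P) (hz : p 2 ∉ C 2)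
    {O : Set E3} (hO : IsOpen O) (hpO : p ∈ O) :
    ∃ q ∈ P, q ∈ O ∧ q 2 = p 2 ∧ ∀ d, reach d q ∉ sideGrid C d := by
  have hφ : Continuous fun q : E3 => pt 0 (q 0) (q 1) (p 2) := by unfold pt; fun_prop
  obtain ⟨q, ⟨hq1, hq2⟩, hqP, hqC⟩ := mem_closure_iff.1 (hG.dense hp)
    ((fun q : E3 => pt 0 (q 0) (q 1) (p 2)) ⁻¹' O ∩
      (fun q : E3 => q 2) ⁻¹' {t | ∀ c ∈ C 2, c ∉ uIcc t (p 2)})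
    ((hO.preimage hφ).inter ((isOpen_forall_notMem_uIcc _ _).preimage (continuous_coord 2)))
    ⟨by rwa [mem_preimage, pt_zero_coord], fun c hc =>
      notMem_uIcc_self fun e : p 2 = c => hz (e ▸ hc)⟩
  refine ⟨_, hG.shift_mem hqP hq2, hq1, by simp, generic_side ?_ ?_⟩
  · simpa using hqC 0
  · simpa using hqC 1

/-- The vertical prism over the rectangle whose side `d` has coordinate `e d` in the outward
direction `d`. -/
def prism (e : Fin 4 → ℝ) : Set E3 := {x | ∀ d, reach d x ≤ e d}

lemma isClosed_prism (e : Fin 4 → ℝ) : IsClosed (prism e) := by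
  have : prism e = ⋂ d, {x | reach d x ≤ e d} := by ext; simp [prism]
  rw [this]
  exact isClosed_iInter fun d => isClosed_le (continuous_reach d) continuous_const

lemma pt_mem_prism {e : Fin 4 → ℝ} {d : Fin 4} {s t h : ℝ} :
    pt d s t h ∈ prism e ↔ (s ≤ e d ∧ -e (d + 2) ≤ s) ∧ t ≤ e (d + 1) ∧ -e (d + 3) ≤ t := by
  rw [prism, mem_ofPred_eq, forall_side d]
  simp only [reach_pt, reach_succ_pt, reach_add_two_pt, reach_add_three_pt]
  constructor
  · rintro ⟨h0, h1, h2, h3⟩; refine ⟨⟨h0, ?_⟩, h1, ?_⟩ <;> linarith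
  · rintro ⟨⟨h0, h1⟩, h2, h3⟩; refine ⟨h0, h2, ?_, ?_⟩ <;> linarith

/-- The four quadrants around a vertical grid line, sampled at single points. -/
lemma GridSolid.corner (hG : GridSolid P C) (hman : HasManifoldBoundary P)
    (href : ∀ x, ¬ IsReflexEdgePoint P up x) (d : Fin 4) {x x₁ x₂ y y₁ y₂ z : ℝ}
    (hz : z ∉ C 2) (hx₁ : x₁ < x) (hx₂ : x < x₂) (hy₁ : y₁ < y) (hy₂ : y < y₂)
    (hx : ∀ c ∈ sideGrid C d, x₁ ≤ c → c ≤ x₂ → c = x)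
    (hy : ∀ c ∈ sideGrid C (d + 1), y₁ ≤ c → c ≤ y₂ → c = y) :
    (pt d x₁ y₁ z ∈ P → pt d x₂ y₂ z ∈ P → pt d x₁ y₂ z ∈ P ∧ pt d x₂ y₁ z ∈ P) ∧
    (pt d x₁ y₂ z ∈ P → pt d x₂ y₁ z ∈ P → pt d x₁ y₁ z ∈ P ∧ pt d x₂ y₂ z ∈ P) := by
  set w := pt d x y z with hw
  set U : Set E3 := {p | (x₁ < reach d p ∧ reach d p < x₂) ∧
    (y₁ < reach (d + 1) p ∧ reach (d + 1) p < y₂)} ∩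
      (fun q : E3 => q 2) ⁻¹' {t | ∀ c ∈ C 2, c ∉ uIcc t z} with hU
  have hUo : IsOpen U :=
    (((isOpen_lt continuous_const (continuous_reach _)).inter
      (isOpen_lt (continuous_reach _) continuous_const)).inter
      ((isOpen_lt continuous_const (continuous_reach _)).inter
      (isOpen_lt (continuous_reach _) continuous_const))).inter
      ((isOpen_forall_notMem_uIcc _ _).preimage (continuous_coord 2))
  have hzz : ∀ c ∈ C 2, c ∉ uIcc z z := fun c hc => notMem_uIcc_self fun e => hz (e ▸ hc)
  have hwU : w ∈ U := by
    refine ⟨⟨⟨?_, ?_⟩, ?_, ?_⟩, ?_⟩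
    · simpa [hw] using hx₁
    · simpa [hw] using hx₂
    · simpa [hw] using hy₁
    · simpa [hw] using hy₂
    · simpa [hw] using hzz
  -- On each open quadrant, membership is decided by the sample point `pt d a b z`.
  have key : ∀ (A : Set E3) (a b a' b' : ℝ), pt d a' b' z ∈ U ∩ A →
      (∀ p ∈ U ∩ A, (∀ c ∈ sideGrid C d, c ∉ uIcc (reach d p) a) ∧
        (∀ c ∈ sideGrid C (d + 1), c ∉ uIcc (reach (d + 1) p) b)) →
      (U ∩ A ⊆ P ↔ pt d a b z ∈ P) ∧ (U ∩ A ⊆ P ∨ Disjoint (U ∩ A) P) := by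
    intro A a b a' b' hmem hA
    have h1 : ∀ p ∈ U ∩ A, (p ∈ P ↔ pt d a b z ∈ P) := by
      intro p hp
      obtain ⟨hp1, hp2⟩ := hA p hp
      constructor
      · refine hG.cell_side d ?_ ?_ ?_
        · simpa using hp1
        · simpa using hp2
        · simpa using hp.1.2
      · refine hG.cell_side d ?_ ?_ ?_
        · simpa [uIcc_comm] using hp1
        · simpa [uIcc_comm] using hp2
        · simpa [uIcc_comm] using hp.1.2
    by_cases hP : pt d a b z ∈ P
    · have : U ∩ A ⊆ P := fun p hp => (h1 p hp).2 hP
      exact ⟨⟨fun _ => hP, fun _ => this⟩, Or.inl this⟩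
    · refine ⟨⟨fun h => absurd ((h1 _ hmem).1 (h hmem)) hP, fun h => absurd h hP⟩,
        Or.inr (Set.disjoint_left.2 fun p hp hpP => hP ((h1 p hp).1 hpP))⟩
  have hmemU : ∀ a b, x₁ < a → a < x₂ → y₁ < b → b < y₂ → pt d a b z ∈ U := by
    intro a b h1 h2 h3 h4
    exact ⟨⟨⟨by simpa using h1, by simpa using h2⟩, by simpa using h3, by simpa using h4⟩,
      by simpa using hzz⟩
  have hwd : reach d w = x := by simp [hw]
  have hwd1 : reach (d + 1) w = y := by simp [hw]
  have right_x : ∀ p : E3, reach d w < reach d p → reach d p < x₂ →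
      ∀ c ∈ sideGrid C d, c ∉ uIcc (reach d p) x₂ := fun p h1 h2 c hc hcc => by
    rw [uIcc_of_le h2.le] at hcc
    have := hx c hc (by linarith [hcc.1]) hcc.2
    linarith [hcc.1]
  have left_x : ∀ p : E3, reach d p < reach d w → x₁ < reach d p →
      ∀ c ∈ sideGrid C d, c ∉ uIcc (reach d p) x₁ := fun p h1 h2 c hc hcc => by
    rw [uIcc_of_ge h2.le] at hcc
    have := hx c hc hcc.1 (by linarith [hcc.2])
    linarith [hcc.2]
  have right_y : ∀ p : E3, reach (d + 1) w < reach (d + 1) p → reach (d + 1) p < y₂ →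
      ∀ c ∈ sideGrid C (d + 1), c ∉ uIcc (reach (d + 1) p) y₂ := fun p h1 h2 c hc hcc => by
    rw [uIcc_of_le h2.le] at hcc
    have := hy c hc (by linarith [hcc.1]) hcc.2
    linarith [hcc.1]
  have left_y : ∀ p : E3, reach (d + 1) p < reach (d + 1) w → y₁ < reach (d + 1) p →
      ∀ c ∈ sideGrid C (d + 1), c ∉ uIcc (reach (d + 1) p) y₁ := fun p h1 h2 c hc hcc => by
    rw [uIcc_of_ge h2.le] at hcc
    have := hy c hc hcc.1 (by linarith [hcc.2])
    linarith [hcc.2]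
  obtain ⟨i0, c0⟩ := key (quadrant d w) x₂ y₂ ((x + x₂) / 2) ((y + y₂) / 2)
    ⟨hmemU _ _ (by linarith) (by linarith) (by linarith) (by linarith),
      mem_quadrant.2 ⟨by rw [hwd, reach_pt]; linarith, by rw [hwd1, reach_succ_pt]; linarith⟩⟩
    (fun p hp => ⟨right_x p (mem_quadrant.1 hp.2).1 hp.1.1.1.2,
      right_y p (mem_quadrant.1 hp.2).2 hp.1.1.2.2⟩)
  obtain ⟨i1, c1⟩ := key (quadrant (d + 1) w) x₁ y₂ ((x + x₁) / 2) ((y + y₂) / 2)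
    ⟨hmemU _ _ (by linarith) (by linarith) (by linarith) (by linarith),
      mem_quadrant_add_one.2
        ⟨by rw [hwd, reach_pt]; linarith, by rw [hwd1, reach_succ_pt]; linarith⟩⟩
    (fun p hp => ⟨left_x p (mem_quadrant_add_one.1 hp.2).1 hp.1.1.1.1,
      right_y p (mem_quadrant_add_one.1 hp.2).2 hp.1.1.2.2⟩)
  obtain ⟨i2, c2⟩ := key (quadrant (d + 2) w) x₁ y₁ ((x + x₁) / 2) ((y + y₁) / 2)
    ⟨hmemU _ _ (by linarith) (by linarith) (by linarith) (by linarith),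
      mem_quadrant_add_two.2
        ⟨by rw [hwd, reach_pt]; linarith, by rw [hwd1, reach_succ_pt]; linarith⟩⟩
    (fun p hp => ⟨left_x p (mem_quadrant_add_two.1 hp.2).1 hp.1.1.1.1,
      left_y p (mem_quadrant_add_two.1 hp.2).2 hp.1.1.2.1⟩)
  obtain ⟨i3, c3⟩ := key (quadrant (d + 3) w) x₂ y₁ ((x + x₂) / 2) ((y + y₁) / 2)
    ⟨hmemU _ _ (by linarith) (by linarith) (by linarith) (by linarith),
      mem_quadrant_add_three.2
        ⟨by rw [hwd, reach_pt]; linarith, by rw [hwd1, reach_succ_pt]; linarith⟩⟩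
    (fun p hp => ⟨right_x p (mem_quadrant_add_three.1 hp.2).1 hp.1.1.1.2,
      left_y p (mem_quadrant_add_three.1 hp.2).2 hp.1.1.2.1⟩)
  have hconst := (forall_side d (p := fun d => U ∩ quadrant d w ⊆ P ∨
    Disjoint (U ∩ quadrant d w) P)).2 ⟨c0, c1, c2, c3⟩
  have rule := quadrant_subset hG.closed hman href hUo hwU hconst
  have r0 := rule d
  have r1 := rule (d + 1)
  have r2 := rule (d + 2)
  have r3 := rule (d + 3)
  rw [add_one_add_two, add_one_add_one] at r1
  rw [add_two_add_two, add_two_add_one] at r2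
  rw [add_three_add_two, add_three_add_one] at r3
  rw [i0, i2, i1] at r0
  rw [i1, i3, i2] at r1
  rw [i2, i0, i3] at r2
  rw [i3, i1, i0] at r3
  exact ⟨fun h h' => ⟨r0 h' h, r2 h h'⟩, fun h h' => ⟨r1 h h', r3 h' h⟩⟩

end

lemma add_one_ne_self (d : Fin 4) : d + 1 ≠ d := by revert d; decide
lemma add_three_ne_self (d : Fin 4) : d + 3 ≠ d := by revert d; decide

section
variable {P : Set E3} {C : Fin 3 → Finset ℝ}

lemma pt_mem_of_rect {z : ℝ} {e : Fin 4 → ℝ} (hrect : ∀ p ∈ prism e, p 2 = z → p ∈ P)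
    {d : Fin 4} {s t : ℝ} (h0 : s ≤ e d) (h2 : -e (d + 2) ≤ s) (h1 : t ≤ e (d + 1))
    (h3 : -e (d + 3) ≤ t) : pt d s t z ∈ P :=
  hrect _ (pt_mem_prism.2 ⟨⟨h0, h2⟩, h1, h3⟩) (by simp)

/-- Just outside side `d` of a rectangle contained in a section, membership in the section does not
depend on the position along the side. -/
lemma GridSolid.side_iff (hG : GridSolid P C) (hman : HasManifoldBoundary P)
    (href : ∀ x, ¬ IsReflexEdgePoint P up x) {z : ℝ} (hz : z ∉ C 2) {e : Fin 4 → ℝ}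
    (hrect : ∀ p ∈ prism e, p 2 = z → p ∈ P) (hpos : ∀ d, 0 < e d + e (d + 2)) {d : Fin 4} {s : ℝ}
    (hs : e d < s) (hgap : ∀ c ∈ sideGrid C d, e d < c → s < c) {t₁ t₂ : ℝ}
    (ht₁ : -e (d + 3) < t₁) (ht₁₂ : t₁ < t₂) (ht₂ : t₂ < e (d + 1))
    (h₁ : t₁ ∉ sideGrid C (d + 1)) (h₂ : t₂ ∉ sideGrid C (d + 1)) :
    pt d s t₁ z ∈ P ↔ pt d s t₂ z ∈ P := by
  refine iff_of_iff_of_subsingleton (sideGrid C (d + 1)) (p := fun t => pt d s t z ∈ P)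
    ?_ ht₁ ht₁₂ ht₂ h₁ h₂
  intro y₁ y₂ hy₁ hy₁₂ hy₂ hC₁ hC₂ hsub
  have hzz : ∀ c ∈ C 2, c ∉ uIcc z z := fun c hc => notMem_uIcc_self fun e => hz (e ▸ hc)
  by_cases hex : ∃ g ∈ sideGrid C (d + 1), y₁ ≤ g ∧ g ≤ y₂
  · obtain ⟨g, hg, hg1, hg2⟩ := hex
    have hg1 : y₁ < g := lt_of_le_of_ne hg1 fun e => hC₁ (e ▸ hg)
    have hg2 : g < y₂ := lt_of_le_of_ne hg2 fun e => hC₂ (e ▸ hg)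
    obtain ⟨x, hx1, hx2, hx3⟩ := exists_near_left (sideGrid C d)
      (show -e (d + 2) < e d by linarith [hpos d])
    obtain ⟨hA, hB⟩ := hG.corner hman href d hz hx2 hs hg1 hg2
      (fun c hc h1 h2 => by
        rcases lt_trichotomy c (e d) with h | h | h
        · linarith [hx3 c hc h]
        · exact h
        · linarith [hgap c hc h])
      (fun c hc h1 h2 => hsub c hc g hg ⟨h1, h2⟩ ⟨hg1.le, hg2.le⟩)
    have hx : ∀ y, -e (d + 3) < y → y < e (d + 1) → pt d x y z ∈ P := fun y h1 h2 =>
      pt_mem_of_rect hrect hx2.le hx1.le h2.le h1.le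
    exact ⟨fun h => (hB (hx _ (by linarith) (by linarith)) h).2,
      fun h => (hA (hx _ (by linarith) (by linarith)) h).2⟩
  · have hcell : ∀ c ∈ sideGrid C (d + 1), c ∉ uIcc y₁ y₂ := fun c hc h => by
      rw [uIcc_of_le hy₁₂.le] at h
      exact hex ⟨c, hc, h.1, h.2⟩
    have hss : ∀ c ∈ sideGrid C d, c ∉ uIcc s s := fun c hc => notMem_uIcc_self fun e' => by
      subst e'
      exact lt_irrefl _ (hgap _ hc hs)
    constructor
    · exact hG.cell_side d (by simpa using hss) (by simpa using hcell) (by simpa using hzz)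
    · exact hG.cell_side d (by simpa using hss) (by simpa [uIcc_comm] using hcell)
        (by simpa using hzz)

/-- A point of the solid off the grid has a grid value beyond it in each direction. -/
lemma GridSolid.exists_next (hG : GridSolid P C) {p : E3} (hp : p ∈ P) (hz : p 2 ∉ C 2)
    (hgen : ∀ d, reach d p ∉ sideGrid C d) (d : Fin 4) :
    ∃ b ∈ sideGrid C d, reach d p < b ∧ ∀ c ∈ sideGrid C d, reach d p < c → b ≤ c := by
  have hne : ((sideGrid C d).filter fun c => reach d p < c).Nonempty := by
    by_contra hemp
    rw [Finset.not_nonempty_iff_eq_empty, Finset.filter_eq_empty_iff] at hemp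
    have hcomp : IsCompact P := Metric.isCompact_of_isClosed_isBounded hG.closed hG.bounded
    obtain ⟨M, hM⟩ := hcomp.bddAbove_image (continuous_reach d).continuousOn
    have hle : ∀ r : ℝ, 0 ≤ r → reach d p + r ≤ M := by
      intro r hr
      have hq : pt d (reach d p + r) (reach (d + 1) p) (p 2) ∈ P := by
        refine hG.cell_side d ?_ ?_ ?_ hp
        · intro c hc hcc
          rw [reach_pt, uIcc_of_le (by linarith)] at hcc
          have h1 := hemp hc
          have h2 : c = reach d p := by linarith [hcc.1]
          exact hgen d (h2 ▸ hc)
        · intro c hc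
          rw [reach_succ_pt]
          exact notMem_uIcc_self fun e => hgen (d + 1) (e ▸ hc)
        · intro c hc
          rw [pt_two]
          exact notMem_uIcc_self fun e => hz (e ▸ hc)
      have := hM (mem_image_of_mem _ hq)
      rwa [reach_pt] at this
    have h0 := hle 0 le_rfl
    have := hle (M - reach d p + 1) (by linarith)
    linarith
  have hmem := Finset.min'_mem _ hne
  rw [Finset.mem_filter] at hmem
  exact ⟨_, hmem.1, hmem.2, fun c hc h => Finset.min'_le _ _ (Finset.mem_filter.2 ⟨hc, h⟩)⟩

lemma pt_mem_of_dense (hcl : IsClosed P) (d : Fin 4) {z a b a' b' : ℝ} (D : Finset ℝ)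
    (hab : a < b) (hab' : a' < b')
    (h : ∀ s t, a < s → s < b → a' < t → t < b' → t ∉ D → pt d s t z ∈ P) {s t : ℝ}
    (hs : s ∈ Icc a b) (ht : t ∈ Icc a' b') : pt d s t z ∈ P := by
  have hs' : s ∈ closure (Ioo a b \ (∅ : Finset ℝ)) := Icc_subset_closure_sdiff ∅ hab hs
  have ht' := Icc_subset_closure_sdiff D hab' ht
  rw [← hcl.closure_eq]
  refine map_mem_closure₂ (f := fun s t => pt d s t z) ?_ hs' ht' ?_
  · exact (continuous_pt d).comp (by fun_prop : Continuous fun q : ℝ × ℝ => (q.1, q.2, z))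
  · rintro s ⟨⟨h1, h2⟩, -⟩ t ⟨⟨h3, h4⟩, h5⟩
    exact h s t h1 h2 h3 h4 h5

/-- A rectangle in a section that is not closed off along side `d` can be extended there to the
next grid value. -/
lemma GridSolid.exists_extend (hG : GridSolid P C) (hman : HasManifoldBoundary P)
    (href : ∀ x, ¬ IsReflexEdgePoint P up x) {z : ℝ} (hz : z ∉ C 2) {e : Fin 4 → ℝ}
    (hrect : ∀ p ∈ prism e, p 2 = z → p ∈ P) (hpos : ∀ d, 0 < e d + e (d + 2)) {d : Fin 4} {s t : ℝ}
    (hs : e d < s) (hgap : ∀ c ∈ sideGrid C d, e d < c → s < c)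
    (ht : -e (d + 3) < t) (ht' : t < e (d + 1)) (htC : t ∉ sideGrid C (d + 1))
    (hmem : pt d s t z ∈ P) :
    ∃ b ∈ sideGrid C d, e d < b ∧ ∀ p ∈ prism (Function.update e d b), p 2 = z → p ∈ P := by
  have hsC : s ∉ sideGrid C d := fun h => lt_irrefl _ (hgap _ h hs)
  obtain ⟨b, hb, hsb, hmin⟩ := hG.exists_next hmem (by simpa using hz)
    ((forall_side d).2 ⟨by simpa using hsC, by simpa using htC,
      by rw [reach_add_two_pt, mem_sideGrid_add_two, neg_neg]; exact hsC,
      by rw [reach_add_three_pt, ← add_one_add_two, mem_sideGrid_add_two, neg_neg]; exact htC⟩) d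
  rw [reach_pt] at hsb hmin
  have hpos1 := hpos (d + 1)
  rw [add_one_add_two] at hpos1
  have hcol : ∀ t', -e (d + 3) < t' → t' < e (d + 1) → t' ∉ sideGrid C (d + 1) →
      pt d s t' z ∈ P := by
    intro t' h1 h2 h3
    rcases lt_trichotomy t t' with h | h | h
    · exact (hG.side_iff hman href hz hrect hpos hs hgap ht h h2 htC h3).1 hmem
    · exact h ▸ hmem
    · exact (hG.side_iff hman href hz hrect hpos hs hgap h1 h ht' h3 htC).2 hmem
  have hcell : ∀ s' t', e d < s' → s' < b → -e (d + 3) < t' → t' < e (d + 1) →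
      t' ∉ sideGrid C (d + 1) → pt d s' t' z ∈ P := by
    intro s' t' h1 h2 h3 h4 h5
    refine hG.cell_side d ?_ ?_ ?_ (hcol t' h3 h4 h5)
    · intro c hc hcc
      simp only [reach_pt, mem_uIcc] at hcc
      have h6 : e d < c := by rcases hcc with hcc | hcc <;> linarith [hcc.1]
      have h7 := hgap c hc h6
      have h8 := hmin c hc h7
      rcases hcc with hcc | hcc <;> linarith [hcc.2]
    · intro c hc
      simp only [reach_succ_pt]
      exact notMem_uIcc_self fun e => h5 (e ▸ hc)
    · intro c hc
      simp only [pt_two]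
      exact notMem_uIcc_self fun e => hz (e ▸ hc)
  refine ⟨b, hb, hs.trans hsb, fun p hp hpz => ?_⟩
  rcases le_or_gt (reach d p) (e d) with h | h
  · refine hrect p (fun d' => ?_) hpz
    by_cases hd : d' = d
    · rw [hd]; exact h
    · have := hp d'
      rwa [Function.update_of_ne hd] at this
  · have h0 := hp d
    have h1 := hp (d + 1)
    have h3 := hp (d + 3)
    rw [Function.update_self] at h0
    rw [Function.update_of_ne (add_one_ne_self d)] at h1
    rw [Function.update_of_ne (add_three_ne_self d)] at h3
    rw [reach_add_three] at h3
    rw [← pt_reach d p, hpz]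
    exact pt_mem_of_dense hG.closed d _ (hs.trans hsb) (by linarith) hcell ⟨h.le, h0⟩
      ⟨by linarith, h1⟩

/-- A nonempty connected section off the horizontal grid planes is a rectangle. -/
lemma GridSolid.section_eq (hG : GridSolid P C) (hman : HasManifoldBoundary P)
    (href : ∀ x, ¬ IsReflexEdgePoint P up x) {z : ℝ} (hz : z ∉ C 2)
    (hconn : IsPreconnected (crossSection P z)) (hne : (crossSection P z).Nonempty) :
    ∃ e : Fin 4 → ℝ, (∀ d, 0 < e d + e (d + 2)) ∧ ∀ p : E3, p 2 = z → (p ∈ P ↔ p ∈ prism e) := by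
  classical
  -- A cell of the grid contained in the section.
  obtain ⟨p₀, hp₀, hp₀z⟩ := hne
  obtain ⟨p, hp, -, hpz, hgen⟩ := hG.exists_generic hp₀ (hp₀z ▸ hz) isOpen_univ (mem_univ _)
  rw [hp₀z] at hpz
  have hpz2 : p 2 ∉ C 2 := hpz ▸ hz
  choose e₀ he₀ hlt₀ hmin₀ using hG.exists_next hp hpz2 hgen
  have hpos₀ : ∀ d, 0 < e₀ d + e₀ (d + 2) := fun d => by
    have h1 := hlt₀ d
    have h2 := hlt₀ (d + 2)
    rw [reach_add_two] at h2
    linarith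
  have hrect₀ : ∀ q ∈ prism e₀, q 2 = z → q ∈ P := by
    intro q hq hqz
    rw [← pt_reach 0 q, hqz]
    have hq0 := hq 0
    have hq1 := hq (0 + 1)
    have hq2 := hq (0 + 2)
    have hq3 := hq (0 + 3)
    rw [reach_add_two] at hq2
    rw [reach_add_three] at hq3
    have hp1 := hpos₀ (0 + 1)
    refine pt_mem_of_dense hG.closed 0 ∅ (a := -e₀ (0 + 2)) (b := e₀ 0) (a' := -e₀ (0 + 3))
      (b' := e₀ (0 + 1)) (by linarith [hpos₀ 0]) (by rw [add_one_add_two] at hp1; linarith) ?_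
      ⟨by linarith, hq0⟩ ⟨by linarith, hq1⟩
    intro s t h1 h2 h3 h4 _
    have aux : ∀ (d : Fin 4) (u : ℝ), -e₀ (d + 2) < u → u < e₀ d →
        ∀ c ∈ sideGrid C d, c ∉ uIcc (reach d p) u := by
      intro d u hu1 hu2 c hc hcc
      rw [mem_uIcc] at hcc
      rcases lt_trichotomy (reach d p) c with h | h | h
      · have := hmin₀ d c hc h
        rcases hcc with hcc | hcc <;> linarith [hcc.1, hcc.2]
      · exact hgen d (h ▸ hc)
      · have := hmin₀ (d + 2) (-c) (mem_sideGrid_add_two.2 (by simpa using hc))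
          (by rw [reach_add_two]; linarith)
        rcases hcc with hcc | hcc <;> linarith [hcc.1, hcc.2]
    refine hG.cell_side 0 ?_ ?_ ?_ hp
    · rw [reach_pt]; exact aux 0 s h1 h2
    · rw [reach_succ_pt]; exact aux (0 + 1) t h3 h4
    · rw [pt_two, hpz]
      exact fun c hc => notMem_uIcc_self fun e => hz (e ▸ hc)
  -- A maximal grid rectangle contained in the section.
  set S := (Fintype.piFinset (sideGrid C)).filter fun e =>
    (∀ d, 0 < e d + e (d + 2)) ∧ ∀ q ∈ prism e, q 2 = z → q ∈ P with hS
  obtain ⟨e, heS, hmax⟩ := S.exists_max_image (fun e => ∑ d, e d)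
    ⟨e₀, Finset.mem_filter.2 ⟨Fintype.mem_piFinset.2 he₀, hpos₀, hrect₀⟩⟩
  obtain ⟨heC, hpos, hrect⟩ := Finset.mem_filter.1 heS
  rw [Fintype.mem_piFinset] at heC
  have noext : ∀ (d : Fin 4) (s t : ℝ), e d < s → (∀ c ∈ sideGrid C d, e d < c → s < c) →
      -e (d + 3) < t → t < e (d + 1) → t ∉ sideGrid C (d + 1) → pt d s t z ∉ P := by
    intro d s t h1 h2 h3 h4 h5 h6
    obtain ⟨b, hb, hlt, hb'⟩ := hG.exists_extend hman href hz hrect hpos h1 h2 h3 h4 h5 h6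
    have hmono : ∀ d', e d' ≤ Function.update e d b d' := fun d' => by
      by_cases h : d' = d
      · subst h; rw [Function.update_self]; exact hlt.le
      · rw [Function.update_of_ne h]
    have hmem : Function.update e d b ∈ S := by
      refine Finset.mem_filter.2 ⟨Fintype.mem_piFinset.2 fun d' => ?_, fun d' => ?_, hb'⟩
      · by_cases h : d' = d
        · subst h; rw [Function.update_self]; exact hb
        · rw [Function.update_of_ne h]; exact heC d'
      · linarith [hpos d', hmono d', hmono (d' + 2)]
    have h7 := hmax _ hmem
    have h8 : ∑ d', e d' < ∑ d', Function.update e d b d' :=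
      Finset.sum_lt_sum (fun d' _ => hmono d') ⟨d, Finset.mem_univ _, by simpa using hlt⟩
    linarith
  -- The section has no further points near that rectangle.
  choose g hg0 hg using fun d => exists_gap_right (sideGrid C d) (e d)
  set U : Set E3 := ⋂ d, {q | reach d q < e d + g d} with hU
  have hUo : IsOpen U :=
    isOpen_iInter_of_finite fun d => isOpen_lt (continuous_reach d) continuous_const
  have hUmem : ∀ q, q ∈ U ↔ ∀ d, reach d q < e d + g d := fun q => by simp [hU]
  have hgen_out : ∀ q ∈ P, q 2 = z → (∀ d, reach d q ∉ sideGrid C d) → q ∈ U →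
      ∀ d, reach d q ≤ e d := by
    intro q hq hqz hqgen hqU d
    rw [hUmem] at hqU
    by_contra hcon
    push Not at hcon
    have hq' := hq
    rw [← pt_reach d q, hqz] at hq'
    have hgap : ∀ c ∈ sideGrid C d, e d < c → reach d q < c := fun c hc h =>
      (hqU d).trans (hg d c hc h)
    obtain ⟨x, hx1, hx2, hx3⟩ := exists_near_left (sideGrid C d)
      (show -e (d + 2) < e d by linarith [hpos d])
    have hxgrid : ∀ c ∈ sideGrid C d, x ≤ c → c ≤ reach d q → c = e d := by
      intro c hc h1 h2
      rcases lt_trichotomy c (e d) with h | h | h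
      · linarith [hx3 c hc h]
      · exact h
      · linarith [hgap c hc h]
    have hpos1 := hpos (d + 1)
    rw [add_one_add_two] at hpos1
    have hside : -e (d + 3) ∈ sideGrid C (d + 1) := by
      rw [← mem_sideGrid_add_two, add_one_add_two]; exact heC _
    rcases lt_trichotomy (reach (d + 1) q) (e (d + 1)) with h | h | h
    · rcases lt_trichotomy (reach (d + 1) q) (-e (d + 3)) with h' | h' | h'
      · obtain ⟨y, hy1, hy2, hy3⟩ := exists_near_right (sideGrid C (d + 1))
          (show -e (d + 3) < e (d + 1) by linarith)
        obtain ⟨-, hB⟩ := hG.corner hman href d hz hx2 hcon h' hy1 hxgrid (by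
          intro c hc h1 h2
          rcases lt_trichotomy c (-e (d + 3)) with h | h | h
          · have h3 := hg (d + 3) (-c) (by
              rw [← add_one_add_two, mem_sideGrid_add_two, neg_neg]; exact hc) (by linarith)
            have h4 := hqU (d + 3)
            rw [reach_add_three] at h4
            linarith
          · exact h
          · linarith [hy3 c hc h])
        refine noext d (reach d q) y hcon hgap hy1 hy2 (fun hy => lt_irrefl _ (hy3 y hy hy1)) ?_
        exact (hB (pt_mem_of_rect hrect hx2.le hx1.le hy2.le hy1.le) hq').2
      · exact hqgen (d + 1) (h' ▸ hside)
      · exact noext d _ _ hcon hgap h' h (hqgen _) hq'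
    · exact hqgen (d + 1) (h ▸ heC _)
    · obtain ⟨y, hy1, hy2, hy3⟩ := exists_near_left (sideGrid C (d + 1))
        (show -e (d + 3) < e (d + 1) by linarith)
      obtain ⟨hA, -⟩ := hG.corner hman href d hz hx2 hcon hy2 h hxgrid (by
        intro c hc h1 h2
        rcases lt_trichotomy c (e (d + 1)) with h | h | h
        · linarith [hy3 c hc h]
        · exact h
        · linarith [hg (d + 1) c hc h, hqU (d + 1)])
      refine noext d (reach d q) y hcon hgap hy1 hy2 (fun hy => lt_irrefl _ (hy3 y hy hy2)) ?_
      exact (hA (pt_mem_of_rect hrect hx2.le hx1.le hy2.le hy1.le) hq').2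
  have hout : ∀ q ∈ P, q 2 = z → q ∈ U → q ∈ prism e := by
    intro q hq hqz hqU d
    by_contra hcon
    push Not at hcon
    obtain ⟨q', hq'P, ⟨hq'U, hq'd⟩, hq'z, hq'gen⟩ := hG.exists_generic hq (hqz ▸ hz)
      (hUo.inter (isOpen_lt continuous_const (continuous_reach d))) ⟨hqU, hcon⟩
    exact absurd (hgen_out q' hq'P (hq'z.trans hqz) hq'gen hq'U d) (not_le.2 hq'd)
  refine ⟨e, hpos, fun q hqz => ⟨fun hq => ?_, fun hq => hrect q hq hqz⟩⟩
  by_contra hqe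
  have hp1 := hpos (0 + 1)
  rw [add_one_add_two] at hp1
  have hr0 : pt 0 (e 0) (e (0 + 1)) z ∈ prism e :=
    pt_mem_prism.2 ⟨⟨le_rfl, by linarith [hpos 0]⟩, le_rfl, by linarith⟩
  have hprismU : prism e ⊆ U := fun q hq => (hUmem q).2 fun d => by linarith [hq d, hg0 d]
  obtain ⟨q', ⟨hq'P, hq'z⟩, hq'U, hq'e⟩ := hconn U (prism e)ᶜ hUo (isClosed_prism e).isOpen_compl
    (fun q _ => by
      by_cases h : q ∈ prism e
      · exact Or.inl (hprismU h)
      · exact Or.inr h)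
    ⟨_, ⟨hrect _ hr0 (by simp), by simp⟩, hprismU hr0⟩ ⟨q, ⟨hq, hqz⟩, hqe⟩
  exact hq'e (hout q' hq'P hq'z hq'U)

end

/-! ### Decomposition into a stack of bricks -/

/-- A decomposition of `P` into a stack of `k` bricks: the brick `i < k` is the box over the
rectangle `prism (e i)` between the heights `z i` and `z (i + 1)`. The rectangles of consecutive
bricks are different and their interiors meet. The values of `z` and `e` beyond the top of the stack
are irrelevant. -/
structure Stack (P : Set E3) where
  /-- the number of bricks -/
  k : ℕ
  /-- the heights at which bricks meet -/
  z : ℕ → ℝ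
  /-- the outward coordinates of the four sides of each brick -/
  e : ℕ → Fin 4 → ℝ
  k_pos : 0 < k
  strictMono : StrictMono z
  pos : ∀ i < k, ∀ d, 0 < e i d + e i (d + 2)
  overlap : ∀ i, i + 1 < k → ∀ d, 0 < e i d + e (i + 1) (d + 2)
  ne : ∀ i, i + 1 < k → e i ≠ e (i + 1)
  mem_iff : ∀ p : E3, p ∈ P ↔ ∃ i < k, p ∈ prism (e i) ∧ z i ≤ p 2 ∧ p 2 ≤ z (i + 1)

lemma reach_congr {p q : E3} (h0 : p 0 = q 0) (h1 : p 1 = q 1) (d : Fin 4) :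
    reach d p = reach d q := by
  fin_cases d
  · simpa using h0
  · simpa using h1
  · simpa using h0
  · simpa using h1

lemma prism_congr {e : Fin 4 → ℝ} {p q : E3} (h : ∀ d, reach d p = reach d q) :
    p ∈ prism e ↔ q ∈ prism e := by
  simp only [prism, mem_ofPred_eq, h]

lemma reach_pt_zero (p : E3) (h : ℝ) (d : Fin 4) : reach d (pt 0 (p 0) (p 1) h) = reach d p :=
  reach_congr (by simp) (by simp) d

lemma reach_add_smul_up (p : E3) (t : ℝ) (d : Fin 4) : reach d (p + t • up) = reach d p := by
  simp [reach_add, reach_smul]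

lemma add_smul_up_two (p : E3) (t : ℝ) : (p + t • up) 2 = p 2 + t := by simp

/-- The interior of the rectangle `prism e`. -/
def openPrism (e : Fin 4 → ℝ) : Set E3 := {x | ∀ d, reach d x < e d}

lemma isOpen_openPrism (e : Fin 4 → ℝ) : IsOpen (openPrism e) := by
  have : openPrism e = ⋂ d, {x | reach d x < e d} := by ext; simp [openPrism]
  rw [this]
  exact isOpen_iInter_of_finite fun d => isOpen_lt (continuous_reach d) continuous_const

lemma openPrism_subset_prism (e : Fin 4 → ℝ) : openPrism e ⊆ prism e := fun _ hx d => (hx d).le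

lemma reach_lerp (d : Fin 4) (w x : E3) (t : ℝ) :
    reach d (w + t • (x - w)) = (1 - t) * reach d w + t * reach d x := by
  rw [reach_add, reach_smul, reach_sub]; ring

lemma lerp_two (w x : E3) (t : ℝ) : (w + t • (x - w)) 2 = (1 - t) * w 2 + t * x 2 := by
  simp; ring

lemma lerp_mem_openPrism {e : Fin 4 → ℝ} {w x : E3} (hw : w ∈ prism e) (hx : x ∈ openPrism e)
    {t : ℝ} (h0 : 0 < t) (h1 : t ≤ 1) : w + t • (x - w) ∈ openPrism e := fun d => by
  rw [reach_lerp]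
  nlinarith [hw d, hx d]

lemma exists_mem_openPrism {e : Fin 4 → ℝ} (he : ∀ d, 0 < e d + e (d + 2)) (h : ℝ) :
    ∃ x ∈ openPrism e, x 2 = h := by
  refine ⟨pt 0 ((e 0 - e 2) / 2) ((e 1 - e 3) / 2) h, ?_, by simp⟩
  have h0 : 0 < e 0 + e 2 := he 0
  have h1 : 0 < e 1 + e 3 := he 1
  refine (forall_side 0).2 ⟨?_, ?_, ?_, ?_⟩
  · rw [reach_pt]; linarith
  · rw [reach_succ_pt]; change _ < e 1; linarith
  · rw [reach_add_two_pt]; change _ < e 2; linarith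
  · rw [reach_add_three_pt]; change _ < e 3; linarith

lemma eventually_mem_Ioo_zero_one : ∀ᶠ t in 𝓝[>] (0 : ℝ), 0 < t ∧ t < 1 :=
  Ioo_mem_nhdsGT one_pos

section Erase
variable {P : Set E3} {C : Fin 3 → Finset ℝ}

/-- A horizontal grid plane at which the section does not change can be removed from the grid. -/
lemma GridSolid.erase (hG : GridSolid P C) {c z₁ z₂ : ℝ} (h₁ : z₁ < c)
    (h₂ : c < z₂) (hgap : ∀ c' ∈ C 2, z₁ ≤ c' → c' ≤ z₂ → c' = c)
    (heq : ∀ s t, pt 0 s t z₁ ∈ P ↔ pt 0 s t z₂ ∈ P) :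
    GridSolid P (Function.update C 2 ((C 2).erase c)) := by
  have hz₁ : z₁ ∉ C 2 := fun h => h₁.ne (hgap _ h le_rfl (h₁.trans h₂).le)
  have cell : ∀ {p : E3} {s t h : ℝ}, (∀ c ∈ C 0, c ∉ uIcc (p 0) s) →
      (∀ c ∈ C 1, c ∉ uIcc (p 1) t) → (∀ c ∈ C 2, c ∉ uIcc (p 2) h) → p ∈ P → pt 0 s t h ∈ P := by
    intro p s t h h0 h1 h2
    refine hG.cell _ _ fun i => ?_
    fin_cases i
    · simpa using h0
    · simpa using h1
    · simpa using h2
  have key : ∀ s t h, s ∉ C 0 → t ∉ C 1 → (∀ c' ∈ (C 2).erase c, c' ∉ uIcc h z₁) →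
      (pt 0 s t h ∈ P ↔ pt 0 s t z₁ ∈ P) := by
    intro s t h hs ht hh
    have hs' : ∀ c ∈ C 0, c ∉ uIcc s s := fun c hc => notMem_uIcc_self fun e => hs (e ▸ hc)
    have ht' : ∀ c ∈ C 1, c ∉ uIcc t t := fun c hc => notMem_uIcc_self fun e => ht (e ▸ hc)
    have col : ∀ {a b : ℝ}, (∀ c ∈ C 2, c ∉ uIcc a b) → (pt 0 s t a ∈ P ↔ pt 0 s t b ∈ P) := by
      intro a b hab
      exact ⟨cell (by simpa using hs') (by simpa using ht') (by simpa using hab),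
        cell (by simpa using hs') (by simpa using ht') (by simpa [uIcc_comm] using hab)⟩
    rcases lt_trichotomy h c with hc | hc | hc
    · refine col fun c' hc' hcc => ?_
      by_cases hcc' : c' = c
      · subst hcc'
        rw [mem_uIcc] at hcc
        rcases hcc with hcc | hcc <;> linarith [hcc.1, hcc.2]
      · exact hh c' (Finset.mem_erase.2 ⟨hcc', hc'⟩) hcc
    · subst hc
      constructor
      · intro hp
        obtain ⟨q, ⟨⟨hq0, hq1⟩, hq2, hq2'⟩, hqP, hqC⟩ := mem_closure_iff.1 (hG.dense hp)
          (((fun q : E3 => q 0) ⁻¹' {a | ∀ c ∈ C 0, c ∉ uIcc a s} ∩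
            (fun q : E3 => q 1) ⁻¹' {a | ∀ c ∈ C 1, c ∉ uIcc a t}) ∩
            ({q | z₁ < q 2} ∩ {q | q 2 < z₂}))
          ((((isOpen_forall_notMem_uIcc _ _).preimage (continuous_coord 0)).inter
            ((isOpen_forall_notMem_uIcc _ _).preimage (continuous_coord 1))).inter
            ((isOpen_lt continuous_const (continuous_coord 2)).inter
              (isOpen_lt (continuous_coord 2) continuous_const)))
          ⟨⟨by simpa using hs', by simpa using ht'⟩, by simpa using h₁, by simpa using h₂⟩
        have hq2 : z₁ < q 2 := hq2
        have hq2' : q 2 < z₂ := hq2'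
        rcases lt_trichotomy (q 2) h with hlt | he | hgt
        · refine cell hq0 hq1 (fun c' hc' hcc => ?_) hqP
          rw [uIcc_of_ge hq2.le] at hcc
          have := hgap c' hc' hcc.1 (by linarith [hcc.2])
          linarith [hcc.2]
        · by_cases hC : h ∈ C 2
          · exact absurd hC (he ▸ hqC 2)
          · refine cell hq0 hq1 (fun c' hc' hcc => ?_) hqP
            rw [uIcc_of_ge hq2.le] at hcc
            have := hgap c' hc' hcc.1 (by linarith [hcc.2])
            exact hC (this ▸ hc')
        · rw [heq]
          refine cell hq0 hq1 (fun c' hc' hcc => ?_) hqP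
          rw [uIcc_of_le hq2'.le] at hcc
          have := hgap c' hc' (by linarith [hcc.1]) hcc.2
          linarith [hcc.1]
      · intro hp
        rw [← hG.closed.closure_eq]
        refine mem_closure_of_ray (-up) ?_
        have hIoo : ∀ᶠ t in 𝓝[>] (0 : ℝ), t ∈ Ioo 0 (h - z₁) := Ioo_mem_nhdsGT (by linarith)
        filter_upwards [hIoo] with τ hτ
        have hpt : pt 0 s t h + τ • (-up) = pt 0 s t (h - τ) := by
          unfold pt
          rw [sub_smul, smul_neg]
          abel
        rw [hpt]
        refine (col fun c' hc' hcc => ?_).2 hp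
        rw [uIcc_of_ge (by linarith [hτ.2])] at hcc
        have := hgap c' hc' hcc.1 (by linarith [hcc.2, hτ.1])
        linarith [hcc.2, hτ.1]
    · rw [heq]
      refine col fun c' hc' hcc => ?_
      rw [mem_uIcc] at hcc
      by_cases hcc' : c' = c
      · subst hcc'
        rcases hcc with hcc | hcc <;> linarith [hcc.1, hcc.2]
      · refine hh c' (Finset.mem_erase.2 ⟨hcc', hc'⟩) (mem_uIcc.2 (Or.inr ?_))
        rcases hcc with hcc | hcc
        · exact absurd (hgap c' hc' (by linarith [hcc.1]) hcc.2) hcc'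
        · exact ⟨by linarith [hcc.1], hcc.2⟩
  refine ⟨hG.closed, hG.bounded, fun p q hpq hp => ?_, ?_⟩
  · have h0 : ∀ c ∈ C 0, c ∉ uIcc (p 0) (q 0) := hpq 0
    have h1 : ∀ c ∈ C 1, c ∉ uIcc (p 1) (q 1) := hpq 1
    have h2 : ∀ c' ∈ (C 2).erase c, c' ∉ uIcc (p 2) (q 2) := by
      have := hpq 2
      rwa [Function.update_self] at this
    by_cases hc : c ∈ C 2 ∧ c ∈ uIcc (p 2) (q 2)
    · have aux : ∀ a b, c ∈ uIcc a b → (∀ c' ∈ (C 2).erase c, c' ∉ uIcc a b) →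
          ∀ c' ∈ (C 2).erase c, c' ∉ uIcc a z₁ := by
        intro a b hab hfree c' hc' hcc
        rcases uIcc_subset_uIcc_union_uIcc (b := c) hcc with h | h
        · exact hfree c' hc' (uIcc_subset_uIcc left_mem_uIcc hab h)
        · rw [uIcc_of_ge h₁.le] at h
          exact (Finset.mem_erase.1 hc').1
            (hgap c' (Finset.mem_erase.1 hc').2 h.1 (by linarith [h.2]))
      have hp' := (key (p 0) (p 1) (p 2) (fun h => h0 _ h left_mem_uIcc)
        (fun h => h1 _ h left_mem_uIcc) (aux _ _ hc.2 h2)).1 ((pt_zero_coord p).symm ▸ hp)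
      have hq' : pt 0 (q 0) (q 1) z₁ ∈ P := cell (by simpa using h0) (by simpa using h1)
        (fun c' hc' => by
          rw [pt_two]
          exact notMem_uIcc_self fun e => hz₁ (e ▸ hc')) hp'
      have := (key (q 0) (q 1) (q 2) (fun h => h0 _ h right_mem_uIcc)
        (fun h => h1 _ h right_mem_uIcc) (aux _ (p 2) (by rw [uIcc_comm]; exact hc.2)
          (by rw [uIcc_comm]; exact h2))).2 hq'
      rwa [pt_zero_coord] at this
    · rw [← pt_zero_coord q]
      refine cell h0 h1 (fun c' hc' hcc => ?_) hp
      by_cases hcc' : c' = c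
      · exact hc ⟨hcc' ▸ hc', hcc' ▸ hcc⟩
      · exact h2 c' (Finset.mem_erase.2 ⟨hcc', hc'⟩) hcc
  · refine hG.dense.trans (closure_mono fun p hp => ⟨hp.1, fun i => ?_⟩)
    fin_cases i
    · exact hp.2 0
    · exact hp.2 1
    · change p 2 ∉ Function.update C 2 ((C 2).erase c) 2
      rw [Function.update_self]
      exact fun h => hp.2 2 (Finset.mem_erase.1 h).2

end Erase

lemma exists_strictMono_enum (D : Finset ℝ) :
    ∃ z : ℕ → ℝ, StrictMono z ∧ ∀ t, t ∈ D ↔ ∃ i < D.card, z i = t := by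
  induction D using Finset.induction_on_max with
  | empty => exact ⟨fun i => i, Nat.strictMono_cast, by simp⟩
  | insert a D hD ih =>
    obtain ⟨z, hz, hmem⟩ := ih
    have ha : a ∉ D := fun h => lt_irrefl _ (hD a h)
    refine ⟨fun i => if i < D.card then z i else a + (i - D.card : ℝ), ?_, ?_⟩
    · refine strictMono_nat_of_lt_succ fun i => ?_
      by_cases h1 : i + 1 < D.card
      · simp only [h1, show i < D.card by omega, if_true]
        exact hz (Nat.lt_succ_self i)
      · by_cases h2 : i < D.card
        · have h3 : D.card = i + 1 := by omega
          simp only [h1, h2, if_true, if_false]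
          have := hD _ ((hmem (z i)).2 ⟨i, h2, rfl⟩)
          rw [h3]; push_cast; linarith
        · simp only [h1, h2, if_false]
          push_cast; linarith
    · intro t
      rw [Finset.card_insert_of_notMem ha, Finset.mem_insert, hmem]
      constructor
      · rintro (rfl | ⟨i, hi, rfl⟩)
        · exact ⟨D.card, by omega, by simp⟩
        · exact ⟨i, by omega, by simp [hi]⟩
      · rintro ⟨i, hi, rfl⟩
        by_cases h : i < D.card
        · exact Or.inr ⟨i, h, by simp [h]⟩
        · have : i = D.card := by omega
          subst this
          exact Or.inl (by simp)

lemma exists_between_consecutive {z : ℕ → ℝ} {k : ℕ} (hk : 0 < k) {t : ℝ} (h0 : z 0 ≤ t)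
    (h1 : t ≤ z k) : ∃ i < k, z i ≤ t ∧ t ≤ z (i + 1) := by
  induction k with
  | zero => omega
  | succ k ih =>
    rcases le_or_gt t (z k) with h | h
    · rcases Nat.eq_zero_or_pos k with rfl | hk'
      · exact ⟨0, hk, h0, h1⟩
      · obtain ⟨i, hi, h2⟩ := ih hk' h
        exact ⟨i, by omega, h2⟩
    · exact ⟨k, by omega, h.le, h1⟩

lemma exists_minimal_gridSolid {P : Set E3} (h : ∃ C, GridSolid P C) :
    ∃ C, GridSolid P C ∧ ∀ C', GridSolid P C' → (C 2).card ≤ (C' 2).card := by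
  obtain ⟨C, hC⟩ := h
  obtain ⟨C, hC, hmin⟩ := WellFounded.has_min
    (InvImage.wf (fun C : Fin 3 → Finset ℝ => (C 2).card) Nat.lt_wfRel.wf)
    {C | GridSolid P C} ⟨C, hC⟩
  exact ⟨C, hC, fun C' hC' => not_lt.1 (hmin C' hC')⟩

/-- The orthostack is a stack of bricks. A grid with the fewest horizontal planes is used, so that
the section changes at each of them. -/
lemma IsTwoReflexOrthostack.exists_stack {P : Set E3} (hP : IsTwoReflexOrthostack P) :
    Nonempty (Stack P) := by
  obtain ⟨C, hG, hmin⟩ := exists_minimal_gridSolid hP.toIsOrthogonalPolyhedron.exists_gridSolid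
  have hcomp : IsCompact P := Metric.isCompact_of_isClosed_isBounded hG.closed hG.bounded
  obtain ⟨x₀, hx₀⟩ := hP.connected.nonempty
  have hpre : IsPreconnected P := hP.connected.isPreconnected
  obtain ⟨M, hM⟩ := hcomp.bddAbove_image (continuous_coord 2).continuousOn
  obtain ⟨m, hm⟩ := hcomp.bddBelow_image (continuous_coord 2).continuousOn
  have hM : ∀ p ∈ P, p 2 ≤ M := fun p hp => hM (mem_image_of_mem _ hp)
  have hm : ∀ p ∈ P, m ≤ p 2 := fun p hp => hm (mem_image_of_mem _ hp)
  have hchange : ∀ c ∈ C 2, ∀ z₁ z₂, z₁ < c → c < z₂ → (∀ c' ∈ C 2, z₁ ≤ c' → c' ≤ z₂ → c' = c) →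
      ¬ ∀ s t, pt 0 s t z₁ ∈ P ↔ pt 0 s t z₂ ∈ P := by
    intro c hc z₁ z₂ h1 h2 h3 h4
    have := hmin _ (hG.erase h1 h2 h3 h4)
    rw [Function.update_self] at this
    exact absurd (Finset.card_erase_lt_of_mem hc) (not_lt.2 this)
  obtain ⟨z, hz, hmem⟩ := exists_strictMono_enum (C 2)
  -- Heights between consecutive grid values.
  have hfree : ∀ {i : ℕ} {a b : ℝ}, z i < a → a < z (i + 1) → z i < b → b < z (i + 1) →
      ∀ c ∈ C 2, c ∉ uIcc a b := by
    intro i a b ha ha' hb hb' c hc hcc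
    obtain ⟨j, -, rfl⟩ := (hmem c).1 hc
    have h1 : z i < z j := by
      rw [mem_uIcc] at hcc
      rcases hcc with hcc | hcc <;> linarith [hcc.1]
    have h2 : z j < z (i + 1) := by
      rw [mem_uIcc] at hcc
      rcases hcc with hcc | hcc <;> linarith [hcc.2]
    rw [hz.lt_iff_lt] at h1 h2
    omega
  have hfree_mem : ∀ {i : ℕ} {a : ℝ}, z i < a → a < z (i + 1) → a ∉ C 2 :=
    fun ha hb hc => hfree ha hb ha hb _ hc left_mem_uIcc
  have hn : 0 < (C 2).card := by
    rw [Finset.card_pos]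
    by_contra hemp
    rw [Finset.not_nonempty_iff_eq_empty] at hemp
    have := hM _ (hG.shift_mem hx₀ (h := M + 1) (by simp [hemp]))
    rw [pt_two] at this
    linarith
  have hbot : ∀ p ∈ P, z 0 ≤ p 2 := by
    intro p hp
    by_contra hlt
    push Not at hlt
    have h1 := hm p hp
    have := hm _ (hG.shift_mem hp (h := m - 1) fun c hc hcc => by
      obtain ⟨j, -, rfl⟩ := (hmem c).1 hc
      rw [uIcc_of_ge (by linarith)] at hcc
      linarith [hcc.2, hz.monotone (Nat.zero_le j)])
    rw [pt_two] at this
    linarith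
  obtain ⟨k, hk⟩ : ∃ k, (C 2).card = k + 1 := ⟨(C 2).card - 1, by omega⟩
  have htop : ∀ p ∈ P, p 2 ≤ z k := by
    intro p hp
    by_contra hlt
    push Not at hlt
    have h1 := hM p hp
    have := hM _ (hG.shift_mem hp (h := M + 1) fun c hc hcc => by
      obtain ⟨j, hj, rfl⟩ := (hmem c).1 hc
      rw [uIcc_of_le (by linarith)] at hcc
      linarith [hcc.1, hz.monotone (show j ≤ k by omega)])
    rw [pt_two] at this
    linarith
  have hk0 : 0 < k := by
    obtain ⟨q, -, hq, hqC⟩ := mem_closure_iff.1 (hG.dense hx₀) _ isOpen_univ (mem_univ _)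
    by_contra hk0
    obtain rfl : k = 0 := by omega
    have : z 0 = q 2 := le_antisymm (hbot q hq) (htop q hq)
    exact hqC 2 ((hmem _).2 ⟨0, by omega, this⟩)
  set mid : ℕ → ℝ := fun i => (z i + z (i + 1)) / 2 with hmid
  have hmid1 : ∀ i, z i < mid i := fun i => by
    have := hz (Nat.lt_succ_self i); simp only [hmid]; linarith
  have hmid2 : ∀ i, mid i < z (i + 1) := fun i => by
    have := hz (Nat.lt_succ_self i); simp only [hmid]; linarith
  -- The grid plane at height `z j` separates the middle heights around it.
  have hgapmid : ∀ i, ∀ c' ∈ C 2, mid i ≤ c' → c' ≤ mid (i + 1) → c' = z (i + 1) := by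
    intro i c hc h1 h2
    obtain ⟨j, -, rfl⟩ := (hmem c).1 hc
    have h3 : z i < z j := (hmid1 i).trans_le h1
    have h4 : z j < z (i + 1 + 1) := h2.trans_lt (hmid2 _)
    rw [hz.lt_iff_lt] at h3 h4
    congr 1; omega
  -- Every brick is nonempty.
  have hne : ∀ i < k, (crossSection P (mid i)).Nonempty := by
    intro i hi
    by_contra hemp
    rw [not_nonempty_iff_eq_empty] at hemp
    have hno : ∀ p ∈ P, p 2 ≠ mid i := fun p hp h => by
      have : p ∈ crossSection P (mid i) := ⟨hp, h⟩
      rw [hemp] at this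
      exact this
    have hcover : P ⊆ {p : E3 | p 2 < mid i} ∪ {p : E3 | mid i < p 2} := fun p hp =>
      lt_or_gt_of_ne (hno p hp)
    have hdisj : Disjoint {p : E3 | p 2 < mid i} {p : E3 | mid i < p 2} :=
      Set.disjoint_left.2 fun p (h1 : p 2 < mid i) (h2 : mid i < p 2) => lt_asymm h1 h2
    rcases hpre.subset_or_subset (isOpen_lt (continuous_coord 2) continuous_const)
      (isOpen_lt continuous_const (continuous_coord 2)) hdisj hcover with h | h
    · refine hchange (z (i + 1)) ((hmem _).2 ⟨i + 1, by omega, rfl⟩) (mid i) (mid (i + 1))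
        (hmid2 i) (hmid1 _) (hgapmid i) fun s t => ⟨fun hp => ?_, fun hp => ?_⟩
      · exact absurd (by simp : (pt 0 s t (mid i)) 2 = mid i) (hno _ hp)
      · have h1 : (pt 0 s t (mid (i + 1))) 2 < mid i := h hp
        rw [pt_two] at h1
        linarith [hmid2 i, hmid1 (i + 1)]
    · obtain ⟨y, hy1, hy2, hy3⟩ := exists_near_left (C 2) (sub_one_lt (z i))
      refine hchange (z i) ((hmem _).2 ⟨i, by omega, rfl⟩) y (mid i) hy2 (hmid1 i) ?_
        fun s t => ⟨fun hp => ?_, fun hp => ?_⟩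
      · intro c hc h1 h2
        rcases lt_trichotomy c (z i) with h3 | h3 | h3
        · linarith [hy3 c hc h3]
        · exact h3
        · obtain ⟨j, -, rfl⟩ := (hmem c).1 hc
          have h4 := h2.trans_lt (hmid2 i)
          rw [hz.lt_iff_lt] at h3 h4
          omega
      · have h1 : mid i < (pt 0 s t y) 2 := h hp
        rw [pt_two] at h1
        linarith [hmid1 i]
      · exact absurd (by simp : (pt 0 s t (mid i)) 2 = mid i) (hno _ hp)
  have hconn : ∀ h, (crossSection P h).Nonempty → IsPreconnected (crossSection P h) :=
      fun h hh => by
    have := hP.orthostack h hh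
    exact (isConnected_iff_connectedSpace.2 inferInstance).isPreconnected
  have hsec : ∀ i, ∃ e : Fin 4 → ℝ, i < k → (∀ d, 0 < e d + e (d + 2)) ∧
      ∀ p : E3, p 2 = mid i → (p ∈ P ↔ p ∈ prism e) := by
    intro i
    by_cases hi : i < k
    · obtain ⟨e, he⟩ := hG.section_eq hP.manifold hP.twoReflex (hfree_mem (hmid1 i) (hmid2 i))
        (hconn _ (hne i hi)) (hne i hi)
      exact ⟨e, fun _ => he⟩
    · exact ⟨0, fun h => absurd h hi⟩
  choose e he using hsec
  have hpos : ∀ i < k, ∀ d, 0 < e i d + e i (d + 2) := fun i hi => (he i hi).1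
  have hslab : ∀ i < k, ∀ p : E3, z i < p 2 → p 2 < z (i + 1) → (p ∈ P ↔ p ∈ prism (e i)) := by
    intro i hi p h1 h2
    rw [← prism_congr (reach_pt_zero p (mid i)), ← (he i hi).2 _ (pt_two _ _ _ _)]
    constructor
    · exact fun hp => hG.shift_mem hp (hfree h1 h2 (hmid1 i) (hmid2 i))
    · intro hp
      have := hG.shift_mem hp (h := p 2) (by rw [pt_two]; exact hfree (hmid1 i) (hmid2 i) h1 h2)
      rwa [pt_zero_zero, pt_zero_one, pt_zero_coord] at this
  have hmem_iff : ∀ p : E3, p ∈ P ↔ ∃ i < k, p ∈ prism (e i) ∧ z i ≤ p 2 ∧ p 2 ≤ z (i + 1) := by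
    intro p
    constructor
    · intro hp
      have hcl : IsClosed (⋃ i ∈ Finset.range k,
          (prism (e i) ∩ {p : E3 | z i ≤ p 2 ∧ p 2 ≤ z (i + 1)})) :=
        isClosed_biUnion_finset fun i _ => (isClosed_prism _).inter
          ((isClosed_le continuous_const (continuous_coord 2)).inter
            (isClosed_le (continuous_coord 2) continuous_const))
      have := closure_minimal (fun q hq => ?_) hcl (hG.dense hp)
      · simp only [mem_iUnion, Finset.mem_range] at this
        obtain ⟨i, hi, h1, h2⟩ := this
        exact ⟨i, hi, h1, h2⟩
      · obtain ⟨hqP, hqC⟩ := hq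
        obtain ⟨i, hi, h1, h2⟩ := exists_between_consecutive hk0 (hbot q hqP) (htop q hqP)
        have h1' : z i < q 2 := lt_of_le_of_ne h1 fun h => hqC 2 ((hmem _).2 ⟨i, by omega, h⟩)
        have h2' : q 2 < z (i + 1) :=
          lt_of_le_of_ne h2 fun h => hqC 2 ((hmem _).2 ⟨i + 1, by omega, h.symm⟩)
        simp only [mem_iUnion, Finset.mem_range]
        exact ⟨i, hi, (hslab i hi q h1' h2').1 hqP, h1, h2⟩
    · rintro ⟨i, hi, hpe, h1, h2⟩
      rw [← hG.closed.closure_eq]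
      refine mem_closure_of_ray ((mid i - p 2) • up) ?_
      filter_upwards [eventually_mem_Ioo_zero_one] with t ht
      rw [smul_smul]
      refine (hslab i hi _ ?_ ?_).2 ((prism_congr (reach_add_smul_up p _)).2 hpe)
      · rw [add_smul_up_two]; nlinarith [hmid1 i, ht.1, ht.2]
      · rw [add_smul_up_two]; nlinarith [hmid2 i, ht.1, ht.2]
  have hnei : ∀ i, i + 1 < k → e i ≠ e (i + 1) := by
    intro i hi heq
    refine hchange (z (i + 1)) ((hmem _).2 ⟨i + 1, by omega, rfl⟩) (mid i) (mid (i + 1))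
        (hmid2 i) (hmid1 _) (hgapmid i) fun s t => ?_
    rw [(he i (by omega)).2 _ (pt_two _ _ _ _), (he (i + 1) hi).2 _ (pt_two _ _ _ _), heq]
    refine prism_congr fun d => ?_
    exact reach_congr (by simp) (by simp) d
  refine ⟨⟨k, z, e, hk0, hz, hpos, fun i hi => ?_, hnei, hmem_iff⟩⟩
  -- At an interface, the section is the union of two rectangles; being connected it makes them
  -- meet, and the manifold condition excludes that they merely touch.
  obtain ⟨c, hc⟩ : ∃ c, c = z (i + 1) := ⟨_, rfl⟩
  have hzi := hz (Nat.lt_succ_self i)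
  have hzi1 := hz (Nat.lt_succ_self (i + 1))
  have hsecc : ∀ p : E3, p 2 = c → (p ∈ P ↔ p ∈ prism (e i) ∨ p ∈ prism (e (i + 1))) := by
    intro p hp
    rw [hmem_iff]
    constructor
    · rintro ⟨j, hj, h0, h1, h2⟩
      rw [hp, hc, hz.le_iff_le] at h1 h2
      rcases (show j = i ∨ j = i + 1 by omega) with rfl | rfl
      · exact Or.inl h0
      · exact Or.inr h0
    · rintro (h | h)
      · exact ⟨i, by omega, h, by rw [hp, hc]; exact hzi.le, by rw [hp, hc]⟩
      · exact ⟨i + 1, hi, h, by rw [hp, hc], by rw [hp, hc]; exact hzi1.le⟩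
  obtain ⟨x₁, hx₁, hx₁c⟩ := exists_mem_openPrism (hpos i (by omega)) c
  obtain ⟨x₂, hx₂, hx₂c⟩ := exists_mem_openPrism (hpos (i + 1) hi) c
  have hx₁P : x₁ ∈ crossSection P c :=
    ⟨(hsecc _ hx₁c).2 (Or.inl (openPrism_subset_prism _ hx₁)), hx₁c⟩
  have hx₂P : x₂ ∈ crossSection P c :=
    ⟨(hsecc _ hx₂c).2 (Or.inr (openPrism_subset_prism _ hx₂)), hx₂c⟩
  obtain ⟨w, ⟨hwP, hwc⟩, hw1, hw2⟩ := isPreconnected_closed_iff.1 (hconn c ⟨_, hx₁P⟩) _ _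
    (isClosed_prism (e i)) (isClosed_prism (e (i + 1))) (fun p hp => (hsecc p hp.2).1 hp.1)
    ⟨x₁, hx₁P, openPrism_subset_prism _ hx₁⟩ ⟨x₂, hx₂P, openPrism_subset_prism _ hx₂⟩
  by_contra hcon
  push Not at hcon
  obtain ⟨d, hd⟩ := hcon
  have hint : ∀ p ∈ interior P, p 2 = c → reach d p = e i d := by
    intro p hp hpc
    have hev := eventually_add_smul_mem isOpen_interior hp up
    have hev' := eventually_add_smul_mem isOpen_interior hp (-up)
    have hsm : ∀ᶠ t in 𝓝[>] (0 : ℝ), t ∈ Ioo 0 (min (c - z i) (z (i + 1 + 1) - c)) :=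
      Ioo_mem_nhdsGT (lt_min (by linarith) (by rw [hc]; linarith))
    obtain ⟨t, ⟨h1, h2⟩, h3, h4⟩ := ((hev.and hev').and hsm).exists
    have h5 := h4.trans_le (min_le_left _ _)
    have h6 := h4.trans_le (min_le_right _ _)
    have h7 := (prism_congr (reach_add_smul_up p t)).1
      ((hslab (i + 1) hi _ (by rw [add_smul_up_two]; linarith)
        (by rw [add_smul_up_two]; linarith)).1 (interior_subset h1))
    rw [smul_neg, ← neg_smul] at h2
    have h8 := (prism_congr (reach_add_smul_up p (-t))).1
      ((hslab i (by omega) _ (by rw [add_smul_up_two]; linarith)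
        (by rw [add_smul_up_two]; linarith)).1 (interior_subset h2))
    have h9 := h7 (d + 2)
    rw [reach_add_two] at h9
    linarith [h8 d]
  have hint : ∀ p ∈ interior P, p 2 ≠ c := by
    intro p hp hpc
    obtain ⟨t, ht, ht0⟩ := ((eventually_add_smul_mem isOpen_interior hp (sideNormal d)).and
      self_mem_nhdsWithin).exists
    have ht0 : (0 : ℝ) < t := ht0
    have h1 := hint p hp hpc
    have h2 := hint _ ht (by simp [hpc])
    rw [reach_add, reach_smul, reach_sideNormal, h1] at h2
    linarith
  have hwf : w ∈ frontier P := by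
    rw [hG.closed.frontier_eq]
    exact ⟨hwP, fun h => hint w h hwc⟩
  obtain ⟨V, -, hVo, hwV, hV⟩ := hP.manifold.exists_isPreconnected hwf isOpen_univ (mem_univ _)
  have happ : ∀ j < k, w ∈ prism (e j) → z j ≤ c → c ≤ z (j + 1) →
      (interior P ∩ V ∩ {p : E3 | z j < p 2 ∧ p 2 < z (j + 1)}).Nonempty := by
    intro j hj hw h1 h2
    obtain ⟨x, hx, hxz⟩ := exists_mem_openPrism (hpos j hj) (mid j)
    obtain ⟨t, htV, ht0, ht1⟩ := ((eventually_add_smul_mem hVo hwV (x - w)).and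
      eventually_mem_Ioo_zero_one).exists
    have h3 : w + t • (x - w) ∈ openPrism (e j) := lerp_mem_openPrism hw hx ht0 ht1.le
    have h4 : w + t • (x - w) ∈ {p : E3 | z j < p 2 ∧ p 2 < z (j + 1)} := by
      rw [mem_ofPred_eq, lerp_two, hwc, hxz]
      constructor <;> nlinarith [hmid1 j, hmid2 j]
    refine ⟨_, ⟨?_, htV⟩, h4⟩
    refine interior_maximal (s := P) (t := openPrism (e j) ∩ {p : E3 | z j < p 2 ∧ p 2 < z (j + 1)})
      ?_ ?_ ⟨h3, h4⟩
    · exact fun q hq => (hslab j hj q hq.2.1 hq.2.2).2 (openPrism_subset_prism _ hq.1)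
    · exact (isOpen_openPrism _).inter ((isOpen_lt continuous_const (continuous_coord 2)).inter
        (isOpen_lt (continuous_coord 2) continuous_const))
  obtain ⟨q₁, hq₁, -, hq₁'⟩ := happ i (by omega) hw1 (by rw [hc]; exact hzi.le) hc.le
  obtain ⟨q₂, hq₂, hq₂', -⟩ := happ (i + 1) hi hw2 hc.ge (by rw [hc]; exact hzi1.le)
  obtain ⟨q, -, hqA, hqB⟩ := hV {p : E3 | p 2 < c} {p : E3 | c < p 2}
    (isOpen_lt (continuous_coord 2) continuous_const)
    (isOpen_lt continuous_const (continuous_coord 2))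
    (fun p hp => lt_or_gt_of_ne (hint p hp.1)) ⟨q₁, hq₁, by rw [hc]; exact hq₁'⟩
    ⟨q₂, hq₂, by rw [hc]; exact hq₂'⟩
  exact lt_asymm (show q 2 < c from hqA) hqB

/-! ### There are finitely many faces -/

/-- A plane on which a coordinate is constant is an axis-orthogonal plane. -/
lemma plane_eq_of_subset {n : E3} {c : ℝ} (hn : n ≠ 0) {i : Fin 3} {a : ℝ}
    (h : ∀ x ∈ plane n c, x i = a) : plane n c = {x | x i = a} := by
  have hnn : inner ℝ n n ≠ (0 : ℝ) := inner_self_ne_zero.2 hn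
  set y : E3 := (c / inner ℝ n n : ℝ) • n with hy
  have hyp : y ∈ plane n c := by
    simp only [plane, mem_ofPred_eq, hy, real_inner_smul_right]
    field_simp
  -- Directions of the plane have vanishing `i`-th coordinate; this is applied below to the part of
  -- the `i`-th unit vector orthogonal to `n`.
  have hperp : ∀ v : E3, inner ℝ n v = (0 : ℝ) → v i = 0 := by
    intro v hv
    have h1 := h (y + v) (by
      have : inner ℝ n y = c := hyp
      simp [plane, inner_add_right, hv, this])
    have h2 := h y hyp
    simp only [PiLp.add_apply] at h1
    linarith
  have hin : inner ℝ n (EuclideanSpace.single i (1 : ℝ)) = n i := by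
    simp [EuclideanSpace.inner_single_right]
  have hval := hperp (EuclideanSpace.single i (1 : ℝ) - (n i / inner ℝ n n : ℝ) • n) (by
    rw [inner_sub_right, real_inner_smul_right, hin]
    field_simp
    ring)
  have hni : n i * n i = inner ℝ n n := by
    simp only [PiLp.sub_apply, PiLp.smul_apply, smul_eq_mul, PiLp.single_apply, if_true] at hval
    field_simp at hval
    linarith
  have hn0 : n - n i • EuclideanSpace.single i (1 : ℝ) = 0 := by
    have hs : inner ℝ (EuclideanSpace.single i (1 : ℝ) : E3) n = n i := by rw [real_inner_comm, hin]
    have hss : inner ℝ (EuclideanSpace.single i (1 : ℝ) : E3) (EuclideanSpace.single i (1 : ℝ)) =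
      (1 : ℝ) := by simp
    rw [← inner_self_eq_zero (𝕜 := ℝ), inner_sub_left, inner_sub_right, inner_sub_right,
      real_inner_smul_left, real_inner_smul_left, real_inner_smul_right, real_inner_smul_right, hin,
      hs, hss]
    linarith
  have hform : ∀ x : E3, inner ℝ n x = n i * x i := by
    intro x
    rw [sub_eq_zero.1 hn0, real_inner_smul_left]
    simp [EuclideanSpace.inner_single_left]
  have hni0 : n i ≠ 0 := fun h0 => hnn (by rw [← hni, h0, mul_zero])
  refine Subset.antisymm h fun x (hx : x i = a) => ?_
  have h1 : inner ℝ n y = c := hyp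
  have h2 := h y hyp
  rw [hform] at h1
  change inner ℝ n x = c
  rw [hform, hx, ← h2, h1]

lemma flatPart_congr {P : Set E3} {n n' : E3} {c c' : ℝ} (h : plane n c = plane n' c') :
    flatPart P n c = flatPart P n' c' := by
  unfold flatPart; rw [h]

lemma GridSolid.exists_mem_of_frontier {P : Set E3} {C : Fin 3 → Finset ℝ} (hG : GridSolid P C)
    {x : E3} (hx : x ∈ frontier P) : ∃ i, x i ∈ C i := by
  by_contra hno
  push Not at hno
  rw [hG.closed.frontier_eq] at hx
  have hN : IsOpen (⋂ i, (fun q : E3 => q i) ⁻¹' {t | ∀ c ∈ C i, c ∉ uIcc t (x i)}) :=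
    isOpen_iInter_of_finite fun i => (isOpen_forall_notMem_uIcc _ _).preimage (continuous_coord i)
  refine hx.2 (interior_maximal (fun q hq => ?_) hN (mem_iInter.2 fun i c hc =>
    notMem_uIcc_self fun e : x i = c => hno i (e ▸ hc)))
  refine hG.cell x q (fun i c hc => ?_) hx.1
  rw [uIcc_comm]
  exact mem_iInter.1 hq i c hc

/-- Within an axis-orthogonal plane, lying on the boundary is constant on the open cells of the
grid. -/
lemma GridSolid.frontier_of_cell {P : Set E3} {C : Fin 3 → Finset ℝ} (hG : GridSolid P C)
    {i : Fin 3} {y w : E3} (hy : y ∈ frontier P) (hi : w i = y i)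
    (hj : ∀ j ≠ i, ∀ c ∈ C j, c ∉ uIcc (w j) (y j)) : w ∈ frontier P := by
  set φ : E3 → E3 := fun q => w + (q i - y i) • EuclideanSpace.single i 1 with hφ
  have hφc : Continuous φ := by fun_prop
  have hφy : φ y = w := by simp [hφ]
  have hφi : ∀ q, φ q i = q i := fun q => by simp [hφ, hi]
  have hφj : ∀ q, ∀ j ≠ i, φ q j = w j := fun q j hji => by simp [hφ, hji]
  have hN : IsOpen (⋂ j, {q : E3 | j ≠ i → ∀ c ∈ C j, c ∉ uIcc (q j) (y j)}) := by
    refine isOpen_iInter_of_finite fun j => ?_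
    by_cases hji : j = i
    · simp [hji]
    · simp only [ne_eq, hji, not_false_eq_true, forall_const]
      exact (isOpen_forall_notMem_uIcc _ _).preimage (continuous_coord j)
  have hyN : y ∈ ⋂ j, {q : E3 | j ≠ i → ∀ c ∈ C j, c ∉ uIcc (q j) (y j)} :=
    mem_iInter.2 fun j hji c hc hcc => hj j hji c hc (by
      rw [uIcc_self, mem_singleton_iff] at hcc; rw [hcc]; exact right_mem_uIcc)
  have hstep : ∀ q ∈ ⋂ j, {q : E3 | j ≠ i → ∀ c ∈ C j, c ∉ uIcc (q j) (y j)}, q i ∉ C i →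
      (q ∈ P ↔ φ q ∈ P) := by
    intro q hq hqi
    have hq := mem_iInter.1 hq
    have hfree : ∀ j, ∀ c ∈ C j, c ∉ uIcc (q j) (φ q j) := by
      intro j c hc
      by_cases hji : j = i
      · subst hji
        rw [hφi]
        exact notMem_uIcc_self fun e => hqi (e ▸ hc)
      · rw [hφj q j hji]
        intro hcc
        rcases uIcc_subset_uIcc_union_uIcc (b := y j) hcc with h | h
        · exact hq j hji c hc h
        · exact hj j hji c hc (by rwa [uIcc_comm])
    exact ⟨hG.cell _ _ hfree, hG.cell _ _ fun j c hc => by rw [uIcc_comm]; exact hfree j c hc⟩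
  rw [frontier_eq_closure_inter_closure] at hy ⊢
  constructor
  · rw [mem_closure_iff]
    intro O hO hwO
    obtain ⟨q, ⟨hq1, hq2⟩, hqP, hqC⟩ := mem_closure_iff.1 (hG.dense (hG.closed.closure_eq ▸ hy.1))
      _ ((hO.preimage hφc).inter hN) ⟨by rwa [mem_preimage, hφy], hyN⟩
    exact ⟨φ q, hq1, (hstep q hq2 (hqC i)).1 hqP⟩
  · rw [mem_closure_iff]
    intro O hO hwO
    have hy2 : y ∈ closure (Pᶜ ∩ {p | ∀ i, p i ∉ C i}) :=
      closure_minimal (subset_closure_inter_generic hG.closed.isOpen_compl C) isClosed_closure hy.2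
    obtain ⟨q, ⟨hq1, hq2⟩, hqP, hqC⟩ := mem_closure_iff.1 hy2
      _ ((hO.preimage hφc).inter hN) ⟨by rwa [mem_preimage, hφy], hyN⟩
    exact ⟨φ q, hq1, fun h => hqP ((hstep q hq2 (hqC i)).2 h)⟩

/-- Every component of a flat part contains a point in an open cell of the grid of its plane. -/
lemma exists_generic_in_component {P : Set E3} (C : Fin 3 → Finset ℝ) {n : E3} {c : ℝ} {i : Fin 3}
    {a : ℝ} (hpl : plane n c = {x | x i = a}) {y : E3} (hy : y ∈ flatPart P n c) :
    ∃ w ∈ connectedComponentIn (flatPart P n c) y, ∀ j ≠ i, w j ∉ C j := by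
  obtain ⟨ε, hε, hb⟩ := exists_ball_subset_component (mem_connectedComponentIn hy)
  have hyi : y i = a := by
    have := hy.1
    rw [hpl] at this
    exact this
  set v : E3 := (∑ j, EuclideanSpace.single j 1) - EuclideanSpace.single i 1 with hv
  have hvi : v i = 0 := by fin_cases i <;> simp [hv, Fin.sum_univ_three]
  have hvj : ∀ j ≠ i, v j = 1 := fun j hj => by
    fin_cases i <;> fin_cases j <;> simp_all [Fin.sum_univ_three]
  have h1 : ∀ j : Fin 3, ∀ᶠ t in 𝓝[>] (0 : ℝ), y j + t ∉ C j := by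
    intro j
    have := eventually_gt_notMem ((C j).image fun c => c - y j) 0
    filter_upwards [this] with t ht htC
    exact ht (Finset.mem_image.2 ⟨_, htC, by ring⟩)
  obtain ⟨t, ht, hti⟩ := ((eventually_add_smul_mem Metric.isOpen_ball
    (Metric.mem_ball_self hε) v).and (eventually_all.2 h1)).exists
  refine ⟨y + t • v, hb ⟨?_, ht⟩, fun j hj => ?_⟩
  · rw [hpl]; simp [hvi, hyi]
  · simpa [hvj j hj] using hti j

/-- An orthogonal polyhedron has finitely many faces: a face is determined by the axis it is
orthogonal to and by the grid cell of any of its points that lies in an open cell of its plane. -/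
lemma IsOrthogonalPolyhedron.finite_faces {P : Set E3} (hP : IsOrthogonalPolyhedron P) :
    (faces P).Finite := by
  classical
  obtain ⟨C, hG⟩ := hP.exists_gridSolid
  let R : Set E3 → Fin 3 × (Fin 3 → Finset ℝ) → Prop := fun F l =>
    ∃ (n : E3) (c a : ℝ) (w : E3), plane n c = {x | x l.1 = a} ∧ w ∈ flatPart P n c ∧
      F = faceAt P n c w ∧ (∀ j ≠ l.1, w j ∉ C j) ∧ a ∈ C l.1 ∧
      l.2 = fun j => (C j).filter (· < w j)
  have hex : ∀ F ∈ faces P, ∃ l, l ∈ (Finset.univ ×ˢ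
      Fintype.piFinset fun j => (C j).powerset : Finset (Fin 3 × (Fin 3 → Finset ℝ))) ∧ R F l := by
    rintro F ⟨n, c, hn, y, hy, rfl⟩
    obtain ⟨i, a, hia⟩ := hP.plane_subset hn hy
    have hpl := plane_eq_of_subset hn hia
    obtain ⟨w, hw, hwC⟩ := exists_generic_in_component C hpl hy
    have hwf := connectedComponentIn_subset _ _ hw
    have hwi : w i = a := hia w hwf.1
    refine ⟨(i, fun j => (C j).filter (· < w j)), ?_, n, c, a, w, hpl, hwf, ?_, hwC, ?_, rfl⟩
    · simp only [Finset.mem_product, Finset.mem_univ, true_and, Fintype.mem_piFinset,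
        Finset.mem_powerset]
      exact fun j => Finset.filter_subset _ _
    · rw [faceAt, connectedComponentIn_eq hw]
    · obtain ⟨j, hj⟩ := hG.exists_mem_of_frontier (flatPart_subset_frontier _ _ _ hwf)
      by_cases hji : j = i
      · subst hji; exact hwi ▸ hj
      · exact absurd hj (hwC j hji)
  have huniq : ∀ F F' l, R F l → R F' l → F = F' := by
    rintro F F' ⟨i, A⟩ ⟨n, c, a, w, hpl, hw, rfl, hwC, ha, hA⟩
      ⟨n', c', a', w', hpl', hw', rfl, hwC', ha', hA'⟩
    simp only at hpl hwC ha hA hpl' hwC' ha' hA'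
    have hfil : ∀ j, ∀ x ∈ C j, (x < w j ↔ x < w' j) := by
      intro j x hx
      have := congrFun (hA.symm.trans hA') j
      have h2 := Finset.ext_iff.1 this x
      simpa [hx] using h2
    have hwi : w i = a := by have := hw.1; rw [hpl] at this; exact this
    have hwi' : w' i = a' := by have := hw'.1; rw [hpl'] at this; exact this
    have haa : a = a' := by
      have h1 := hfil i a ha
      have h2 := hfil i a' ha'
      rw [hwi, hwi'] at h1 h2
      rcases lt_trichotomy a a' with h | h | h
      · exact absurd (h1.2 h) (lt_irrefl _)
      · exact h
      · exact absurd (h2.1 h) (lt_irrefl _)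
    subst haa
    have hfree : ∀ j ≠ i, ∀ x ∈ C j, x ∉ uIcc (w' j) (w j) := by
      intro j hj x hx hxx
      have h1 := hfil j x hx
      have h2 : x ≠ w j := fun e => hwC j hj (e ▸ hx)
      have h3 : x ≠ w' j := fun e => hwC' j hj (e ▸ hx)
      rw [mem_uIcc] at hxx
      rcases hxx with ⟨h4, h5⟩ | ⟨h4, h5⟩
      · exact absurd (h1.1 (lt_of_le_of_ne h5 h2)) (not_lt.2 h4)
      · exact absurd (h1.2 (lt_of_le_of_ne h5 h3)) (not_lt.2 h4)
    unfold faceAt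
    rw [← flatPart_congr (hpl.trans hpl'.symm)]
    set W : Set E3 := ⋂ j, {q : E3 | j ≠ i → ∀ c ∈ C j, c ∉ uIcc (q j) (w j)} with hW
    have hWo : IsOpen W := by
      refine isOpen_iInter_of_finite fun j => ?_
      by_cases hji : j = i
      · simp [hji]
      · simp only [ne_eq, hji, not_false_eq_true, forall_const]
        exact (isOpen_forall_notMem_uIcc _ _).preimage (continuous_coord j)
    have hWflat : plane n c ∩ W ⊆ flatPart P n c := by
      refine plane_inter_subset_flatPart hWo ?_
      rintro q ⟨hq1, hq2⟩
      rw [hpl] at hq1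
      exact hG.frontier_of_cell (flatPart_subset_frontier _ _ _ hw)
        ((show q i = a from hq1).trans hwi.symm) (fun j hj => mem_iInter.1 hq2 j hj)
    have hseg : segment ℝ w w' ⊆ plane n c ∩ W := by
      intro q hq
      have hqj : ∀ j, q j ∈ uIcc (w j) (w' j) := by
        intro j
        rw [← segment_eq_uIcc]
        obtain ⟨r, s, hr, hs, hrs, rfl⟩ := hq
        exact ⟨r, s, hr, hs, hrs, by simp⟩
      constructor
      · rw [hpl]
        have := hqj i
        rw [hwi, hwi', uIcc_self, mem_singleton_iff] at this
        exact this
      · refine mem_iInter.2 fun j hj x hx hxx => hfree j hj x hx ?_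
        rw [uIcc_comm]
        refine uIcc_subset_uIcc (hqj j) left_mem_uIcc hxx
    have hcomp : w' ∈ connectedComponentIn (flatPart P n c) w :=
      (convex_segment w w').isPreconnected.subset_connectedComponentIn (left_mem_segment ℝ w w')
        (hseg.trans hWflat) (right_mem_segment ℝ w w')
    rw [connectedComponentIn_eq hcomp]
  choose! f hf using hex
  refine Set.Finite.of_injOn (f := f) (t := (↑(Finset.univ ×ˢ
      Fintype.piFinset fun j => (C j).powerset : Finset (Fin 3 × (Fin 3 → Finset ℝ))) : Set _))
      (fun F hF => (hf F hF).1) (fun F hF F' hF' h => ?_) (Finset.finite_toSet _)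
  exact huniq F F' (f F) (hf F hF).2 (h ▸ (hf F' hF').2)

/-! ### Boundary and interior of a stack of bricks -/

lemma convex_reach_lt (d : Fin 4) (c : ℝ) : Convex ℝ {x : E3 | reach d x < c} :=
  convex_halfSpace_lt ⟨reach_add d, fun r x => reach_smul d r x⟩ c

lemma convex_lt_reach (d : Fin 4) (c : ℝ) : Convex ℝ {x : E3 | c < reach d x} :=
  convex_halfSpace_gt ⟨reach_add d, fun r x => reach_smul d r x⟩ c

lemma convex_coord_lt (i : Fin 3) (c : ℝ) : Convex ℝ {x : E3 | x i < c} :=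
  convex_halfSpace_lt (f := fun x : E3 => x i) ⟨fun _ _ => rfl, fun _ _ => rfl⟩ c

lemma convex_lt_coord (i : Fin 3) (c : ℝ) : Convex ℝ {x : E3 | c < x i} :=
  convex_halfSpace_gt (f := fun x : E3 => x i) ⟨fun _ _ => rfl, fun _ _ => rfl⟩ c

lemma convex_openPrism (e : Fin 4 → ℝ) : Convex ℝ (openPrism e) := by
  have : openPrism e = ⋂ d, {x | reach d x < e d} := by ext; simp [openPrism]
  rw [this]
  exact convex_iInter fun d => convex_reach_lt d _

lemma convex_prism (e : Fin 4 → ℝ) : Convex ℝ (prism e) := by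
  have : prism e = ⋂ d, {x | reach d x ≤ e d} := by ext; simp [prism]
  rw [this]
  exact convex_iInter fun d => convex_halfSpace_le ⟨reach_add d, fun r x => reach_smul d r x⟩ _

lemma plane_up (h : ℝ) : plane up h = {x : E3 | x 2 = h} := by
  ext x
  simp [plane, up, EuclideanSpace.inner_single_left]

lemma up_ne_zero : up ≠ 0 := fun h => by
  have := up_two
  rw [h] at this
  simp at this

lemma mem_plane_sideNormal {d : Fin 4} {c : ℝ} {x : E3} :
    x ∈ plane (sideNormal d) c ↔ reach d x = c := Iff.rfl

lemma mem_plane_up {h : ℝ} {x : E3} : x ∈ plane up h ↔ x 2 = h := by rw [plane_up]; rfl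

/-- A convex open set whose intersection with a plane lies in the boundary provides a piece of a
face. -/
lemma face_of_convex {P U : Set E3} {n : E3} {c : ℝ} (hU : IsOpen U) (hconv : Convex ℝ U)
    (hfr : plane n c ∩ U ⊆ frontier P) {y : E3} (hy : y ∈ plane n c ∩ U) :
    y ∈ flatPart P n c ∧ plane n c ∩ U ⊆ connectedComponentIn (flatPart P n c) y ∧
      ∀ x ∈ plane n c, (∀ t : ℝ, 0 < t → t < 1 → x + t • (y - x) ∈ U) → x ∈ faceAt P n c y := by
  have hflat := plane_inter_subset_flatPart hU hfr
  have hcomp := ((convex_plane n c).inter hconv).isPreconnected.subset_connectedComponentIn hy hflat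
  refine ⟨hflat hy, hcomp, fun x hx hxt => mem_closure_of_ray (y - x) ?_⟩
  filter_upwards [eventually_mem_Ioo_zero_one] with t ht
  refine hcomp ⟨?_, hxt t ht.1 ht.2⟩
  have h1 : inner ℝ n x = c := hx
  have h2 : inner ℝ n y = c := hy.1
  change inner ℝ n (x + t • (y - x)) = c
  rw [inner_add_right, real_inner_smul_right, inner_sub_right, h1, h2]
  ring

/-- A point of `P` that can be left along a ray is a boundary point. -/
lemma frontier_of_ray {P : Set E3} {p : E3} (hp : p ∈ P) (v : E3)
    (h : ∀ᶠ t in 𝓝[>] (0 : ℝ), p + t • v ∉ P) : p ∈ frontier P := by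
  refine ⟨subset_closure hp, fun hi => ?_⟩
  obtain ⟨t, h1, h2⟩ := (h.and (eventually_add_smul_mem isOpen_interior hi v)).exists
  exact h1 (interior_subset h2)

namespace Stack

variable {P : Set E3} (S : Stack P)

/-- The `i`-th brick of the stack. -/
def brick (i : ℕ) : Set E3 := prism (S.e i) ∩ {x | S.z i ≤ x 2 ∧ x 2 ≤ S.z (i + 1)}

variable {S}

lemma z_lt (S : Stack P) (i : ℕ) : S.z i < S.z (i + 1) := S.strictMono (Nat.lt_succ_self i)

lemma brick_subset {i : ℕ} (hi : i < S.k) : S.brick i ⊆ P := fun x hx =>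
  (S.mem_iff x).2 ⟨i, hi, hx.1, hx.2⟩

lemma convex_brick (S : Stack P) (i : ℕ) : Convex ℝ (S.brick i) := by
  refine (convex_prism _).inter (Convex.inter ?_ ?_)
  · exact convex_halfSpace_ge (f := fun x : E3 => x 2) ⟨fun _ _ => rfl, fun _ _ => rfl⟩ _
  · exact convex_halfSpace_le (f := fun x : E3 => x 2) ⟨fun _ _ => rfl, fun _ _ => rfl⟩ _

lemma exists_brick {x : E3} (hx : x ∈ P) : ∃ i < S.k, x ∈ S.brick i := by
  obtain ⟨i, hi, h1, h2⟩ := (S.mem_iff x).1 hx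
  exact ⟨i, hi, h1, h2⟩

lemma isClosed (S : Stack P) : IsClosed P := by
  have : P = ⋃ i ∈ Finset.range S.k, S.brick i := by
    ext x
    rw [S.mem_iff]
    simp only [mem_iUnion, Finset.mem_range, exists_prop]
    rfl
  rw [this]
  exact isClosed_biUnion_finset fun i _ => (isClosed_prism _).inter
    ((isClosed_le continuous_const (continuous_coord 2)).inter
      (isClosed_le (continuous_coord 2) continuous_const))

lemma le_height {x : E3} (hx : x ∈ P) : S.z 0 ≤ x 2 := by
  obtain ⟨i, -, -, h, -⟩ := (S.mem_iff x).1 hx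
  exact (S.strictMono.monotone (Nat.zero_le i)).trans h

lemma height_le {x : E3} (hx : x ∈ P) : x 2 ≤ S.z S.k := by
  obtain ⟨i, hi, -, -, h⟩ := (S.mem_iff x).1 hx
  exact h.trans (S.strictMono.monotone (Nat.succ_le_of_lt hi))

/-- Only brick `i` contains heights strictly between `z i` and `z (i + 1)`. -/
lemma index_eq {i j : ℕ} {h : ℝ} (h1 : S.z i < h) (h2 : h < S.z (i + 1)) (h3 : S.z j ≤ h)
    (h4 : h ≤ S.z (j + 1)) : j = i := by
  have h5 := h1.trans_le h4
  have h6 := h3.trans_lt h2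
  rw [S.strictMono.lt_iff_lt] at h5 h6
  omega

lemma mem_prism_of_mem {i : ℕ} {x : E3} (hx : x ∈ P) (h1 : S.z i < x 2) (h2 : x 2 < S.z (i + 1)) :
    x ∈ prism (S.e i) := by
  obtain ⟨j, -, h, h3, h4⟩ := (S.mem_iff x).1 hx
  rwa [index_eq h1 h2 h3 h4] at h

lemma interior_of_openPrism {i : ℕ} (hi : i < S.k) {x : E3} (hx : x ∈ openPrism (S.e i))
    (h1 : S.z i < x 2) (h2 : x 2 < S.z (i + 1)) : x ∈ interior P := by
  refine interior_maximal (s := P) (t := openPrism (S.e i) ∩ ({q : E3 | S.z i < q 2} ∩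
    {q : E3 | q 2 < S.z (i + 1)})) ?_ ?_ ⟨hx, h1, h2⟩
  · exact fun q hq => brick_subset hi ⟨openPrism_subset_prism _ hq.1, hq.2.1.le, hq.2.2.le⟩
  · exact (isOpen_openPrism _).inter ((isOpen_lt continuous_const (continuous_coord 2)).inter
      (isOpen_lt (continuous_coord 2) continuous_const))

lemma interior_of_interface {i : ℕ} (hi : i + 1 < S.k) {x : E3} (hx : x ∈ openPrism (S.e i))
    (hx' : x ∈ openPrism (S.e (i + 1))) (h : x 2 = S.z (i + 1)) : x ∈ interior P := by
  refine interior_maximal (s := P) (t := (openPrism (S.e i) ∩ openPrism (S.e (i + 1))) ∩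
    ({q : E3 | S.z i < q 2} ∩ {q : E3 | q 2 < S.z (i + 1 + 1)})) ?_ ?_
    ⟨⟨hx, hx'⟩, by rw [mem_ofPred_eq, h]; exact S.z_lt i, by rw [mem_ofPred_eq, h]; exact S.z_lt _⟩
  · rintro q ⟨⟨hq, hq'⟩, hq1, hq2⟩
    rcases le_total (q 2) (S.z (i + 1)) with h | h
    · exact brick_subset (by omega) ⟨openPrism_subset_prism _ hq, le_of_lt hq1, h⟩
    · exact brick_subset hi ⟨openPrism_subset_prism _ hq', h, le_of_lt hq2⟩
  · exact ((isOpen_openPrism _).inter (isOpen_openPrism _)).inter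
      ((isOpen_lt continuous_const (continuous_coord 2)).inter
      (isOpen_lt (continuous_coord 2) continuous_const))

/-- A point extremal in a horizontal direction among the points at its height is a boundary
point. -/
lemma frontier_of_side {x : E3} (hx : x ∈ P) {d : Fin 4}
    (h : ∀ j < S.k, S.z j ≤ x 2 → x 2 ≤ S.z (j + 1) → S.e j d ≤ reach d x) : x ∈ frontier P := by
  refine frontier_of_ray hx (sideNormal d) ?_
  filter_upwards [self_mem_nhdsWithin] with t ht hP
  have ht : (0 : ℝ) < t := ht
  obtain ⟨j, hj, h0, h1, h2⟩ := (S.mem_iff _).1 hP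
  have h3 := h0 d
  rw [reach_add, reach_smul, reach_sideNormal] at h3
  simp only [PiLp.add_apply, PiLp.smul_apply, sideNormal_two, smul_zero, add_zero] at h1 h2
  linarith [h j hj h1 h2]

lemma frontier_of_notMem_above {i : ℕ} {x : E3} (hx : x ∈ P) (hz : x 2 = S.z (i + 1))
    (h : i + 1 < S.k → x ∉ prism (S.e (i + 1))) : x ∈ frontier P := by
  refine frontier_of_ray hx up ?_
  have hIoo : ∀ᶠ t in 𝓝[>] (0 : ℝ), t ∈ Ioo 0 (S.z (i + 1 + 1) - S.z (i + 1)) :=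
    Ioo_mem_nhdsGT (by linarith [S.z_lt (i + 1)])
  filter_upwards [hIoo] with t ht hP
  obtain ⟨j, hj, h0, h1, h2⟩ := (S.mem_iff _).1 hP
  rw [add_smul_up_two, hz] at h1 h2
  have hji := index_eq (S := S) (i := i + 1) (by linarith [ht.1]) (by linarith [ht.2]) h1 h2
  subst hji
  exact h hj ((prism_congr (reach_add_smul_up x t)).1 h0)

lemma frontier_of_notMem_below {i : ℕ} {x : E3} (hx : x ∈ P) (hz : x 2 = S.z (i + 1))
    (h : x ∉ prism (S.e i)) : x ∈ frontier P := by
  refine frontier_of_ray hx (-up) ?_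
  have hIoo : ∀ᶠ t in 𝓝[>] (0 : ℝ), t ∈ Ioo 0 (S.z (i + 1) - S.z i) :=
    Ioo_mem_nhdsGT (by linarith [S.z_lt i])
  filter_upwards [hIoo] with t ht hP
  obtain ⟨j, hj, h0, h1, h2⟩ := (S.mem_iff _).1 hP
  rw [smul_neg, ← neg_smul, add_smul_up_two, hz] at h1 h2
  have hji := index_eq (S := S) (i := i) (by linarith [ht.2]) (by linarith [ht.1]) h1 h2
  subst hji
  rw [smul_neg, ← neg_smul] at h0
  exact h ((prism_congr (reach_add_smul_up x (-t))).1 h0)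

lemma frontier_of_bottom {x : E3} (hx : x ∈ P) (hz : x 2 = S.z 0) : x ∈ frontier P := by
  refine frontier_of_ray hx (-up) ?_
  filter_upwards [self_mem_nhdsWithin] with t ht hP
  have ht : (0 : ℝ) < t := ht
  have := S.le_height hP
  rw [smul_neg, ← neg_smul, add_smul_up_two] at this
  linarith

/-! ### Walls -/

lemma overlap' (S : Stack P) {i : ℕ} (hi : i + 1 < S.k) (d : Fin 4) :
    0 < S.e (i + 1) d + S.e i (d + 2) := by
  have := S.overlap i hi (d + 2)
  rw [add_two_add_two] at this
  linarith

lemma pos' (S : Stack P) {i : ℕ} (hi : i < S.k) (d : Fin 4) :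
    0 < S.e i (d + 1) + S.e i (d + 3) := by
  have := S.pos i hi (d + 1)
  rwa [add_one_add_two] at this

/-- Points whose coordinate along side `d` and whose height lie in open intervals. -/
def sideSlab (d : Fin 4) (a b h₁ h₂ : ℝ) : Set E3 :=
  {x | (a < reach (d + 1) x ∧ reach (d + 1) x < b) ∧ h₁ < x 2 ∧ x 2 < h₂}

lemma isOpen_sideSlab (d : Fin 4) (a b h₁ h₂ : ℝ) : IsOpen (sideSlab d a b h₁ h₂) :=
  ((isOpen_lt continuous_const (continuous_reach _)).inter
    (isOpen_lt (continuous_reach _) continuous_const)).inter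
    ((isOpen_lt continuous_const (continuous_coord 2)).inter
      (isOpen_lt (continuous_coord 2) continuous_const))

lemma convex_sideSlab (d : Fin 4) (a b h₁ h₂ : ℝ) : Convex ℝ (sideSlab d a b h₁ h₂) :=
  ((convex_lt_reach _ _).inter (convex_reach_lt _ _)).inter
    ((convex_lt_coord _ _).inter (convex_coord_lt _ _))

lemma lerp_mem_sideSlab {d : Fin 4} {a b h₁ h₂ : ℝ} {x y : E3} (hy : y ∈ sideSlab d a b h₁ h₂)
    (h1 : a ≤ reach (d + 1) x) (h2 : reach (d + 1) x ≤ b) (h3 : h₁ ≤ x 2) (h4 : x 2 ≤ h₂) {t : ℝ}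
    (ht0 : 0 < t) (ht1 : t < 1) : x + t • (y - x) ∈ sideSlab d a b h₁ h₂ := by
  obtain ⟨⟨h5, h6⟩, h7, h8⟩ := hy
  refine ⟨⟨?_, ?_⟩, ?_, ?_⟩
  · rw [reach_lerp]; nlinarith
  · rw [reach_lerp]; nlinarith
  · rw [lerp_two]; nlinarith
  · rw [lerp_two]; nlinarith

variable (S)

/-- The centre of the wall of brick `i` on side `d`. -/
noncomputable def wallPt (i : ℕ) (d : Fin 4) : E3 :=
  pt d (S.e i d) ((S.e i (d + 1) - S.e i (d + 3)) / 2) ((S.z i + S.z (i + 1)) / 2)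

/-- The face containing the wall of brick `i` on side `d`. -/
noncomputable def wallFace (i : ℕ) (d : Fin 4) : Set E3 :=
  faceAt P (sideNormal d) (S.e i d) (S.wallPt i d)

variable {S}

lemma wall_frontier {i : ℕ} (hi : i < S.k) (d : Fin 4) :
    plane (sideNormal d) (S.e i d) ∩
      sideSlab d (-S.e i (d + 3)) (S.e i (d + 1)) (S.z i) (S.z (i + 1)) ⊆ frontier P := by
  rintro x ⟨hx, ⟨h1, h2⟩, h3, h4⟩
  rw [mem_plane_sideNormal] at hx
  have hxP : x ∈ prism (S.e i) := (forall_side d).2 ⟨hx.le, h2.le, by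
    rw [reach_add_two]; linarith [S.pos i hi d], by rw [reach_add_three]; linarith⟩
  refine frontier_of_side (S := S) (brick_subset hi ⟨hxP, h3.le, h4.le⟩) (d := d)
    fun j _ h5 h6 => ?_
  rw [index_eq h3 h4 h5 h6, hx]

lemma wallPt_mem {i : ℕ} (hi : i < S.k) (d : Fin 4) :
    S.wallPt i d ∈ plane (sideNormal d) (S.e i d) ∩
      sideSlab d (-S.e i (d + 3)) (S.e i (d + 1)) (S.z i) (S.z (i + 1)) := by
  have h1 := S.pos' hi d
  have h2 := S.z_lt i
  refine ⟨mem_plane_sideNormal.2 (by simp [wallPt]), ⟨?_, ?_⟩, ?_, ?_⟩ <;>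
    simp only [wallPt, reach_succ_pt, pt_two] <;> linarith

lemma wallPt_mem_flatPart {i : ℕ} (hi : i < S.k) (d : Fin 4) :
    S.wallPt i d ∈ flatPart P (sideNormal d) (S.e i d) :=
  (face_of_convex (isOpen_sideSlab _ _ _ _ _) (convex_sideSlab _ _ _ _ _) (wall_frontier hi d)
    (wallPt_mem hi d)).1

lemma wallFace_mem_faces {i : ℕ} (hi : i < S.k) (d : Fin 4) : S.wallFace i d ∈ faces P :=
  faceAt_mem_faces (sideNormal_ne_zero d) (wallPt_mem_flatPart hi d)

lemma mem_wallFace {i : ℕ} (hi : i < S.k) {d : Fin 4} {x : E3} (hx : x ∈ S.brick i)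
    (hd : reach d x = S.e i d) : x ∈ S.wallFace i d := by
  refine (face_of_convex (isOpen_sideSlab _ _ _ _ _) (convex_sideSlab _ _ _ _ _)
    (wall_frontier hi d) (wallPt_mem hi d)).2.2 x hd fun t h0 h1 => ?_
  have h3 := hx.1 (d + 3)
  rw [reach_add_three] at h3
  exact lerp_mem_sideSlab (wallPt_mem hi d).2 (by linarith) (hx.1 (d + 1)) hx.2.1 hx.2.2 h0 h1

/-- Flush walls of consecutive bricks belong to the same face. -/
lemma wallFace_succ {i : ℕ} (hi : i + 1 < S.k) {d : Fin 4} (hd : S.e i d = S.e (i + 1) d) :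
    S.wallFace i d = S.wallFace (i + 1) d := by
  have hi' : i < S.k := by omega
  have hz := S.z_lt i
  have hz' := S.z_lt (i + 1)
  set a := max (-S.e i (d + 3)) (-S.e (i + 1) (d + 3)) with ha
  set b := min (S.e i (d + 1)) (S.e (i + 1) (d + 1)) with hb
  have hab : a < b := by
    have h1 := S.overlap i hi (d + 1)
    have h2 := S.overlap' hi (d + 1)
    rw [add_one_add_two] at h1 h2
    have h3 := S.pos' hi' d
    have h4 := S.pos' hi d
    exact max_lt (lt_min (by linarith) (by linarith)) (lt_min (by linarith) (by linarith))
  have hfr : plane (sideNormal d) (S.e i d) ∩ sideSlab d a b (S.z i) (S.z (i + 1 + 1)) ⊆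
      frontier P := by
    rintro x ⟨hx, ⟨h1, h2⟩, h3, h4⟩
    rw [mem_plane_sideNormal] at hx
    have h1a := (le_max_left _ _).trans_lt h1
    have h1b := (le_max_right _ _).trans_lt h1
    have h2a := h2.trans_le (min_le_left _ _)
    have h2b := h2.trans_le (min_le_right _ _)
    have hxP : x ∈ P := by
      rcases le_total (x 2) (S.z (i + 1)) with h | h
      · exact brick_subset hi' ⟨(forall_side d).2 ⟨hx.le, h2a.le, by
          rw [reach_add_two]; linarith [S.pos i hi' d], by
          rw [reach_add_three]; linarith⟩, h3.le, h⟩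
      · exact brick_subset hi ⟨(forall_side d).2 ⟨(hx.trans hd).le, h2b.le, by
          rw [reach_add_two]; linarith [S.pos _ hi d], by
          rw [reach_add_three]; linarith⟩, h, h4.le⟩
    refine frontier_of_side (S := S) hxP (d := d) fun j _ h5 h6 => ?_
    have h7 := h3.trans_le h6
    have h8 := h5.trans_lt h4
    rw [S.strictMono.lt_iff_lt] at h7 h8
    rcases (show j = i ∨ j = i + 1 by omega) with rfl | rfl
    · exact hx.ge
    · rw [hx, hd]
  -- A point in each of the two walls, joined by a vertical segment.
  have hy : ∀ h, S.z i < h → h < S.z (i + 1 + 1) → pt d (S.e i d) ((a + b) / 2) h ∈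
      plane (sideNormal d) (S.e i d) ∩ sideSlab d a b (S.z i) (S.z (i + 1 + 1)) := by
    intro h h1 h2
    refine ⟨mem_plane_sideNormal.2 (by simp), ⟨?_, ?_⟩, ?_, ?_⟩ <;>
      simp only [reach_succ_pt, pt_two] <;> linarith
  have hy₁ := hy ((S.z i + S.z (i + 1)) / 2) (by linarith) (by linarith)
  have hy₂ := hy ((S.z (i + 1) + S.z (i + 1 + 1)) / 2) (by linarith) (by linarith)
  have hmem :=
    (face_of_convex (isOpen_sideSlab _ _ _ _ _) (convex_sideSlab _ _ _ _ _) hfr hy₁).2.1 hy₂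
  have h1 : pt d (S.e i d) ((a + b) / 2) ((S.z i + S.z (i + 1)) / 2) ∈
      connectedComponentIn (flatPart P (sideNormal d) (S.e i d)) (S.wallPt i d) := by
    refine (face_of_convex (isOpen_sideSlab _ _ _ _ _) (convex_sideSlab _ _ _ _ _)
      (wall_frontier hi' d) (wallPt_mem hi' d)).2.1 ⟨hy₁.1, ?_⟩
    have := le_max_left (-S.e i (d + 3)) (-S.e (i + 1) (d + 3))
    have := min_le_left (S.e i (d + 1)) (S.e (i + 1) (d + 1))
    refine ⟨⟨?_, ?_⟩, ?_, ?_⟩ <;> simp only [reach_succ_pt, pt_two] <;> linarith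
  have h2 : pt d (S.e i d) ((a + b) / 2) ((S.z (i + 1) + S.z (i + 1 + 1)) / 2) ∈
      connectedComponentIn (flatPart P (sideNormal d) (S.e (i + 1) d)) (S.wallPt (i + 1) d) := by
    refine (face_of_convex (isOpen_sideSlab _ _ _ _ _) (convex_sideSlab _ _ _ _ _)
      (wall_frontier hi d) (wallPt_mem hi d)).2.1 ⟨by rw [← hd]; exact hy₂.1, ?_⟩
    have := le_max_right (-S.e i (d + 3)) (-S.e (i + 1) (d + 3))
    have := min_le_right (S.e i (d + 1)) (S.e (i + 1) (d + 1))
    refine ⟨⟨?_, ?_⟩, ?_, ?_⟩ <;> simp only [reach_succ_pt, pt_two] <;> linarith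
  unfold wallFace faceAt
  rw [← hd] at h2 ⊢
  rw [connectedComponentIn_eq h1, connectedComponentIn_eq hmem, connectedComponentIn_eq h2]

/-- The wall of brick `i` on side `d` does not continue into the brick below. -/
def WallStart (S : Stack P) (i : ℕ) (d : Fin 4) : Prop := i = 0 ∨ S.e (i - 1) d ≠ S.e i d

/-- A face that starts with the wall of brick `i` does not reach below that brick, so that different
starting walls belong to different faces. -/
lemma height_of_wallStart {i : ℕ} (hi : i < S.k) {d : Fin 4} (h : S.WallStart i d) :
    ∀ x ∈ S.wallFace i d, S.z i ≤ x 2 := by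
  rcases i with _ | i
  · exact fun x hx => S.le_height (S.isClosed.frontier_subset (faceAt_subset_frontier hx))
  replace h : S.e i d ≠ S.e (i + 1) d := by
    rcases h with h | h
    · omega
    · exact h
  -- Just below the interface the plane of the wall has no flat boundary points.
  have hno : ∀ x ∈ flatPart P (sideNormal d) (S.e (i + 1) d), S.z i < x 2 → x 2 < S.z (i + 1) →
      False := by
    rintro x ⟨hxp, ε, hε, hb⟩ h1 h2
    have hxd : reach d x = S.e (i + 1) d := hxp
    have hxe := mem_prism_of_mem
      (S.isClosed.frontier_subset (hb ⟨hxp, Metric.mem_ball_self hε⟩)) h1 h2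
    have hlt : S.e (i + 1) d < S.e i d := lt_of_le_of_ne (hxd ▸ hxe d) h.symm
    have hpos := S.pos' (show i < S.k by omega) d
    have hx₀ : pt d (S.e (i + 1) d) ((S.e i (d + 1) - S.e i (d + 3)) / 2) (x 2) ∈
        openPrism (S.e i) := by
      refine (forall_side d).2 ⟨?_, ?_, ?_, ?_⟩
      · rw [reach_pt]; exact hlt
      · rw [reach_succ_pt]; linarith
      · rw [reach_add_two_pt]; linarith [S.overlap' hi d]
      · rw [reach_add_three_pt]; linarith
    obtain ⟨t, ht, ht0, ht1⟩ := ((eventually_add_smul_mem Metric.isOpen_ball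
      (Metric.mem_ball_self hε) (pt d (S.e (i + 1) d) ((S.e i (d + 1) - S.e i (d + 3)) / 2) (x 2)
        - x)).and eventually_mem_Ioo_zero_one).exists
    have hheight := lerp_two x (pt d (S.e (i + 1) d) ((S.e i (d + 1) - S.e i (d + 3)) / 2) (x 2)) t
    rw [pt_two] at hheight
    have hheight' := hheight.trans (by ring : (1 - t) * x 2 + t * x 2 = x 2)
    refine (hb ⟨?_, ht⟩).2 (interior_of_openPrism (by omega)
      (lerp_mem_openPrism hxe hx₀ ht0 ht1.le) (by rw [hheight']; exact h1)
      (by rw [hheight']; exact h2))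
    rw [mem_plane_sideNormal, reach_lerp, reach_pt, hxd]
    ring
  refine faceAt_subset (isClosed_le continuous_const (continuous_coord 2)) fun x hx => ?_
  by_contra hlt
  have hlt : x 2 < S.z (i + 1) := not_le.1 hlt
  obtain ⟨h, hh1, hh2⟩ := exists_between (max_lt hlt (S.z_lt i))
  have hc := (wallPt_mem hi d).2.2.1
  obtain ⟨q, hq, hqh⟩ := isPreconnected_connectedComponentIn.intermediate_value hx
    (mem_connectedComponentIn (wallPt_mem_flatPart hi d)) (continuous_coord 2).continuousOn
    (show h ∈ Icc (x 2) (S.wallPt (i + 1) d 2) from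
      ⟨((le_max_left _ _).trans_lt hh1).le, (hh2.trans hc).le⟩)
  simp only at hqh
  exact hno q (connectedComponentIn_subset _ _ hq)
    (by rw [hqh]; exact (le_max_right _ _).trans_lt hh1)
    (by rw [hqh]; exact hh2)

/-- A point of the wall of brick `i` on side `d` with prescribed position along the side and
prescribed height. -/
lemma pt_mem_wallFace {i : ℕ} (hi : i < S.k) {d : Fin 4} {t h : ℝ} (h1 : -S.e i (d + 3) ≤ t)
    (h2 : t ≤ S.e i (d + 1)) (h3 : S.z i ≤ h) (h4 : h ≤ S.z (i + 1)) :
    pt d (S.e i d) t h ∈ S.wallFace i d := by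
  refine mem_wallFace hi ⟨pt_mem_prism.2 ⟨⟨le_rfl, ?_⟩, h2, h1⟩, ?_, ?_⟩ (by simp)
  · linarith [S.pos i hi d]
  · rw [pt_two]; exact h3
  · rw [pt_two]; exact h4

lemma wallFace_injective {i i' : ℕ} (hi : i < S.k) (hi' : i' < S.k) {d d' : Fin 4}
    (h : S.WallStart i d) (h' : S.WallStart i' d') (heq : S.wallFace i d = S.wallFace i' d') :
    i = i' ∧ d = d' := by
  have hpt : ∀ {i : ℕ} (_ : i < S.k) (d : Fin 4),
      pt d (S.e i d) (S.e i (d + 1)) (S.z i) ∈ S.wallFace i d ∧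
      pt d (S.e i d) (-S.e i (d + 3)) (S.z i) ∈ S.wallFace i d := fun {i} hi d => by
    have h1 := S.pos' hi d
    exact ⟨pt_mem_wallFace hi (by linarith) le_rfl le_rfl (S.z_lt i).le,
      pt_mem_wallFace hi le_rfl (by linarith) le_rfl (S.z_lt i).le⟩
  have hii : i = i' := by
    have h1 := height_of_wallStart hi' h' _ (heq ▸ (hpt hi d).1)
    have h2 := height_of_wallStart hi h _ (heq.symm ▸ (hpt hi' d').1)
    rw [pt_two, S.strictMono.le_iff_le] at h1 h2
    omega
  subst hii
  refine ⟨rfl, ?_⟩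
  have h1 : reach d' (pt d (S.e i d) (S.e i (d + 1)) (S.z i)) = S.e i d' :=
    faceAt_subset_plane (heq ▸ (hpt hi d).1 : _ ∈ S.wallFace i d')
  have h2 : reach d' (pt d (S.e i d) (-S.e i (d + 3)) (S.z i)) = S.e i d' :=
    faceAt_subset_plane (heq ▸ (hpt hi d).2 : _ ∈ S.wallFace i d')
  have h3 := S.pos' hi d
  revert h1 h2
  refine (forall_side d (p := fun d' =>
    reach d' (pt d (S.e i d) (S.e i (d + 1)) (S.z i)) = S.e i d' →
    reach d' (pt d (S.e i d) (-S.e i (d + 3)) (S.z i)) = S.e i d' → d = d')).2 ⟨?_, ?_, ?_, ?_⟩ d'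
  · exact fun _ _ => rfl
  · rw [reach_succ_pt, reach_succ_pt]
    intro h1 h2; linarith
  · rw [reach_add_two_pt]
    intro h1; linarith [S.pos i hi d]
  · rw [reach_add_three_pt, reach_add_three_pt]
    intro h1 h2; linarith

/-! ### Horizontal faces -/

variable (S)

/-- How the side `d` moves at the interface between bricks `i` and `i + 1`: the sign is `1` if brick
`i` extends further in direction `d`, `-1` if brick `i + 1` does, and `0` if the sides are flush. -/
noncomputable def sgn (i : ℕ) (d : Fin 4) : SignType := SignType.sign (S.e i d - S.e (i + 1) d)

/-- Among bricks `i` and `i + 1`, the rectangle of the one that extends further in direction `d`. -/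
noncomputable def outer (i : ℕ) (d : Fin 4) : Fin 4 → ℝ :=
  if S.e (i + 1) d < S.e i d then S.e i else S.e (i + 1)

/-- Among bricks `i` and `i + 1`, the rectangle of the one that extends less in direction `d`. -/
noncomputable def inner (i : ℕ) (d : Fin 4) : Fin 4 → ℝ :=
  if S.e (i + 1) d < S.e i d then S.e (i + 1) else S.e i

/-- A point of the interface between bricks `i` and `i + 1` where only the outer one is present, on
side `d`. -/
noncomputable def stripPt (i : ℕ) (d : Fin 4) : E3 :=
  pt d ((S.outer i d d + S.inner i d d) / 2) ((S.outer i d (d + 1) - S.outer i d (d + 3)) / 2)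
    (S.z (i + 1))

/-- The horizontal face at the interface between bricks `i` and `i + 1` that contains the part of
the outer rectangle protruding on side `d`. -/
noncomputable def stripFace (i : ℕ) (d : Fin 4) : Set E3 :=
  faceAt P up (S.z (i + 1)) (S.stripPt i d)

variable {S}

lemma sgn_eq_one {i : ℕ} {d : Fin 4} : S.sgn i d = 1 ↔ S.e (i + 1) d < S.e i d := by
  rw [sgn, sign_eq_one_iff, sub_pos]

lemma sgn_eq_neg_one {i : ℕ} {d : Fin 4} : S.sgn i d = -1 ↔ S.e i d < S.e (i + 1) d := by
  rw [sgn, sign_eq_neg_one_iff, sub_neg]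

lemma sgn_eq_zero {i : ℕ} {d : Fin 4} : S.sgn i d = 0 ↔ S.e i d = S.e (i + 1) d := by
  rw [sgn, sign_eq_zero_iff, sub_eq_zero]

lemma sgn_cases {i : ℕ} {d : Fin 4} (h : S.sgn i d ≠ 0) :
    (S.sgn i d = 1 ∧ S.outer i d = S.e i ∧ S.inner i d = S.e (i + 1)) ∨
    (S.sgn i d = -1 ∧ S.outer i d = S.e (i + 1) ∧ S.inner i d = S.e i) := by
  rcases lt_trichotomy (S.e (i + 1) d) (S.e i d) with hlt | heq | hgt
  · exact Or.inl ⟨sgn_eq_one.2 hlt, if_pos hlt, if_pos hlt⟩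
  · exact absurd (sgn_eq_zero.2 heq.symm) h
  · exact Or.inr ⟨sgn_eq_neg_one.2 hgt, if_neg hgt.not_gt, if_neg hgt.not_gt⟩

lemma inner_lt_outer {i : ℕ} {d : Fin 4} (h : S.sgn i d ≠ 0) : S.inner i d d < S.outer i d d := by
  rcases sgn_cases h with ⟨h1, h2, h3⟩ | ⟨h1, h2, h3⟩ <;> rw [h2, h3]
  · exact sgn_eq_one.1 h1
  · exact sgn_eq_neg_one.1 h1

lemma outer_le_inner {i : ℕ} {d d' : Fin 4} (h : S.sgn i d ≠ 0) (h' : S.sgn i d' ≠ S.sgn i d) :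
    S.outer i d d' ≤ S.inner i d d' := by
  rcases sgn_cases h with ⟨h1, h2, h3⟩ | ⟨h1, h2, h3⟩ <;> rw [h2, h3] <;> rw [h1] at h'
  · rwa [Ne, sgn_eq_one, not_lt] at h'
  · rwa [Ne, sgn_eq_neg_one, not_lt] at h'

lemma pos_outer {i : ℕ} (hi : i + 1 < S.k) {d : Fin 4} (h : S.sgn i d ≠ 0) (d' : Fin 4) :
    0 < S.outer i d d' + S.outer i d (d' + 2) := by
  rcases sgn_cases h with ⟨h1, h2, h3⟩ | ⟨h1, h2, h3⟩ <;> rw [h2]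
  · exact S.pos i (by omega) d'
  · exact S.pos _ hi d'

lemma pos_inner {i : ℕ} (hi : i + 1 < S.k) {d : Fin 4} (h : S.sgn i d ≠ 0) (d' : Fin 4) :
    0 < S.inner i d d' + S.inner i d (d' + 2) := by
  rcases sgn_cases h with ⟨h1, h2, h3⟩ | ⟨h1, h2, h3⟩ <;> rw [h3]
  · exact S.pos _ hi d'
  · exact S.pos i (by omega) d'

lemma overlap_inner_outer {i : ℕ} (hi : i + 1 < S.k) {d : Fin 4} (h : S.sgn i d ≠ 0) (d' : Fin 4) :
    0 < S.inner i d d' + S.outer i d (d' + 2) := by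
  rcases sgn_cases h with ⟨h1, h2, h3⟩ | ⟨h1, h2, h3⟩ <;> rw [h2, h3]
  · exact S.overlap' hi d'
  · exact S.overlap i hi d'

lemma overlap_outer_inner {i : ℕ} (hi : i + 1 < S.k) {d : Fin 4} (h : S.sgn i d ≠ 0) (d' : Fin 4) :
    0 < S.outer i d d' + S.inner i d (d' + 2) := by
  rcases sgn_cases h with ⟨h1, h2, h3⟩ | ⟨h1, h2, h3⟩ <;> rw [h2, h3]
  · exact S.overlap i hi d'
  · exact S.overlap' hi d'

lemma strip_frontier {i : ℕ} (hi : i + 1 < S.k) {d : Fin 4} (h : S.sgn i d ≠ 0) :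
    plane up (S.z (i + 1)) ∩ (openPrism (S.outer i d) ∩ {x | S.inner i d d < reach d x}) ⊆
      frontier P := by
  rintro x ⟨hx, hxA, hxB⟩
  have hxz := mem_plane_up.1 hx
  have hnot : x ∉ prism (S.inner i d) := fun h' => absurd (h' d) (not_le.2 hxB)
  replace hxA := openPrism_subset_prism _ hxA
  rcases sgn_cases h with ⟨h1, h2, h3⟩ | ⟨h1, h2, h3⟩ <;> rw [h2] at hxA <;> rw [h3] at hnot
  · exact frontier_of_notMem_above (S := S)
      (brick_subset (i := i) (by omega) ⟨hxA, by rw [hxz]; exact (S.z_lt i).le, hxz.le⟩) hxz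
      fun _ => hnot
  · exact frontier_of_notMem_below (S := S)
      (brick_subset hi ⟨hxA, hxz.ge, by rw [hxz]; exact (S.z_lt _).le⟩) hxz hnot

lemma isOpen_convex_strip (S : Stack P) (i : ℕ) (d : Fin 4) :
    IsOpen (openPrism (S.outer i d) ∩ {x | S.inner i d d < reach d x}) ∧
    Convex ℝ (openPrism (S.outer i d) ∩ {x | S.inner i d d < reach d x}) :=
  ⟨(isOpen_openPrism _).inter (isOpen_lt continuous_const (continuous_reach d)),
    (convex_openPrism _).inter (convex_lt_reach _ _)⟩

lemma stripPt_mem {i : ℕ} (hi : i + 1 < S.k) {d : Fin 4} (h : S.sgn i d ≠ 0) :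
    S.stripPt i d ∈
    plane up (S.z (i + 1)) ∩ (openPrism (S.outer i d) ∩ {x | S.inner i d d < reach d x}) := by
  have h1 := inner_lt_outer h
  have h2 := overlap_inner_outer hi h d
  have h3 := pos_outer hi h (d + 1)
  have h4 := pos_outer hi h d
  rw [add_one_add_two] at h3
  refine ⟨mem_plane_up.2 (by simp [stripPt]), (forall_side d).2 ⟨?_, ?_, ?_, ?_⟩, ?_⟩
  · rw [stripPt, reach_pt]; linarith
  · rw [stripPt, reach_succ_pt]; linarith
  · rw [stripPt, reach_add_two_pt]; linarith
  · rw [stripPt, reach_add_three_pt]; linarith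
  · rw [mem_ofPred_eq, stripPt, reach_pt]; linarith

lemma stripPt_mem_flatPart {i : ℕ} (hi : i + 1 < S.k) {d : Fin 4} (h : S.sgn i d ≠ 0) :
    S.stripPt i d ∈ flatPart P up (S.z (i + 1)) :=
  (face_of_convex (S.isOpen_convex_strip i d).1 (S.isOpen_convex_strip i d).2 (strip_frontier hi h)
    (stripPt_mem hi h)).1

lemma stripFace_mem_faces {i : ℕ} (hi : i + 1 < S.k) {d : Fin 4} (h : S.sgn i d ≠ 0) :
    S.stripFace i d ∈ faces P :=
  faceAt_mem_faces up_ne_zero (stripPt_mem_flatPart hi h)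

lemma mem_stripFace {i : ℕ} (hi : i + 1 < S.k) {d : Fin 4} (h : S.sgn i d ≠ 0) {x : E3}
    (hx : x ∈ prism (S.outer i d)) (hxB : S.inner i d d ≤ reach d x)
    (hz : x 2 = S.z (i + 1)) : x ∈ S.stripFace i d := by
  refine (face_of_convex (S.isOpen_convex_strip i d).1 (S.isOpen_convex_strip i d).2
    (strip_frontier hi h) (stripPt_mem hi h)).2.2 x (mem_plane_up.2 hz) fun t h0 h1 => ?_
  have h2 := stripPt_mem hi h
  refine ⟨lerp_mem_openPrism hx h2.2.1 h0 h1.le, ?_⟩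
  have h3 : S.inner i d d < reach d (S.stripPt i d) := h2.2.2
  rw [mem_ofPred_eq, reach_lerp]
  nlinarith

/-- A horizontal face at an interface has points on the common boundary of the two bricks. -/
lemma exists_mem_stripFace {i : ℕ} (hi : i + 1 < S.k) {d : Fin 4} (h : S.sgn i d ≠ 0) :
    ∃ x ∈ S.stripFace i d, x ∈ S.brick i ∧ x ∈ S.brick (i + 1) := by
  have p1 := pos_outer hi h (d + 1)
  have p2 := pos_inner hi h (d + 1)
  have p3 := overlap_inner_outer hi h (d + 1)
  have p4 := overlap_outer_inner hi h (d + 1)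
  rw [add_one_add_two] at p1 p2 p3 p4
  obtain ⟨s, hs1, hs2⟩ := exists_between (max_lt (lt_min (show -S.outer i d (d + 3) <
    S.outer i d (d + 1) by linarith) (show _ < S.inner i d (d + 1) by linarith))
    (lt_min (show -S.inner i d (d + 3) < S.outer i d (d + 1) by linarith)
    (show _ < S.inner i d (d + 1) by linarith)))
  have hs1a := (le_max_left _ _).trans_lt hs1
  have hs1b := (le_max_right _ _).trans_lt hs1
  have hs2a := hs2.trans_le (min_le_left _ _)
  have hs2b := hs2.trans_le (min_le_right _ _)
  have hA : pt d (S.inner i d d) s (S.z (i + 1)) ∈ prism (S.outer i d) :=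
    pt_mem_prism.2 ⟨⟨(inner_lt_outer h).le, by linarith [overlap_inner_outer hi h d]⟩, hs2a.le,
      hs1a.le⟩
  have hB : pt d (S.inner i d d) s (S.z (i + 1)) ∈ prism (S.inner i d) :=
    pt_mem_prism.2 ⟨⟨le_rfl, by linarith [pos_inner hi h d]⟩, hs2b.le, hs1b.le⟩
  have hz : (pt d (S.inner i d d) s (S.z (i + 1))) 2 = S.z (i + 1) := pt_two _ _ _ _
  refine ⟨_, mem_stripFace hi h hA (by rw [reach_pt]) hz, ?_⟩
  generalize pt d (S.inner i d d) s (S.z (i + 1)) = x at hA hB hz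
  have h1 := (S.z_lt i).le
  have h2 := (S.z_lt (i + 1)).le
  rcases sgn_cases h with ⟨-, e1, e2⟩ | ⟨-, e1, e2⟩ <;> rw [e1] at hA <;> rw [e2] at hB
  · exact ⟨⟨hA, by rw [hz]; exact h1, hz.le⟩, ⟨hB, hz.ge, by rw [hz]; exact h2⟩⟩
  · exact ⟨⟨hB, by rw [hz]; exact h1, hz.le⟩, ⟨hA, hz.ge, by rw [hz]; exact h2⟩⟩

lemma height_of_mem_stripFace {i : ℕ} {d : Fin 4} {x : E3} (hx : x ∈ S.stripFace i d) :
    x 2 = S.z (i + 1) :=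
  mem_plane_up.1 (faceAt_subset_plane hx)

/-- At an interface, a flat boundary point belongs to exactly one of the two rectangles. -/
lemma mem_prism_iff_of_flatPart {i : ℕ} (hi : i + 1 < S.k) {x : E3}
    (hx : x ∈ flatPart P up (S.z (i + 1))) : x ∈ prism (S.e i) ↔ x ∉ prism (S.e (i + 1)) := by
  have hxz := mem_plane_up.1 hx.1
  constructor
  · intro h1 h2
    have hpos : ∀ d,
        0 < min (S.e i d) (S.e (i + 1) d) + min (S.e i (d + 2)) (S.e (i + 1) (d + 2)) := by
      intro d
      have a1 := S.pos i (by omega) d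
      have a2 := S.pos _ hi d
      have a3 := S.overlap i hi d
      have a4 := S.overlap' hi d
      rcases min_choice (S.e i d) (S.e (i + 1) d) with e1 | e1 <;>
        rcases min_choice (S.e i (d + 2)) (S.e (i + 1) (d + 2)) with e2 | e2 <;>
        rw [e1, e2] <;> assumption
    obtain ⟨x₀, hx₀, hx₀z⟩ := exists_mem_openPrism (e := fun d => min (S.e i d) (S.e (i + 1) d))
      hpos (S.z (i + 1))
    obtain ⟨-, ε, hε, hb⟩ := hx
    obtain ⟨t, ht, ht0, ht1⟩ := ((eventually_add_smul_mem Metric.isOpen_ball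
      (Metric.mem_ball_self hε) (x₀ - x)).and eventually_mem_Ioo_zero_one).exists
    have hz : (x + t • (x₀ - x)) 2 = S.z (i + 1) := by rw [lerp_two, hxz, hx₀z]; ring
    exact (hb ⟨mem_plane_up.2 hz, ht⟩).2 (interior_of_interface hi
      (lerp_mem_openPrism h1 (fun d => (hx₀ d).trans_le (min_le_left _ _)) ht0 ht1.le)
      (lerp_mem_openPrism h2 (fun d => (hx₀ d).trans_le (min_le_right _ _)) ht0 ht1.le) hz)
  · intro h2
    obtain ⟨j, -, h0, h1, h3⟩ := (S.mem_iff x).1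
      (S.isClosed.frontier_subset (flatPart_subset_frontier _ _ _ hx))
    rw [hxz, S.strictMono.le_iff_le] at h1 h3
    rcases (show j = i ∨ j = i + 1 by omega) with rfl | rfl
    · exact h0
    · exact absurd h0 h2

/-- A connected flat piece of an interface stays in one of the two rectangles. -/
lemma notMem_inner_of_component {i : ℕ} (hi : i + 1 < S.k) {d : Fin 4} (h : S.sgn i d ≠ 0) :
    ∀ x ∈ connectedComponentIn (flatPart P up (S.z (i + 1))) (S.stripPt i d),
      x ∈ prism (S.outer i d) ∧ x ∉ prism (S.inner i d) := by
  have hiff : ∀ x ∈ flatPart P up (S.z (i + 1)),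
      (x ∈ prism (S.outer i d) ↔ x ∉ prism (S.inner i d)) := by
    intro x hx
    have := mem_prism_iff_of_flatPart hi hx
    rcases sgn_cases h with ⟨-, e1, e2⟩ | ⟨-, e1, e2⟩ <;> rw [e1, e2]
    · exact this
    · tauto
  have hsub := connectedComponentIn_subset (flatPart P up (S.z (i + 1))) (S.stripPt i d)
  have hnot : ∀ x ∈ connectedComponentIn (flatPart P up (S.z (i + 1))) (S.stripPt i d),
      x ∉ prism (S.inner i d) := by
    intro x hx hxB
    have hs := stripPt_mem hi h
    have hsB : S.stripPt i d ∉ prism (S.inner i d) := fun h' => absurd (h' d) (not_le.2 hs.2.2)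
    obtain ⟨q, hq, hq1, hq2⟩ := isPreconnected_connectedComponentIn _ _
      (isClosed_prism (S.inner i d)).isOpen_compl (isClosed_prism (S.outer i d)).isOpen_compl
      (fun q hq => by
        by_cases hqB : q ∈ prism (S.inner i d)
        · exact Or.inr fun hqA => (hiff q (hsub hq)).1 hqA hqB
        · exact Or.inl hqB)
      ⟨_, mem_connectedComponentIn (stripPt_mem_flatPart hi h), hsB⟩
      ⟨x, hx, fun hxA => (hiff x (hsub hx)).1 hxA hxB⟩
    exact hq2 ((hiff q (hsub hq)).2 hq1)
  exact fun x hx => ⟨(hiff x (hsub hx)).2 (hnot x hx), hnot x hx⟩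

lemma stripPt_mem_component_of_eq {i : ℕ} (hi : i + 1 < S.k) {d d' : Fin 4} (h : S.sgn i d ≠ 0)
    (h' : S.sgn i d' ≠ 0) (heq : S.stripFace i d = S.stripFace i d') :
    S.stripPt i d' ∈ connectedComponentIn (flatPart P up (S.z (i + 1))) (S.stripPt i d) := by
  rw [component_eq_of_faceAt_eq (stripPt_mem_flatPart hi h) heq]
  exact mem_connectedComponentIn (stripPt_mem_flatPart hi h')

/-- Parts of a floor and of a ceiling lie in different faces. -/
lemma stripFace_ne_of_sgn_ne {i : ℕ} (hi : i + 1 < S.k) {d d' : Fin 4} (h : S.sgn i d ≠ 0)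
    (h' : S.sgn i d' ≠ 0) (hne : S.sgn i d ≠ S.sgn i d') : S.stripFace i d ≠ S.stripFace i d' := by
  intro heq
  have h1 := (notMem_inner_of_component hi h _ (stripPt_mem_component_of_eq hi h h' heq)).2
  refine h1 ?_
  have h2 := openPrism_subset_prism _ (stripPt_mem hi h').2.1
  have h3 : S.outer i d' = S.inner i d := by
    rcases sgn_cases h with ⟨a1, a2, a3⟩ | ⟨a1, a2, a3⟩ <;>
      rcases sgn_cases h' with ⟨b1, b2, b3⟩ | ⟨b1, b2, b3⟩
    · exact absurd (a1.trans b1.symm) hne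
    · rw [b2, a3]
    · rw [b2, a3]
    · exact absurd (a1.trans b1.symm) hne
  rwa [h3] at h2

/-- Protrusions of the same rectangle on two opposite sides lie in different faces if it protrudes
on none of the other two sides. -/
lemma stripFace_ne_opposite {i : ℕ} (hi : i + 1 < S.k) {d : Fin 4} (h : S.sgn i d ≠ 0)
    (h2 : S.sgn i (d + 2) = S.sgn i d) (h1 : S.sgn i (d + 1) ≠ S.sgn i d)
    (h3 : S.sgn i (d + 3) ≠ S.sgn i d) : S.stripFace i d ≠ S.stripFace i (d + 2) := by
  intro heq
  have h' : S.sgn i (d + 2) ≠ 0 := h2.trans_ne h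
  have hmem := stripPt_mem_component_of_eq hi h h' heq
  have hinner : S.inner i (d + 2) = S.inner i d := by
    rcases sgn_cases h with ⟨a1, a2, a3⟩ | ⟨a1, a2, a3⟩ <;>
      rcases sgn_cases h' with ⟨b1, b2, b3⟩ | ⟨b1, b2, b3⟩
    · rw [b3, a3]
    · rw [a1, b1] at h2; exact absurd h2 (by decide)
    · rw [a1, b1] at h2; exact absurd h2 (by decide)
    · rw [b3, a3]
  have hlt := (stripPt_mem hi h').2.2
  rw [hinner] at hlt
  obtain ⟨q, -, hq1, hq2⟩ := isPreconnected_connectedComponentIn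
    {x : E3 | S.inner i d d < reach d x} {x : E3 | S.inner i d (d + 2) < reach (d + 2) x}
    (isOpen_lt continuous_const (continuous_reach d))
    (isOpen_lt continuous_const (continuous_reach (d + 2)))
    (fun x hx => by
      obtain ⟨hA, hB⟩ := notMem_inner_of_component hi h x hx
      by_contra hcon
      rw [mem_union, not_or] at hcon
      exact hB ((forall_side d).2 ⟨not_lt.1 hcon.1, (hA _).trans (outer_le_inner h h1),
        not_lt.1 hcon.2, (hA _).trans (outer_le_inner h h3)⟩))
    ⟨_, mem_connectedComponentIn (stripPt_mem_flatPart hi h), (stripPt_mem hi h).2.2⟩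
    ⟨_, hmem, hlt⟩
  have hq1 : S.inner i d d < reach d q := hq1
  have hq2 : S.inner i d (d + 2) < reach (d + 2) q := hq2
  rw [reach_add_two] at hq2
  linarith [pos_inner hi h d]

/-! ### The bottom and top faces -/

lemma exists_bottomFace (S : Stack P) : ∃ F ∈ faces P, F.Nonempty ∧ ∀ x ∈ F, x 2 = S.z 0 := by
  obtain ⟨x, hx, hxz⟩ := exists_mem_openPrism (S.pos 0 S.k_pos) (S.z 0)
  have hfr : plane up (S.z 0) ∩ openPrism (S.e 0) ⊆ frontier P := by
    rintro y ⟨hy, hyA⟩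
    have hyz := mem_plane_up.1 hy
    exact frontier_of_bottom (brick_subset S.k_pos ⟨openPrism_subset_prism _ hyA, hyz.ge, by
      rw [hyz]; exact (S.z_lt 0).le⟩) hyz
  have hflat := (face_of_convex (isOpen_openPrism _) (convex_openPrism _) hfr
    ⟨mem_plane_up.2 hxz, hx⟩).1
  exact ⟨_, faceAt_mem_faces up_ne_zero hflat,
    ⟨x, subset_closure (mem_connectedComponentIn hflat)⟩,
    fun y hy => mem_plane_up.1 (faceAt_subset_plane hy)⟩

lemma top_frontier (S : Stack P) : plane up (S.z S.k) ∩ openPrism (S.e (S.k - 1)) ⊆ frontier P := by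
  have hk := S.k_pos
  have hk1 : S.k - 1 + 1 = S.k := by omega
  rintro y ⟨hy, hyA⟩
  have hyz := mem_plane_up.1 hy
  have hz := S.z_lt (S.k - 1)
  rw [hk1] at hz
  refine frontier_of_notMem_above (S := S) (i := S.k - 1) (brick_subset (i := S.k - 1) (by omega)
    ⟨openPrism_subset_prism _ hyA, by rw [hyz]; exact hz.le, by rw [hk1, hyz]⟩)
    (by rw [hk1, hyz]) fun h => by omega

lemma exists_topFace (S : Stack P) : ∃ F ∈ faces P, F.Nonempty ∧ ∀ x ∈ F, x 2 = S.z S.k := by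
  have hk := S.k_pos
  obtain ⟨x, hx, hxz⟩ := exists_mem_openPrism (S.pos (S.k - 1) (by omega)) (S.z S.k)
  have hflat := (face_of_convex (isOpen_openPrism _) (convex_openPrism _) S.top_frontier
    ⟨mem_plane_up.2 hxz, hx⟩).1
  exact ⟨_, faceAt_mem_faces up_ne_zero hflat,
    ⟨x, subset_closure (mem_connectedComponentIn hflat)⟩,
    fun y hy => mem_plane_up.1 (faceAt_subset_plane hy)⟩

lemma exists_top_mem (S : Stack P) : ∃ x ∈ P, x 2 = S.z S.k := by
  obtain ⟨F, ⟨n, c, -, y, -, rfl⟩, ⟨x, hx⟩, h⟩ := S.exists_topFace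
  exact ⟨x, S.isClosed.frontier_subset (faceAt_subset_frontier hx), h x hx⟩

lemma not_isTopmostFace (S : Stack P) {F : Set E3} {x : E3} (hx : x ∈ F) (h : x 2 < S.z S.k) :
    ¬ IsTopmostFace P F := by
  intro hF
  obtain ⟨y, hy, hyz⟩ := S.exists_top_mem
  linarith [hF.2 x hx y hy]

/-- There is only one topmost face. -/
lemma topmostFace_unique (S : Stack P) {F F' : Set E3} (hF : IsTopmostFace P F)
    (hF' : IsTopmostFace P F') : F = F' := by
  have key : ∀ F, IsTopmostFace P F →
      ∃ y ∈ openPrism (S.e (S.k - 1)), y 2 = S.z S.k ∧ F = faceAt P up (S.z S.k) y := by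
    rintro F ⟨⟨n, c, hn, y, hy, rfl⟩, htop⟩
    obtain ⟨x₀, hx₀, hx₀z⟩ := S.exists_top_mem
    have hheight : ∀ x ∈ faceAt P n c y, x 2 = S.z S.k := fun x hx => le_antisymm
      (S.height_le (S.isClosed.frontier_subset (faceAt_subset_frontier hx)))
      (hx₀z ▸ htop x hx x₀ hx₀)
    obtain ⟨ε, hε, hb⟩ := exists_ball_subset_component (mem_connectedComponentIn hy)
    have hpl := plane_eq_of_subset hn
      (plane_subset_of_ball hε hy.1 fun x hx => hheight x (subset_closure (hb hx)))
    rw [← plane_up] at hpl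
    have hyz : y 2 = S.z S.k := hheight y (subset_closure (mem_connectedComponentIn hy))
    refine ⟨y, fun d => ?_, hyz, by rw [faceAt, flatPart_congr hpl]⟩
    obtain ⟨t, ht, ht0⟩ := ((eventually_add_smul_mem Metric.isOpen_ball
      (Metric.mem_ball_self hε) (sideNormal d)).and self_mem_nhdsWithin).exists
    have ht0 : (0 : ℝ) < t := ht0
    have hyt : (y + t • sideNormal d) 2 = S.z S.k := by simp [hyz]
    have hmem := S.isClosed.frontier_subset (flatPart_subset_frontier _ _ _
      (connectedComponentIn_subset _ _ (hb ⟨by rw [hpl]; exact mem_plane_up.2 hyt, ht⟩)))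
    obtain ⟨j, hj, h1, h2, h3⟩ := (S.mem_iff _).1 hmem
    rw [hyt, S.strictMono.le_iff_le] at h3
    obtain rfl : j = S.k - 1 := by omega
    have := h1 d
    rw [reach_add, reach_smul, reach_sideNormal] at this
    linarith
  obtain ⟨y, hy, hyz, rfl⟩ := key F hF
  obtain ⟨y', hy', hyz', rfl⟩ := key F' hF'
  have hmem := (face_of_convex (isOpen_openPrism _) (convex_openPrism _) S.top_frontier
    ⟨mem_plane_up.2 hyz, hy⟩).2.1 ⟨mem_plane_up.2 hyz', hy'⟩
  rw [faceAt, faceAt, connectedComponentIn_eq hmem]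

end Stack

/-! ### Counting the faces contributed by an interface -/

/-- For the sign pattern `ε` of an interface, one side for each horizontal face: the first side of
each group of protruding sides that lie in a common face. Two sides are in the same group when they
have the same sign, unless they are opposite and both of the other sides have a different sign. -/
def stripReps (ε : Fin 4 → SignType) : Finset (Fin 4) :=
  Finset.univ.filter fun d => ε d ≠ 0 ∧ ∀ d' < d, ε d' = ε d →
    d = d' + 2 ∧ ε (d' + 1) ≠ ε d ∧ ε (d' + 3) ≠ ε d

/-- The number of faces that an interface with sign pattern `ε` adds: one wall for each side that is
not flush, and the horizontal faces. -/
def newFaces (ε : Fin 4 → SignType) : ℕ :=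
  (Finset.univ.filter fun d => ε d ≠ 0).card + (stripReps ε).card

lemma forall_signs {p : (Fin 4 → SignType) → Prop} (h : ∀ a b c d, p ![a, b, c, d])
    (ε : Fin 4 → SignType) : p ε := by
  have := h (ε 0) (ε 1) (ε 2) (ε 3)
  convert this using 1
  ext i; fin_cases i <;> rfl

lemma two_le_newFaces (ε : Fin 4 → SignType) : ε ≠ 0 → 2 ≤ newFaces ε := by
  revert ε
  exact forall_signs (by decide +kernel)

lemma exists_unique_side_of_newFaces_eq_two (ε : Fin 4 → SignType) :
    newFaces ε = 2 → ∃ d₀, ∀ d ≠ d₀, ε d = 0 := by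
  revert ε
  exact forall_signs (by decide +kernel)

/-- The combinatorial core. If two consecutive interfaces add at most six faces, then either some
wall of the brick between them reaches both neighbouring bricks, or the brick between them contains
the upper brick's rectangle and has a floor that reaches a side shared with the upper brick. -/
lemma signs_of_newFaces_le_six (ε ε' : Fin 4 → SignType) (h : ε ≠ 0) (h' : ε' ≠ 0)
    (hle : newFaces ε + newFaces ε' ≤ 6) :
    (∃ d, 0 ≤ ε d ∧ ε' d ≤ 0) ∨ ((∀ d, 0 ≤ ε' d) ∧ ∃ d, ε d = -1 ∧ ε' d = 0) := by
  have h4 : newFaces ε ≤ 4 := by have := two_le_newFaces ε' h'; omega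
  revert ε'
  revert ε
  refine forall_signs fun a b c d h h4 => forall_signs fun a' b' c' d' h' hle => ?_
  revert a b c d
  have key : ∀ a b c d : SignType, ![a, b, c, d] ≠ 0 → newFaces ![a, b, c, d] ≤ 4 →
      ∀ a' b' c' d' : SignType, ![a', b', c', d'] ≠ 0 →
      newFaces ![a, b, c, d] + newFaces ![a', b', c', d'] ≤ 6 →
      (∃ i, 0 ≤ ![a, b, c, d] i ∧ ![a', b', c', d'] i ≤ 0) ∨
        ((∀ i, 0 ≤ ![a', b', c', d'] i) ∧ ∃ i, ![a, b, c, d] i = -1 ∧ ![a', b', c', d'] i = 0) := by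
    decide +kernel
  exact fun a b c d h h4 hle => key a b c d h h4 a' b' c' d' h' hle

namespace Stack

variable {P : Set E3} {S : Stack P}

lemma sgn_ne_zero {i : ℕ} (hi : i + 1 < S.k) : S.sgn i ≠ 0 := fun h =>
  S.ne i hi (funext fun d => sgn_eq_zero.1 (congrFun h d))

lemma exists_sgn_ne_zero {i : ℕ} (hi : i + 1 < S.k) : ∃ d, S.sgn i d ≠ 0 :=
  Function.ne_iff.1 (sgn_ne_zero hi)

lemma wallStart_succ {i : ℕ} {d : Fin 4} : S.WallStart (i + 1) d ↔ S.sgn i d ≠ 0 := by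
  rw [Ne, sgn_eq_zero, WallStart]
  simp

/-- Distinct representatives of an interface give distinct horizontal faces. -/
lemma stripFace_injOn {i : ℕ} (hi : i + 1 < S.k) {d d' : Fin 4} (h : d ∈ stripReps (S.sgn i))
    (h' : d' ∈ stripReps (S.sgn i)) (heq : S.stripFace i d = S.stripFace i d') : d = d' := by
  have key : ∀ d d', d ∈ stripReps (S.sgn i) → d' ∈ stripReps (S.sgn i) → d' < d →
      S.stripFace i d ≠ S.stripFace i d' := by
    intro d d' hd hd' hlt
    simp only [stripReps, Finset.mem_filter, Finset.mem_univ, true_and] at hd hd'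
    by_cases hs : S.sgn i d' = S.sgn i d
    · obtain ⟨rfl, h1, h3⟩ := hd.2 d' hlt hs
      rw [← hs] at h1 h3
      exact (stripFace_ne_opposite hi hd'.1 hs.symm h1 h3).symm
    · exact stripFace_ne_of_sgn_ne hi hd.1 hd'.1 (Ne.symm hs)
  rcases lt_trichotomy d d' with hlt | rfl | hlt
  · exact absurd heq.symm (key _ _ h' h hlt)
  · rfl
  · exact absurd heq (key _ _ h h' hlt)

/-- A lower bound for the number of faces: the bottom, the top, the four walls of the lowest brick,
and the faces added by the interfaces. -/
lemma le_card_faces (S : Stack P) (Φ : Finset (Set E3)) (hΦ : ∀ F, F ∈ Φ ↔ F ∈ faces P) :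
    6 + ∑ i ∈ Finset.range (S.k - 1), newFaces (S.sgn i) ≤ Φ.card := by
  classical
  obtain ⟨m, hm⟩ : ∃ m, S.k = m + 1 := ⟨S.k - 1, by have := S.k_pos; omega⟩
  obtain ⟨Fb, hFb, hFbne, hFbz⟩ := S.exists_bottomFace
  obtain ⟨Ft, hFt, hFtne, hFtz⟩ := S.exists_topFace
  set V : Finset (Σ _ : ℕ, Fin 4) := (Finset.range S.k).sigma fun i =>
    Finset.univ.filter fun d => S.WallStart i d with hV
  set H : Finset (Σ _ : ℕ, Fin 4) := (Finset.range m).sigma fun i => stripReps (S.sgn i) with hH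
  have hVmem : ∀ x ∈ V, x.1 < S.k ∧ S.WallStart x.1 x.2 := fun x hx => by
    rw [hV, Finset.mem_sigma, Finset.mem_range, Finset.mem_filter] at hx
    exact ⟨hx.1, hx.2.2⟩
  have hHmem : ∀ x ∈ H, x.1 + 1 < S.k ∧ x.2 ∈ stripReps (S.sgn x.1) := fun x hx => by
    rw [hH, Finset.mem_sigma, Finset.mem_range] at hx
    exact ⟨by omega, hx.2⟩
  have hrep : ∀ {ε : Fin 4 → SignType} {d : Fin 4}, d ∈ stripReps ε → ε d ≠ 0 := fun h => by
    simp only [stripReps, Finset.mem_filter] at h; exact h.2.1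
  set W := V.image fun x => S.wallFace x.1 x.2 with hW
  set T := H.image fun x => S.stripFace x.1 x.2 with hT
  have hWcard : W.card = V.card := Finset.card_image_of_injOn fun x hx y hy h => by
    obtain ⟨h1, h2⟩ := wallFace_injective (hVmem x hx).1 (hVmem y hy).1 (hVmem x hx).2
      (hVmem y hy).2 h
    exact Sigma.ext h1 (heq_of_eq h2)
  have hTcard : T.card = H.card := Finset.card_image_of_injOn fun x hx y hy h => by
    obtain ⟨hx1, hx2⟩ := hHmem x hx
    obtain ⟨hy1, hy2⟩ := hHmem y hy
    obtain ⟨q, hq, -⟩ := exists_mem_stripFace hx1 (hrep hx2)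
    have h1 : x.1 = y.1 := by
      have e1 := height_of_mem_stripFace hq
      have h' : S.stripFace x.1 x.2 = S.stripFace y.1 y.2 := h
      rw [h'] at hq
      have e2 := height_of_mem_stripFace hq
      have := S.strictMono.injective (e1.symm.trans e2)
      omega
    obtain ⟨i, d⟩ := x
    obtain ⟨j, d'⟩ := y
    simp only at h1 h hx1 hx2 hy2
    subst h1
    exact Sigma.ext rfl (heq_of_eq (stripFace_injOn hx1 hx2 hy2 h))
  have hwall : ∀ F ∈ W, ∃ x ∈ F, ∃ y ∈ F, x 2 < y 2 := by
    intro F hF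
    obtain ⟨⟨i, d⟩, hx, rfl⟩ := Finset.mem_image.1 hF
    have hi := (hVmem _ hx).1
    have h1 := S.pos' hi d
    have h2 := S.z_lt i
    have h3 : -S.e i (d + 3) ≤ S.e i (d + 1) := by linarith
    exact ⟨_, pt_mem_wallFace hi h3 le_rfl le_rfl h2.le,
      _, pt_mem_wallFace hi h3 le_rfl h2.le le_rfl,
      by rw [pt_two, pt_two]; exact h2⟩
  have hWT : Disjoint W T := by
    rw [Finset.disjoint_left]
    intro F hF hF'
    obtain ⟨x, hx, y, hy, hlt⟩ := hwall F hF
    obtain ⟨w, -, rfl⟩ := Finset.mem_image.1 hF'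
    rw [height_of_mem_stripFace hx, height_of_mem_stripFace hy] at hlt
    exact lt_irrefl _ hlt
  have hflat : ∀ {F : Set E3} {h : ℝ}, (∀ x ∈ F, x 2 = h) → F ∉ W := fun {F h} hF hFW => by
    obtain ⟨x, hx, y, hy, hlt⟩ := hwall F hFW
    rw [hF x hx, hF y hy] at hlt
    exact lt_irrefl _ hlt
  have hstrip : ∀ {F : Set E3} {j : ℕ}, F.Nonempty → (∀ x ∈ F, x 2 = S.z j) → F ∈ T →
      0 < j ∧ j < S.k := fun {F j} hne hF hFT => by
    obtain ⟨w, hw, rfl⟩ := Finset.mem_image.1 hFT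
    obtain ⟨x, hx⟩ := hne
    have := S.strictMono.injective ((hF x hx).symm.trans (height_of_mem_stripFace hx))
    have := (hHmem w hw).1
    omega
  have hbt : Fb ≠ Ft := fun h => by
    obtain ⟨x, hx⟩ := hFbne
    have := S.strictMono.injective ((hFbz x hx).symm.trans (hFtz x (h ▸ hx)))
    have := S.k_pos
    omega
  have hdisj : Disjoint (W ∪ T) {Fb, Ft} := by
    rw [Finset.disjoint_right]
    intro F hF hF'
    rw [Finset.mem_insert, Finset.mem_singleton] at hF
    rw [Finset.mem_union] at hF'
    rcases hF with rfl | rfl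
    · exact absurd (hstrip hFbne hFbz (hF'.resolve_left (hflat hFbz))).1 (lt_irrefl _)
    · exact absurd (hstrip hFtne hFtz (hF'.resolve_left (hflat hFtz))).2 (lt_irrefl _)
  have hsub : (W ∪ T) ∪ {Fb, Ft} ⊆ Φ := by
    intro F hF
    rw [Finset.mem_union, Finset.mem_union, Finset.mem_insert, Finset.mem_singleton] at hF
    rw [hΦ]
    rcases hF with (hF | hF) | rfl | rfl
    · obtain ⟨x, hx, rfl⟩ := Finset.mem_image.1 hF
      exact wallFace_mem_faces (hVmem x hx).1 _
    · obtain ⟨x, hx, rfl⟩ := Finset.mem_image.1 hF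
      exact stripFace_mem_faces (hHmem x hx).1 (hrep (hHmem x hx).2)
    · exact hFb
    · exact hFt
  have hcard := Finset.card_le_card hsub
  rw [Finset.card_union_of_disjoint hdisj, Finset.card_union_of_disjoint hWT, hWcard, hTcard,
    Finset.card_pair hbt] at hcard
  have hVcard : V.card =
      (∑ i ∈ Finset.range m, (Finset.univ.filter fun d => S.sgn i d ≠ 0).card) + 4 := by
    rw [hV, Finset.card_sigma, hm, Finset.sum_range_succ']
    congr 1
    · refine Finset.sum_congr rfl fun i _ => ?_
      congr 1
      exact Finset.filter_congr fun d _ => wallStart_succ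
    · have hall : (Finset.univ.filter fun d => S.WallStart 0 d) = Finset.univ :=
        Finset.filter_true_of_mem fun d _ => (Or.inl rfl : S.WallStart 0 d)
      rw [hall]
      simp
  have hHcard : H.card = ∑ i ∈ Finset.range m, (stripReps (S.sgn i)).card := by
    rw [hH, Finset.card_sigma]
  have hsum : ∑ i ∈ Finset.range (S.k - 1), newFaces (S.sgn i) =
      (∑ i ∈ Finset.range m, (Finset.univ.filter fun d => S.sgn i d ≠ 0).card) +
        ∑ i ∈ Finset.range m, (stripReps (S.sgn i)).card := by
    rw [show S.k - 1 = m by omega, ← Finset.sum_add_distrib]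
    rfl
  omega

/-! ### Guarding runs of bricks -/

/-- Every point of the `i`-th brick is visible from `F`. -/
def Sees (S : Stack P) (F : Set E3) (i : ℕ) : Prop :=
  ∀ y ∈ S.brick i, ∃ x ∈ F, segment ℝ x y ⊆ P

lemma sees_of_mem {F : Set E3} {i : ℕ} (hi : i < S.k) {x : E3} (hx : x ∈ F) (hxi : x ∈ S.brick i) :
    S.Sees F i := fun _ hy =>
  ⟨x, hx, ((S.convex_brick i).segment_subset hxi hy).trans (brick_subset hi)⟩

lemma sees_stripFace {i : ℕ} (hi : i + 1 < S.k) {d : Fin 4} (h : S.sgn i d ≠ 0) :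
    S.Sees (S.stripFace i d) i ∧ S.Sees (S.stripFace i d) (i + 1) := by
  obtain ⟨x, hx, h1, h2⟩ := exists_mem_stripFace hi h
  exact ⟨sees_of_mem (by omega) hx h1, sees_of_mem hi hx h2⟩

lemma not_isTopmostFace_stripFace {i : ℕ} (hi : i + 1 < S.k) {d : Fin 4} (h : S.sgn i d ≠ 0) :
    ¬ IsTopmostFace P (S.stripFace i d) := by
  obtain ⟨x, hx, -⟩ := exists_mem_stripFace hi h
  refine S.not_isTopmostFace hx ?_
  rw [height_of_mem_stripFace hx]
  exact S.strictMono hi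

lemma pt_mem_brick {i : ℕ} (hi : i < S.k) (d : Fin 4) :
    pt d (S.e i d) (S.e i (d + 1)) (S.z i) ∈ S.brick i := by
  refine ⟨pt_mem_prism.2 ⟨⟨le_rfl, ?_⟩, le_rfl, ?_⟩, ?_, ?_⟩
  · linarith [S.pos i hi d]
  · linarith [S.pos' hi d]
  · rw [pt_two]
  · rw [pt_two]; exact (S.z_lt i).le

lemma sees_wallFace {i : ℕ} (hi : i < S.k) (d : Fin 4) : S.Sees (S.wallFace i d) i :=
  sees_of_mem hi (mem_wallFace hi (pt_mem_brick hi d) (by simp)) (pt_mem_brick hi d)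

lemma not_isTopmostFace_wallFace {i : ℕ} (hi : i < S.k) (d : Fin 4) :
    ¬ IsTopmostFace P (S.wallFace i d) := by
  refine S.not_isTopmostFace (mem_wallFace hi (pt_mem_brick hi d) (by simp)) ?_
  rw [pt_two]
  exact S.strictMono hi

lemma exists_common_position {i : ℕ} (hi : i + 1 < S.k) (d : Fin 4) :
    ∃ t, (t ≤ S.e i (d + 1) ∧ -S.e i (d + 3) ≤ t) ∧
      (t ≤ S.e (i + 1) (d + 1) ∧ -S.e (i + 1) (d + 3) ≤ t) := by
  have p1 := S.pos' (show i < S.k by omega) d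
  have p2 := S.pos' hi d
  have p3 := S.overlap i hi (d + 1)
  have p4 := S.overlap' hi (d + 1)
  rw [add_one_add_two] at p3 p4
  refine ⟨min (S.e i (d + 1)) (S.e (i + 1) (d + 1)), ⟨min_le_left _ _, le_min ?_ ?_⟩,
    min_le_right _ _, le_min ?_ ?_⟩ <;> linarith

/-- A wall that the lower brick reaches sees the lower brick. -/
lemma sees_wallFace_below {i : ℕ} (hi : i + 1 < S.k) {d : Fin 4} (h : 0 ≤ S.sgn i d) :
    S.Sees (S.wallFace (i + 1) d) i := by
  rw [sgn, sign_nonneg_iff, sub_nonneg] at h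
  obtain ⟨t, ⟨h1, h2⟩, h3, h4⟩ := exists_common_position hi d
  refine sees_of_mem (by omega) (pt_mem_wallFace hi h4 h3 le_rfl (S.z_lt _).le)
    ⟨pt_mem_prism.2 ⟨⟨h, ?_⟩, h1, h2⟩, ?_, ?_⟩
  · linarith [S.overlap' hi d]
  · rw [pt_two]; exact (S.z_lt i).le
  · rw [pt_two]

/-- A wall that the upper brick reaches sees the upper brick. -/
lemma sees_wallFace_above {i : ℕ} (hi : i + 1 < S.k) {d : Fin 4} (h : S.sgn i d ≤ 0) :
    S.Sees (S.wallFace i d) (i + 1) := by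
  rw [sgn, sign_nonpos_iff, sub_nonpos] at h
  obtain ⟨t, ⟨h1, h2⟩, h3, h4⟩ := exists_common_position hi d
  refine sees_of_mem hi (pt_mem_wallFace (i := i) (by omega) h2 h1 (S.z_lt _).le le_rfl)
    ⟨pt_mem_prism.2 ⟨⟨h, ?_⟩, h3, h4⟩, ?_, ?_⟩
  · linarith [S.overlap i hi d]
  · rw [pt_two]
  · rw [pt_two]; exact (S.z_lt _).le

/-- A floor at the interface of bricks `i` and `i + 1` that extends to a side shared by the bricks
`i + 1` and `i + 2` sees brick `i + 2`, provided the rectangle of brick `i + 2` is contained in that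
of brick `i + 1`. -/
lemma sees_stripFace_above {i : ℕ} (hi : i + 2 < S.k) {d : Fin 4} (h : S.sgn i d = -1)
    (h' : S.sgn (i + 1) d = 0) (hsub : ∀ d, 0 ≤ S.sgn (i + 1) d) :
    S.Sees (S.stripFace i d) (i + 2) := by
  have hi' : i + 1 < S.k := by omega
  have hne : S.sgn i d ≠ 0 := by rw [h]; decide
  have hle : prism (S.e (i + 2)) ⊆ prism (S.e (i + 1)) := fun x hx d => by
    have := hsub d
    rw [sgn, sign_nonneg_iff, sub_nonneg] at this
    exact (hx d).trans this
  have hz1 := S.z_lt (i + 1)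
  have hz2 := S.z_lt (i + 1 + 1)
  rw [sgn_eq_zero] at h'
  have hq : pt d (S.e (i + 1 + 1) d) (S.e (i + 1 + 1) (d + 1)) (S.z (i + 1)) ∈
      prism (S.e (i + 2)) := by
    refine pt_mem_prism.2 ⟨⟨le_rfl, ?_⟩, le_rfl, ?_⟩
    · linarith [S.pos (i + 2) hi d]
    · linarith [S.pos' hi d]
  have houter : S.outer i d = S.e (i + 1) ∧ S.inner i d = S.e i := by
    rcases sgn_cases hne with ⟨h1, -, -⟩ | ⟨-, h2, h3⟩
    · rw [h] at h1; exact absurd h1 (by decide)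
    · exact ⟨h2, h3⟩
  have hqF : pt d (S.e (i + 1 + 1) d) (S.e (i + 1 + 1) (d + 1)) (S.z (i + 1)) ∈
      S.stripFace i d := by
    refine mem_stripFace hi' hne (by rw [houter.1]; exact hle hq) ?_ (pt_two _ _ _ _)
    rw [reach_pt, houter.2, ← h']
    exact (sgn_eq_neg_one.1 h).le
  rintro y ⟨hy, hy1, hy2⟩
  refine ⟨_, hqF, fun x hx => ?_⟩
  have hxe := (convex_prism _).segment_subset hq hy hx
  obtain ⟨a, b, ha, hb, hab, rfl⟩ := hx
  have hheight : (a • pt d (S.e (i + 1 + 1) d) (S.e (i + 1 + 1) (d + 1)) (S.z (i + 1)) + b • y) 2 =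
      a * S.z (i + 1) + b * y 2 := by simp
  have hy1 : S.z (i + 1 + 1) ≤ y 2 := hy1
  have hy2 : y 2 ≤ S.z (i + 1 + 1 + 1) := hy2
  have hb' : b = 1 - a := by linarith
  generalize a • pt d (S.e (i + 1 + 1) d) (S.e (i + 1 + 1) (d + 1)) (S.z (i + 1)) + b • y = x
    at hxe hheight ⊢
  rw [hb'] at hheight hb
  have hlow : S.z (i + 1) ≤ x 2 := by rw [hheight]; nlinarith
  have hhigh : x 2 ≤ S.z (i + 1 + 1 + 1) := by rw [hheight]; nlinarith
  rcases le_total (x 2) (S.z (i + 1 + 1)) with hc | hc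
  · exact brick_subset hi' ⟨hle hxe, hlow, hc⟩
  · exact brick_subset hi ⟨hxe, hc, hhigh⟩

/-- If two consecutive interfaces add at most six faces, then some face sees all three bricks. -/
lemma exists_face_three {s : ℕ} (hs : s + 2 < S.k)
    (hle : newFaces (S.sgn s) + newFaces (S.sgn (s + 1)) ≤ 6) :
    ∃ F ∈ faces P, ¬ IsTopmostFace P F ∧ S.Sees F s ∧ S.Sees F (s + 1) ∧ S.Sees F (s + 2) := by
  have hs1 : s + 1 < S.k := by omega
  rcases signs_of_newFaces_le_six _ _ (sgn_ne_zero hs1) (sgn_ne_zero hs) hle with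
    ⟨d, h1, h2⟩ | ⟨h1, d, h2, h3⟩
  · exact ⟨_, wallFace_mem_faces hs1 d, not_isTopmostFace_wallFace hs1 d,
      sees_wallFace_below hs1 h1, sees_wallFace hs1 d, sees_wallFace_above hs h2⟩
  · have hne : S.sgn s d ≠ 0 := by rw [h2]; decide
    exact ⟨_, stripFace_mem_faces hs1 hne, not_isTopmostFace_stripFace hs1 hne,
      (sees_stripFace hs1 hne).1, (sees_stripFace hs1 hne).2, sees_stripFace_above hs h2 h3 h1⟩

/-- If each of three consecutive interfaces adds two faces only, then a single side changes at each
of them, so that some wall runs along all four bricks. -/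
lemma exists_face_four {s : ℕ} (hs : s + 3 < S.k) (h0 : newFaces (S.sgn s) = 2)
    (h1 : newFaces (S.sgn (s + 1)) = 2) (h2 : newFaces (S.sgn (s + 2)) = 2) :
    ∃ F ∈ faces P, ¬ IsTopmostFace P F ∧ S.Sees F s ∧ S.Sees F (s + 1) ∧ S.Sees F (s + 2) ∧
      S.Sees F (s + 3) := by
  obtain ⟨d₀, hd₀⟩ := exists_unique_side_of_newFaces_eq_two _ h0
  obtain ⟨d₁, hd₁⟩ := exists_unique_side_of_newFaces_eq_two _ h1
  obtain ⟨d₂, hd₂⟩ := exists_unique_side_of_newFaces_eq_two _ h2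
  obtain ⟨d, hd0, hd1, hd2⟩ : ∃ d, d ≠ d₀ ∧ d ≠ d₁ ∧ d ≠ d₂ := by
    clear hd₀ hd₁ hd₂; revert d₀ d₁ d₂; decide
  have e0 := wallFace_succ (i := s) (by omega) (sgn_eq_zero.1 (hd₀ d hd0))
  have e1 := wallFace_succ (i := s + 1) (by omega) (sgn_eq_zero.1 (hd₁ d hd1))
  have e2 := wallFace_succ (i := s + 2) (by omega) (sgn_eq_zero.1 (hd₂ d hd2))
  have hs0 : s < S.k := by omega
  refine ⟨_, wallFace_mem_faces hs0 d, not_isTopmostFace_wallFace hs0 d, sees_wallFace hs0 d,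
    ?_, ?_, ?_⟩
  · rw [e0]; exact sees_wallFace (by omega) d
  · rw [e0, e1]; exact sees_wallFace (by omega) d
  · rw [e0, e1, e2]; exact sees_wallFace hs d

/-- From any brick `s` on, a single face sees a run of bricks `s, …, t` that either reaches the top
or is followed by an interface which, together with those inside the run, adds at least seven
faces. -/
lemma exists_face_run {s : ℕ} (hs : s < S.k) :
    ∃ t, s ≤ t ∧ t < S.k ∧ ∃ F ∈ faces P, ¬ IsTopmostFace P F ∧
      (∀ j, s ≤ j → j ≤ t → S.Sees F j) ∧
      (t + 1 = S.k ∨ 7 ≤ ∑ i ∈ Finset.Ico s (t + 1), newFaces (S.sgn i)) := by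
  have hsum : ∀ n, ∑ i ∈ Finset.Ico s (s + n + 1), newFaces (S.sgn i) =
      ∑ i ∈ Finset.Ico s (s + n), newFaces (S.sgn i) + newFaces (S.sgn (s + n)) := fun n =>
    Finset.sum_Ico_succ_top (by omega) _
  have h0 : ∑ i ∈ Finset.Ico s (s + 0), newFaces (S.sgn i) = 0 := by simp
  have s0 := hsum 0
  have s1 := hsum 1
  have s2 := hsum 2
  have s3 := hsum 3
  simp only [add_zero] at s0 h0
  rw [show s + 1 + 1 = s + 2 from rfl] at s1
  rw [show s + 2 + 1 = s + 3 from rfl] at s2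
  have a_ge : ∀ i, i + 1 < S.k → 2 ≤ newFaces (S.sgn i) := fun i hi =>
    two_le_newFaces _ (sgn_ne_zero hi)
  rcases Nat.lt_or_ge (s + 1) S.k with hs1 | hs1
  swap
  · exact ⟨s, le_rfl, hs, _, wallFace_mem_faces hs 0, not_isTopmostFace_wallFace hs 0,
      fun j h1 h2 => by obtain rfl : j = s := by omega
                        exact sees_wallFace hs 0, Or.inl (by omega)⟩
  have hge0 := a_ge s hs1
  by_cases hA : s + 2 = S.k ∨ 7 ≤ newFaces (S.sgn s) + newFaces (S.sgn (s + 1))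
  · obtain ⟨d, hd⟩ := exists_sgn_ne_zero hs1
    refine ⟨s + 1, by omega, hs1, _, stripFace_mem_faces hs1 hd, not_isTopmostFace_stripFace hs1 hd,
      fun j h1 h2 => ?_, ?_⟩
    · rcases (show j = s ∨ j = s + 1 by omega) with rfl | rfl
      · exact (sees_stripFace hs1 hd).1
      · exact (sees_stripFace hs1 hd).2
    · rcases hA with hA | hA
      · exact Or.inl hA
      · right; rw [show s + 1 + 1 = s + 2 from rfl]; omega
  push Not at hA
  have hs2 : s + 2 < S.k := by omega
  have hge1 := a_ge (s + 1) hs2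
  by_cases hB : s + 3 = S.k ∨
      7 ≤ newFaces (S.sgn s) + newFaces (S.sgn (s + 1)) + newFaces (S.sgn (s + 2))
  · obtain ⟨F, hF, hFt, f0, f1, f2⟩ := exists_face_three hs2 (by omega)
    refine ⟨s + 2, by omega, hs2, F, hF, hFt, fun j h1 h2 => ?_, ?_⟩
    · rcases (show j = s ∨ j = s + 1 ∨ j = s + 2 by omega) with rfl | rfl | rfl <;> assumption
    · rcases hB with hB | hB
      · exact Or.inl hB
      · right; rw [show s + 2 + 1 = s + 3 from rfl]; omega
  push Not at hB
  have hs3 : s + 3 < S.k := by omega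
  have hge2 := a_ge (s + 2) hs3
  obtain ⟨F, hF, hFt, f0, f1, f2, f3⟩ := exists_face_four hs3 (by omega) (by omega) (by omega)
  refine ⟨s + 3, by omega, hs3, F, hF, hFt, fun j h1 h2 => ?_, ?_⟩
  · rcases (show j = s ∨ j = s + 1 ∨ j = s + 2 ∨ j = s + 3 by omega) with rfl | rfl | rfl | rfl <;>
      assumption
  · by_cases hs4 : s + 3 + 1 = S.k
    · exact Or.inl hs4
    · have hge3 := a_ge (s + 3) (by omega)
      right; omega

/-- The greedy choice of runs. -/
lemma exists_guards_from (n : ℕ) : ∀ s < S.k, S.k - s = n → ∃ G : Finset (Set E3),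
    (∀ F ∈ G, F ∈ faces P ∧ ¬ IsTopmostFace P F) ∧
    G.card ≤ 1 + (∑ i ∈ Finset.Ico s (S.k - 1), newFaces (S.sgn i)) / 7 ∧
    ∀ j, s ≤ j → j < S.k → ∃ F ∈ G, S.Sees F j := by
  classical
  induction n using Nat.strong_induction_on with
  | _ n ih =>
    intro s hs hn
    obtain ⟨t, hst, ht, F, hF, hFt, hsee, hend⟩ := exists_face_run hs
    by_cases htk : t + 1 = S.k
    · refine ⟨{F}, ?_, by simp, fun j h1 h2 => ⟨F, by simp, hsee j h1 (by omega)⟩⟩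
      intro F' hF'
      rw [Finset.mem_singleton.1 hF']
      exact ⟨hF, hFt⟩
    · have h7 := hend.resolve_left htk
      obtain ⟨G, hG, hcard, hcov⟩ := ih (S.k - (t + 1)) (by omega) (t + 1) (by omega) rfl
      refine ⟨insert F G, ?_, ?_, fun j h1 h2 => ?_⟩
      · intro F' hF'
        rcases Finset.mem_insert.1 hF' with rfl | h
        · exact ⟨hF, hFt⟩
        · exact hG F' h
      · have h8 := Finset.card_insert_le F G
        have h9 := Finset.sum_Ico_consecutive (fun i => newFaces (S.sgn i))
          (show s ≤ t + 1 by omega) (show t + 1 ≤ S.k - 1 by omega)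
        omega
      · rcases Nat.lt_or_ge t j with h | h
        · obtain ⟨F', hF', hs'⟩ := hcov j h h2
          exact ⟨F', Finset.mem_insert_of_mem hF', hs'⟩
        · exact ⟨F, Finset.mem_insert_self _ _, hsee j h1 h⟩

end Stack

lemma guards_of_forall {P A : Set E3} (hcl : IsClosed P)
    (h : ∀ y ∈ P, ∃ x ∈ A, segment ℝ x y ⊆ P) : Guards P A := by
  refine Subset.antisymm ?_ ?_
  · rintro y ⟨x, -, hxy⟩
    by_contra hy
    refine hxy y (right_mem_segment ℝ x y) ?_
    rwa [hcl.isOpen_compl.interior_eq]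
  · intro y hy
    obtain ⟨x, hx, hxy⟩ := h y hy
    exact ⟨x, hx, fun p hp hpi => interior_subset hpi (hxy hp)⟩

end FaceGuards

theorem theorem4 (P : Set FaceGuards.E3) (hP : FaceGuards.IsTwoReflexOrthostack P) :
    (FaceGuards.faces P).Finite ∧
      ∃ G : Finset (Set FaceGuards.E3),
        (∀ F ∈ G, F ∈ FaceGuards.faces P ∧ ¬ FaceGuards.IsTopmostFace P F) ∧
        G.card = ((FaceGuards.faces P).ncard + 1) / 7 ∧
        FaceGuards.Guards P (⋃ F ∈ G, F) := by
  classical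
  have hfin := hP.toIsOrthogonalPolyhedron.finite_faces
  refine ⟨hfin, ?_⟩
  obtain ⟨S⟩ := hP.exists_stack
  have hcount := S.le_card_faces hfin.toFinset fun F => hfin.mem_toFinset
  rw [Set.ncard_eq_toFinset_card _ hfin]
  obtain ⟨G, hG, hcard, hcov⟩ := FaceGuards.Stack.exists_guards_from (S := S) _ 0 S.k_pos rfl
  rw [← Finset.range_eq_Ico] at hcard
  -- The greedy set may be too small; it is enlarged by arbitrary faces other than the topmost one.
  have htop : (hfin.toFinset.filter fun F => FaceGuards.IsTopmostFace P F).card ≤ 1 :=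
    Finset.card_le_one.2 fun F hF F' hF' =>
      S.topmostFace_unique (Finset.mem_filter.1 hF).2 (Finset.mem_filter.1 hF').2
  have hsplit := Finset.card_filter_add_card_filter_not (s := hfin.toFinset)
    (fun F => FaceGuards.IsTopmostFace P F)
  obtain ⟨G', hGG', hG'N, hG'card⟩ := Finset.exists_subsuperset_card_eq
    (s := G) (t := hfin.toFinset.filter fun F => ¬ FaceGuards.IsTopmostFace P F)
    (n := (hfin.toFinset.card + 1) / 7)
    (fun F hF => Finset.mem_filter.2 ⟨hfin.mem_toFinset.2 (hG F hF).1, (hG F hF).2⟩)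
    (by omega) (by omega)
  refine ⟨G', fun F hF => ?_, hG'card, FaceGuards.guards_of_forall S.isClosed fun y hy => ?_⟩
  · have := Finset.mem_filter.1 (hG'N hF)
    exact ⟨hfin.mem_toFinset.1 this.1, this.2⟩
  · obtain ⟨i, hi, hyi⟩ := FaceGuards.Stack.exists_brick (S := S) hy
    obtain ⟨F, hF, hsee⟩ := hcov i (Nat.zero_le i) hi
    obtain ⟨x, hx, hxy⟩ := hsee y hyi
    exact ⟨x, Set.mem_iUnion₂.2 ⟨F, hGG' hF, hx⟩, hxy⟩
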